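/- **Setting.** Let $N\ge 2$ and let $\Omega\subset\mathbb R^N$ be open, with $\overline\Omega$ the union of a finite set $\mathcal T$ of curved simplices, i.e. images of the standard $N$-simplex under diffeomorphisms that are smooth up to the boundary, any two of which meet in a common subsimplex or not at all. "Smooth on $\mathcal T$" means smooth on each $T\in\mathcal T$ up to its boundary (possibly multi-valued across elements). Let $\mathring{\mathscr F}$ and $\mathring{\mathscr E}$ be the sets of subsimplices of codimension 1 (facets $F$) and of codimension 2 (denoted $E$) that are not contained in $\partial\Omega$. For $E\in\mathring{\mathscr E}$ let $\mathscr F_E$ be the set of facets $F$ of which $E$ is a facet. Write $T_\pm$ for the two elements that contain $F\in\mathring{\mathscr F}$. A *Regge metric* is a positive definite symmetric 2-tensor field $g$, smooth on $\mathcal T$, such that $g(X,Y)$ is single-valued on each $F\in\mathring{\mathscr F}$ for all $X,Y$ tangent to $F$. For a Regge metric $g$, all of the following are computed in $T$ from $g|_T$: the Levi-Civita connection $\nabla$ (with $(\nabla A)(X,\dots)=(\nabla_XA)(\dots)$, $\nabla^2=\nabla\nabla$); the curvature $\mathcal R(X,Y,Z,W)=g(\nabla_X\nabla_YZ-\nabla_Y\nabla_XZ-\nabla_{[X,Y]}Z,W)$;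 the $g$-unit normal $\mathfrak n=\mathfrak n_F^T$ of a facet $F$ of $T$ pointing into $T$; the $g$-unit conormal $\mathfrak m=\mathfrak m_E^F$, tangent to $F$, orthogonal to $E$ and pointing from $E$ into $F$; and $I\!I^{\mathfrak n}(X,Y)=-g(\nabla_X\mathfrak n,Y)$ for $X,Y$ tangent to $F$. The brackets $\langle\cdot,\cdot\rangle$ denote the $g$-inner product of tensors, $\langle A,B\rangle=A_{i_1\dots i_k}g^{i_1j_1}\cdots g^{i_kj_k}B_{j_1\dots j_k}$, and $\omega_T,\omega_F,\omega_E$ the Riemannian volume forms. For a tensor $B^{\mathfrak n}$ on $F$ depending on the normal, $[\![B]\!]=B^{\mathfrak n_F^{T_+}}+B^{\mathfrak n_F^{T_-}}$. The angle deficit is $\Theta_E=2\pi-\sum_{T\supset E}\arccos g|_T(\mathfrak m_E^{F_+},\mathfrak m_E^{F_-})$, where $F_\pm$ are the two facets of $T$ containing $E$. Let $\mathring{\mathcal U}$ be the space of fields $U$, smooth on $\mathcal T$, with values in the symmetric square $\Lambda^{N-2}\odot\Lambda^{N-2}$ of the $(N-2)$-forms ($u\odot v=\frac12(u\otimes v+v\otimes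 u)$), whose restrictions to vectors tangent to $F$ are single-valued for $F\in\mathring{\mathscr F}$ and vanish for facets $F\subset\partial\Omega$. Put $$(\mathbb A_gU)(X,Y,Z,W)=\langle U,\ \star(X^\flat\wedge Y^\flat)\odot\star(W^\flat\wedge Z^\flat)\rangle$$ with the Hodge star of $g$ and $\alpha\wedge\beta=\alpha\otimes\beta-\beta\otimes\alpha$ for 1-forms. With $A=\mathbb A_gU$, $A_{F\mathfrak n\mathfrak nF}(X,Y)=A(X,\mathfrak n,\mathfrak n,Y)$ for $X,Y$ tangent to $F$, and $A_{\mathfrak m\mathfrak n\mathfrak n\mathfrak m}=A(\mathfrak m,\mathfrak n,\mathfrak n,\mathfrak m)$ on $E$ (both are single-valued), the generalized curvature functional is $$\widetilde{\mathcal Q\omega}(g)(U)=\sum_{T\in\mathcal T}\int_T\langle\mathcal R,A\rangle\,\omega_T+4\sum_{F\in\mathring{\mathscr F}}\int_F\langle[\![I\!I]\!],A_{F\mathfrak n\mathfrak nF}\rangle\,\omega_F+4\sum_{E\in\mathring{\mathscr E}}\int_E\Theta_E\,A_{\mathfrak m\mathfrak n\mathfrak n\mathfrak m}\,\omega_E .$$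 **Theorem.** Let $g(t)$, $t\in\mathbb R$, be a family of Regge metrics that is continuously differentiable in $t$ (as a map into the piecewise smooth tensor fields, with the topology of uniform convergence of all spatial derivatives on each element). Let $\sigma=\dot g(t)$, let $U\in\mathring{\mathcal U}$ be independent of $t$, and let $A=\mathbb A_{g(t)}U$. Then for every $t$ the function $s\mapsto\widetilde{\mathcal Q\omega}(g(s))(U)$ is differentiable at $t$ and $$\frac{d}{dt}\,\widetilde{\mathcal Q\omega}(g(t))(U)=a(g(t);\sigma,U)+b(g(t);\sigma,U),$$ where $$\begin{aligned}a(g;\sigma,U)={}&\sum_{T\in\mathcal T}\int_T\Big(\langle L^{(1)}_\sigma\mathcal R,A\rangle-\tfrac12\,\mathrm{tr}(\sigma)\,\langle\mathcal R,A\rangle\Big)\omega_T+2\sum_{F\in\mathring{\mathscr F}}\int_F[\![I\!I]\!]:\mathbb S_F(\sigma):A_{F\mathfrak n\mathfrak nF}\,\omega_F\\&-2\sum_{E\in\mathring{\mathscr E}}\int_E\mathrm{tr}(\sigma_E)\,\Theta_E\,A_{\mathfrak m\mathfrak n\mathfrak n\mathfrak m}\,\omega_E,\\ b(g;\sigma,U)={}&2\sum_{T\in\mathcal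 T}\int_T\langle\nabla^2\sigma,SA\rangle\,\omega_T\\&+2\sum_{F\in\mathring{\mathscr F}}\int_F\big\langle[\![\sigma_{\mathfrak n\mathfrak n}I\!I+(\nabla\sigma)_{F\mathfrak nF}+\nabla(\mathfrak n\lrcorner\sigma)-(\nabla\sigma)_{\mathfrak nFF}]\!],A_{F\mathfrak n\mathfrak nF}\big\rangle\,\omega_F\\&+2\sum_{E\in\mathring{\mathscr E}}\int_E\sum_{F\in\mathscr F_E}[\![\sigma_{\mathfrak m\mathfrak n}]\!]_F^E\,A_{\mathfrak m\mathfrak n\mathfrak n\mathfrak m}\,\omega_E.\end{aligned}$$ Here $g(L_\sigma X,Y)=\sigma(X,Y)$; $(L^{(1)}_\sigma\mathcal R)(X,Y,Z,W)=\mathcal R(L_\sigma X,Y,Z,W)$; $\mathrm{tr}(\sigma)=g^{ij}\sigma_{ij}$; $\sigma_F,g_F,\sigma_E$ are restrictions to tangent vectors of $F$ and $E$, with traces taken with respect to the restricted metric; $\mathbb S_F(\sigma)=\sigma_F-\mathrm{tr}(\sigma_F)g_F$; $\tau:\rho:\eta=\tau_{ij}\rho^{jk}\eta_k{}^i$ (indices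 raised with $g_F$); $(SA)(X,Y,Z,W)=A(X,Z,Y,W)$; $(\nabla\sigma)_{F\mathfrak nF}(X,Y)=(\nabla\sigma)(X,\mathfrak n,Y)$, $(\nabla\sigma)_{\mathfrak nFF}(X,Y)=(\nabla\sigma)(\mathfrak n,X,Y)$ and $\nabla(\mathfrak n\lrcorner\sigma)(X,Y)=(\nabla_X(\sigma(\mathfrak n,\cdot)))(Y)$ for $X,Y$ tangent to $F$; $\sigma_{\mathfrak n\mathfrak n}=\sigma(\mathfrak n,\mathfrak n)$; and $[\![\sigma_{\mathfrak m\mathfrak n}]\!]_F^E=\sigma|_{T_+}(\mathfrak n_F^{T_+},\mathfrak m_E^F)+\sigma|_{T_-}(\mathfrak n_F^{T_-},\mathfrak m_E^F)$. In particular $a$ contains no spatial derivatives and no jumps of $\sigma$. -/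

import Mathlib

open MeasureTheory
open scoped ContDiff BigOperators Matrix

noncomputable section

namespace Regge

/-! ## Tensors at a point, in the Cartesian frame of the Euclidean parameter space -/

/-- Vectors (and covectors) of `ℝ ^ m`, by their Cartesian components. -/
abbrev Vec (m : ℕ) := Fin m → ℝ

/-- Covariant 2-tensors on `ℝ ^ m`, by their components `B i j = B(∂ᵢ, ∂ⱼ)`. -/
abbrev Mat (m : ℕ) := Matrix (Fin m) (Fin m) ℝ

/-- Covariant tensors on `ℝ ^ m` whose arguments are labelled by `κ`, by their components
`A I = A(∂_{I l} : l ∈ κ)`. -/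
abbrev Tens (m : ℕ) (κ : Type) := (κ → Fin m) → ℝ

/-- The value `A(X₁, X₂, …)` of a covariant tensor on vectors. -/
def eval {m : ℕ} {κ : Type} [Fintype κ] [DecidableEq κ] (A : Tens m κ) (X : κ → Vec m) : ℝ :=
  ∑ I : κ → Fin m, A I * ∏ l, X l (I l)

/-- A 2-tensor given by a matrix, as a tensor with two arguments. -/
def ofMat {m : ℕ} (B : Mat m) : Tens m (Fin 2) := fun I => B (I 0) (I 1)

/-- `G(X, Y)`. -/
def bil {m : ℕ} (G : Mat m) (X Y : Vec m) : ℝ := X ⬝ᵥ (G *ᵥ Y)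

/-- The `G`-inner product of covariant tensors,
`⟨A, B⟩ = A_{i₁…iₖ} g^{i₁j₁} ⋯ g^{iₖjₖ} B_{j₁…jₖ}`. -/
def ip {m : ℕ} {κ : Type} [Fintype κ] [DecidableEq κ] (G : Mat m) (A B : Tens m κ) : ℝ :=
  ∑ I : κ → Fin m, ∑ J : κ → Fin m, A I * (∏ l, G⁻¹ (I l) (J l)) * B J

/-- The endomorphism `L_σ` with `G(L_σ X, Y) = σ(X, Y)` (for symmetric `σ`):
`L_σ ∂ⱼ = ∑ᵢ (Lend G σ i j) ∂ᵢ`. -/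
def Lend {m : ℕ} (G σ : Mat m) : Mat m := G⁻¹ * σ

/-- The trace `tr σ = g^{ij} σ_{ij}`. -/
def tr {m : ℕ} (G σ : Mat m) : ℝ := (Lend G σ).trace

/-- `(L_σ⁽¹⁾ A)(X, Y, Z, W) = A(L_σ X, Y, Z, W)`. -/
def L1 {m : ℕ} (G σ : Mat m) (A : Tens m (Fin 4)) : Tens m (Fin 4) :=
  fun I => ∑ q, Lend G σ q (I 0) * A (Function.update I 0 q)

/-- `(S A)(X, Y, Z, W) = A(X, Z, Y, W)`. -/
def swap23 {m : ℕ} (A : Tens m (Fin 4)) : Tens m (Fin 4) :=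
  fun I => A ![I 0, I 2, I 1, I 3]

/-- The triple product `τ : σ : η = τ_{ij} σ^{jk} η_k{}^i`. -/
def triple {m : ℕ} (G τ σ η : Mat m) : ℝ :=
  (τ * (G⁻¹ * σ * G⁻¹) * (η * G⁻¹)).trace

/-- The permutation symbol. -/
def leviCivita {m : ℕ} (I : Fin m → Fin m) : ℝ :=
  Matrix.det (Matrix.of fun a b : Fin m => if I a = b then (1 : ℝ) else 0)

/-- The Riemannian volume form `ω_{i₁…i_m} = √(det G) ε_{i₁…i_m}`. -/
def volForm {m : ℕ} (G : Mat m) : Tens m (Fin m) := fun I => √ G.det * leviCivita I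

/-- The wedge product of two covectors, `α ∧ β = α ⊗ β - β ⊗ α`. -/
def wedge {m : ℕ} (α β : Vec m) : Tens m (Fin 2) :=
  fun I => α (I 0) * β (I 1) - α (I 1) * β (I 0)

/-- The Hodge dual of a 2-form in dimension `n + 2`,
`(⋆η)_J = (1/2!) η_{kl} g^{ki} g^{lj} ω_{ijJ}`. -/
def hodge {n : ℕ} (G : Mat (n + 2)) (η : Tens (n + 2) (Fin 2)) : Tens (n + 2) (Fin n) :=
  fun J => (1 / 2) * ∑ k, ∑ l, ∑ i, ∑ j,
    η ![k, l] * G⁻¹ k i * G⁻¹ l j * volForm G (Fin.cons i (Fin.cons j J))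

/-- The symmetric dyadic product `u ⊙ v = (u ⊗ v + v ⊗ u) / 2`. -/
def symDyad {m : ℕ} {κ : Type} (u v : Tens m κ) : Tens m (κ ⊕ κ) :=
  fun I => (1 / 2) * (u (I ∘ Sum.inl) * v (I ∘ Sum.inr) + v (I ∘ Sum.inl) * u (I ∘ Sum.inr))

/-- The coordinate vector `∂ᵢ`. -/
def frame {m : ℕ} (i : Fin m) : Vec m := Pi.single i 1

/-- `X ↦ X^♭`. -/
def flat {m : ℕ} (G : Mat m) (X : Vec m) : Vec m := G *ᵥ X

/-- The map `𝔸` at a point: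
`(𝔸 U)(X, Y, Z, W) = ⟨U, ⋆(X^♭ ∧ Y^♭) ⊙ ⋆(W^♭ ∧ Z^♭)⟩`. -/
def mapA {n : ℕ} (G : Mat (n + 2)) (U : Tens (n + 2) (Fin n ⊕ Fin n)) :
    Tens (n + 2) (Fin 4) :=
  fun I => ip G U (symDyad
    (hodge G (wedge (flat G (frame (I 0))) (flat G (frame (I 1)))))
    (hodge G (wedge (flat G (frame (I 3))) (flat G (frame (I 2))))))

/-- `U` lies in the span of the products `u ⊙ v` of `n`-forms: it is alternating in its first
`n` arguments and symmetric under exchange of the two blocks of arguments. -/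
def IsSymDyadForm {m n : ℕ} (U : Tens m (Fin n ⊕ Fin n)) : Prop :=
  (∀ (π : Equiv.Perm (Fin n)) (α β : Fin n → Fin m),
    U (Sum.elim (α ∘ π) β) = ((Equiv.Perm.sign π : ℤ) : ℝ) * U (Sum.elim α β)) ∧
  ∀ α β : Fin n → Fin m, U (Sum.elim α β) = U (Sum.elim β α)

/-! ## Levi-Civita calculus on a domain `D`, with derivatives up to the boundary of `D` -/

section Calculus

variable {m : ℕ} (D : Set (Vec m))

/-- The partial derivative `∂ₖ f`, taken within `D`. -/
def pd (k : Fin m) (f : Vec m → ℝ) (x : Vec m) : ℝ := fderivWithin ℝ f D x (frame k)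

/-- Iterated partial derivatives. -/
def iterPd : List (Fin m) → (Vec m → ℝ) → Vec m → ℝ
  | [], f => f
  | k :: l, f => pd D k (iterPd l f)

/-- The Christoffel symbols, `∇_{∂ᵢ} ∂ⱼ = ∑ₗ (christoffel D G x l i j) ∂ₗ`. -/
def christoffel (G : Vec m → Mat m) (x : Vec m) (l i j : Fin m) : ℝ :=
  (1 / 2) * ∑ k, (G x)⁻¹ l k *
    (pd D i (fun z => G z j k) x + pd D j (fun z => G z i k) x - pd D k (fun z => G z i j) x)

/-- The Riemann curvature tensor `ℛ(X, Y, Z, W) = g(R_{X,Y} Z, W)` with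
`R_{X,Y} Z = ∇_X ∇_Y Z - ∇_Y ∇_X Z - ∇_{[X,Y]} Z`. -/
def riemann (G : Vec m → Mat m) (x : Vec m) : Tens m (Fin 4) := fun I =>
  ∑ l, G x (I 3) l *
    (pd D (I 0) (fun z => christoffel D G z l (I 1) (I 2)) x
      - pd D (I 1) (fun z => christoffel D G z l (I 0) (I 2)) x
      + ∑ q, (christoffel D G x l (I 0) q * christoffel D G x q (I 1) (I 2)
        - christoffel D G x l (I 1) q * christoffel D G x q (I 0) (I 2)))

/-- The covariant derivative of a covariant tensor field,
`(∇A)(X, Y₁, …, Yₖ) = (∇_X A)(Y₁, …, Yₖ)`. -/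
def covDeriv (G : Vec m → Mat m) {k : ℕ} (A : Vec m → Tens m (Fin k)) (x : Vec m) :
    Tens m (Fin (k + 1)) := fun I =>
  pd D (I 0) (fun z => A z (Fin.tail I)) x
    - ∑ l : Fin k, ∑ q, christoffel D G x q (I 0) (Fin.tail I l) *
        A x (Function.update (Fin.tail I) l q)

/-- The covariant derivative of a vector field: the `l`-th component of `∇_{∂ᵢ} X`. -/
def covDerivVec (G : Vec m → Mat m) (X : Vec m → Vec m) (x : Vec m) (i l : Fin m) : ℝ :=
  pd D i (fun z => X z l) x + ∑ q, christoffel D G x l i q * X x q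

/-- The second covariant derivative `(∇²σ)(X, Y, Z, W) = (∇²_{X,Y} σ)(Z, W)`. -/
def hess (G σ : Vec m → Mat m) : Vec m → Tens m (Fin 4) :=
  covDeriv D G (covDeriv D G fun z => ofMat (σ z))

/-- The form `(X, Y) ↦ -g(∇_X 𝔫, Y)`. If the values of `𝔫` on a hypersurface are unit normals of
it, this restricts to the second fundamental form on tangent vectors. -/
def sff (G : Vec m → Mat m) (nrm : Vec m → Vec m) (x : Vec m) : Mat m := Matrix.of fun i j =>
  -∑ l, covDerivVec D G nrm x i l * G x l j

/-- The form `(X, Y) ↦ (∇σ)(X, 𝔫, Y)`. -/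
def nablaFnF (G : Vec m → Mat m) (nrm : Vec m → Vec m) (σ : Vec m → Mat m) (x : Vec m) : Mat m :=
  Matrix.of fun i j => ∑ k, covDeriv D G (fun z => ofMat (σ z)) x ![i, k, j] * nrm x k

/-- The form `(X, Y) ↦ (∇σ)(𝔫, X, Y)`. -/
def nablanFF (G : Vec m → Mat m) (nrm : Vec m → Vec m) (σ : Vec m → Mat m) (x : Vec m) : Mat m :=
  Matrix.of fun i j => ∑ k, covDeriv D G (fun z => ofMat (σ z)) x ![k, i, j] * nrm x k

/-- The form `∇(𝔫 ⌟ σ)`, where `𝔫 ⌟ σ` is the 1-form `σ(𝔫, ·)`. -/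
def nablaContr (G : Vec m → Mat m) (nrm : Vec m → Vec m) (σ : Vec m → Mat m) (x : Vec m) :
    Mat m :=
  Matrix.of fun i j =>
    covDeriv D G (fun z (I : Fin 1 → Fin m) => ∑ k, nrm z k * σ z k (I 0)) x ![i, j]

end Calculus

/-- The form `(X, Y) ↦ A(X, 𝔫, 𝔫, Y)`. -/
def contractNN {m : ℕ} (A : Tens m (Fin 4)) (nrm : Vec m) : Mat m := Matrix.of fun i j =>
  eval A ![frame i, nrm, nrm, frame j]

/-- The unit vector that is `G`-orthogonal to the kernel of the covector `ν`, on the side where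
`ν` is positive. -/
def unitNormal {m : ℕ} (G : Mat m) (ν : Vec m) : Vec m :=
  (√ (ν ⬝ᵥ (G⁻¹ *ᵥ ν)))⁻¹ • (G⁻¹ *ᵥ ν)

/-- The part of the `G`-gradient of `μ` that is tangent to the kernel of `ν`. -/
def tangentialGrad {m : ℕ} (G : Mat m) (ν μ : Vec m) : Vec m :=
  G⁻¹ *ᵥ μ - (μ ⬝ᵥ unitNormal G ν) • unitNormal G ν

/-- The unit vector in the kernel of `ν` that is `G`-orthogonal to the common kernel of `ν` and
`μ`, on the side where `μ` is positive. -/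
def unitConormal {m : ℕ} (G : Mat m) (ν μ : Vec m) : Vec m :=
  (√ (bil G (tangentialGrad G ν μ) (tangentialGrad G ν μ)))⁻¹ • tangentialGrad G ν μ

theorem bil_comm {m : ℕ} {G : Mat m} (hs : G.IsSymm) (X Y : Vec m) :
    bil G X Y = bil G Y X := by
  unfold bil
  rw [Matrix.dotProduct_mulVec, ← Matrix.mulVec_transpose, hs.eq, dotProduct_comm]

theorem isUnit_det_of_pos {m : ℕ} {G : Mat m}
    (hp : ∀ X : Vec m, X ≠ 0 → 0 < bil G X X) : IsUnit G.det := by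
  rw [isUnit_iff_ne_zero]
  intro h0
  obtain ⟨X, hX, hGX⟩ := Matrix.exists_mulVec_eq_zero_iff.mpr h0
  have := hp X hX
  simp [bil, hGX] at this

theorem mulVec_inv_mulVec {m : ℕ} {G : Mat m}
    (hp : ∀ X : Vec m, X ≠ 0 → 0 < bil G X X) (ν : Vec m) : G *ᵥ (G⁻¹ *ᵥ ν) = ν := by
  rw [Matrix.mulVec_mulVec, Matrix.mul_nonsing_inv _ (isUnit_det_of_pos hp), Matrix.one_mulVec]

theorem bil_inv_mulVec {m : ℕ} {G : Mat m} (hs : G.IsSymm)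
    (hp : ∀ X : Vec m, X ≠ 0 → 0 < bil G X X) (ν X : Vec m) :
    bil G (G⁻¹ *ᵥ ν) X = ν ⬝ᵥ X := by
  rw [bil_comm hs, bil, mulVec_inv_mulVec hp, dotProduct_comm]

theorem inv_form_pos {m : ℕ} {G : Mat m} (hs : G.IsSymm)
    (hp : ∀ X : Vec m, X ≠ 0 → 0 < bil G X X) {ν : Vec m} (hν : ν ≠ 0) :
    0 < ν ⬝ᵥ (G⁻¹ *ᵥ ν) := by
  rw [← bil_inv_mulVec hs hp]
  refine hp _ fun h => hν ?_
  rw [← mulVec_inv_mulVec hp ν, h, Matrix.mulVec_zero]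

theorem bil_smul_left {m : ℕ} (G : Mat m) (r : ℝ) (X Y : Vec m) :
    bil G (r • X) Y = r * bil G X Y := by simp [bil]

theorem bil_smul_right {m : ℕ} (G : Mat m) (r : ℝ) (X Y : Vec m) :
    bil G X (r • Y) = r * bil G X Y := by simp [bil, Matrix.mulVec_smul]

theorem bil_sub_left {m : ℕ} (G : Mat m) (X X' Y : Vec m) :
    bil G (X - X') Y = bil G X Y - bil G X' Y := by simp [bil, sub_dotProduct]

/-- The characterization of `unitNormal`. -/
theorem unitNormal_spec {m : ℕ} {G : Mat m} (hs : G.IsSymm)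
    (hp : ∀ X : Vec m, X ≠ 0 → 0 < bil G X X) {ν : Vec m} (hν : ν ≠ 0) :
    bil G (unitNormal G ν) (unitNormal G ν) = 1 ∧
      (∀ X, ν ⬝ᵥ X = 0 → bil G (unitNormal G ν) X = 0) ∧ 0 < ν ⬝ᵥ unitNormal G ν := by
  have h := inv_form_pos hs hp hν
  have h1 : √ (ν ⬝ᵥ (G⁻¹ *ᵥ ν)) ≠ 0 := (Real.sqrt_pos.mpr h).ne'
  refine ⟨?_, fun X hX => ?_, ?_⟩
  · rw [unitNormal, bil_smul_left, bil_smul_right, bil_inv_mulVec hs hp]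
    field_simp
    rw [Real.sq_sqrt h.le]
  · rw [unitNormal, bil_smul_left, bil_inv_mulVec hs hp, hX, mul_zero]
  · rw [unitNormal, dotProduct_smul, smul_eq_mul]
    have := Real.sqrt_pos.mpr h
    positivity

/-- The characterization of `unitConormal`. -/
theorem unitConormal_spec {m : ℕ} {G : Mat m} (hs : G.IsSymm)
    (hp : ∀ X : Vec m, X ≠ 0 → 0 < bil G X X) {ν μ : Vec m} (hν : ν ≠ 0)
    (hμ : ∀ r : ℝ, μ ≠ r • ν) :
    ν ⬝ᵥ unitConormal G ν μ = 0 ∧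
      bil G (unitConormal G ν μ) (unitConormal G ν μ) = 1 ∧
      (∀ X, ν ⬝ᵥ X = 0 → μ ⬝ᵥ X = 0 → bil G (unitConormal G ν μ) X = 0) ∧
      0 < μ ⬝ᵥ unitConormal G ν μ := by
  have h := inv_form_pos hs hp hν
  have h1 : √ (ν ⬝ᵥ (G⁻¹ *ᵥ ν)) ≠ 0 := (Real.sqrt_pos.mpr h).ne'
  have hsw : ν ⬝ᵥ (G⁻¹ *ᵥ μ) = μ ⬝ᵥ (G⁻¹ *ᵥ ν) := by
    rw [← bil_inv_mulVec hs hp, ← bil_inv_mulVec hs hp, bil_comm hs]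
  have hker : ν ⬝ᵥ tangentialGrad G ν μ = 0 := by
    simp only [tangentialGrad, unitNormal, dotProduct_sub, dotProduct_smul, smul_eq_mul, hsw]
    field_simp
    rw [Real.sq_sqrt h.le]
    ring
  have hbil : ∀ X, ν ⬝ᵥ X = 0 → bil G (tangentialGrad G ν μ) X = μ ⬝ᵥ X := by
    intro X hX
    rw [tangentialGrad, bil_sub_left, bil_smul_left, (unitNormal_spec hs hp hν).2.1 X hX,
      bil_inv_mulVec hs hp, mul_zero, sub_zero]
  have hne : tangentialGrad G ν μ ≠ 0 := by
    intro h0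
    apply hμ ((μ ⬝ᵥ unitNormal G ν) * (√ (ν ⬝ᵥ (G⁻¹ *ᵥ ν)))⁻¹)
    have h2 : G⁻¹ *ᵥ μ = (μ ⬝ᵥ unitNormal G ν) • unitNormal G ν := sub_eq_zero.mp h0
    have h3 := congrArg (fun v => G *ᵥ v) h2
    simp only [mulVec_inv_mulVec hp] at h3
    have h5 : G *ᵥ unitNormal G ν = (√ (ν ⬝ᵥ (G⁻¹ *ᵥ ν)))⁻¹ • ν := by
      rw [unitNormal, Matrix.mulVec_smul, mulVec_inv_mulVec hp]
    rwa [Matrix.mulVec_smul, h5, smul_smul] at h3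
  have hpos := hp _ hne
  have h4 : √ (bil G (tangentialGrad G ν μ) (tangentialGrad G ν μ)) ≠ 0 :=
    (Real.sqrt_pos.mpr hpos).ne'
  refine ⟨?_, ?_, fun X hX hX' => ?_, ?_⟩
  · rw [unitConormal, dotProduct_smul, hker, smul_zero]
  · rw [unitConormal, bil_smul_left, bil_smul_right]
    field_simp
    rw [Real.sq_sqrt hpos.le]
  · rw [unitConormal, bil_smul_left, hbil X hX, hX', mul_zero]
  · rw [unitConormal, dotProduct_smul, smul_eq_mul, ← hbil _ hker]
    have := Real.sqrt_pos.mpr hpos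
    positivity

/-! ## Parametrized subsimplices -/

/-- The reference simplex with vertices `0, e₁, …, e_m`. -/
def simplex (m : ℕ) : Set (Vec m) := {y | (∀ i, 0 ≤ y i) ∧ ∑ i, y i ≤ 1}

/-- The barycentric coordinates with respect to the vertices `0, e₁, …, e_m`. -/
def bary {m : ℕ} (y : Vec m) : Fin (m + 1) → ℝ := Fin.cons (1 - ∑ i, y i) y

/-- The affine map of the reference simplex onto the facet opposite to the vertex `a` of the
reference simplex one dimension higher. -/
def faceMap {m : ℕ} (a : Fin (m + 2)) (y : Vec m) : Vec (m + 1) :=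
  Fin.tail (a.insertNth (α := fun _ => ℝ) 0 (bary y))

/-- The matrix with columns `∂_p Ψ`, which span the tangent space of the image of `Ψ`. -/
def jac {m k : ℕ} (Ψ : Vec m → Vec k) (y : Vec m) : Matrix (Fin k) (Fin m) ℝ :=
  Matrix.of fun i p => fderivWithin ℝ Ψ (simplex m) y (frame p) i

/-- The restriction of a 2-tensor to the tangent space of the image of `Ψ`, by its components
`B(∂_p Ψ, ∂_q Ψ)`. -/
def restrict {m k : ℕ} (Ψ : Vec m → Vec k) (y : Vec m) (B : Mat k) : Mat m :=
  (jac Ψ y)ᵀ * B * jac Ψ y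

/-- The integral of a function over the submanifold parametrized by `Ψ`, with respect to the
Riemannian volume form of the metric induced on it by `G`. The integrand is given as a function
of the parameter. -/
def volInt {m k : ℕ} (Ψ : Vec m → Vec k) (G : Vec k → Mat k) (f : Vec m → ℝ) : ℝ :=
  ∫ y in simplex m, f y * √ (restrict Ψ y (G (Ψ y))).det

/-- The form `𝕊_F(ρ) = ρ_F - (tr ρ_F) g_F`, given `g_F` and `ρ_F`. -/
def traceRev {m : ℕ} (gF ρF : Mat m) : Mat m := ρF - tr gF ρF • gF

/-! ## Triangulations -/

/-- A curved simplex in `ℝ ^ (n + 2)`: the image of the reference simplex under a diffeomorphism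
that is smooth up to the boundary, as is its inverse. -/
structure Element (n : ℕ) where
  map : Vec (n + 2) → Vec (n + 2)
  inv : Vec (n + 2) → Vec (n + 2)
  map_smooth : ContDiffOn ℝ ∞ map (simplex (n + 2))
  inv_smooth : ContDiffOn ℝ ∞ inv (map '' simplex (n + 2))
  left_inv : ∀ y ∈ simplex (n + 2), inv (map y) = y

namespace Element

variable {n : ℕ} (T : Element n)

/-- The underlying closed set. -/
def carrier : Set (Vec (n + 2)) := T.map '' simplex (n + 2)

/-- The subsimplex spanned by the vertices not in `I` (of codimension `#I`). -/
def face (I : Finset (Fin (n + 3))) : Set (Vec (n + 2)) :=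
  T.map '' {y ∈ simplex (n + 2) | ∀ a ∈ I, bary y a = 0}

/-- The parametrization of the facet opposite to the vertex `a`. -/
def facetMap (a : Fin (n + 3)) : Vec (n + 1) → Vec (n + 2) := T.map ∘ faceMap a

/-- The parametrization of the subsimplex of codimension 2 that is opposite to the vertices `a`
and `a.succAbove c`. -/
def ridgeMap (a : Fin (n + 3)) (c : Fin (n + 2)) : Vec n → Vec (n + 2) :=
  T.map ∘ faceMap a ∘ faceMap c

/-- The differential, at a point of `T`, of the barycentric coordinate function of the vertex
`a`. At points of the facet opposite to `a` its kernel is the tangent space of this facet, and it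
is positive on the vectors that point into `T`. -/
def dbary (a : Fin (n + 3)) (x : Vec (n + 2)) : Vec (n + 2) := fun k =>
  pd T.carrier k (fun z => bary (T.inv z) a) x

/-- The inward unit normal `𝔫_F^T` of the facet `F` opposite to `a` (extended to all of `T` by the
unit normals of the level sets of the barycentric coordinate of `a`). -/
def normal (G : Vec (n + 2) → Mat (n + 2)) (a : Fin (n + 3)) (x : Vec (n + 2)) : Vec (n + 2) :=
  unitNormal (G x) (T.dbary a x)

/-- The unit conormal `𝔪_E^F` pointing from `E` into `F`, where `F` is the facet of `T` opposite
to `a` and `E` is the subsimplex of codimension 2 opposite to `a` and `b`. -/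
def conormal (G : Vec (n + 2) → Mat (n + 2)) (a b : Fin (n + 3)) (x : Vec (n + 2)) :
    Vec (n + 2) :=
  unitConormal (G x) (T.dbary a x) (T.dbary b x)

/-- The interior angle of `T` at the subsimplex of codimension 2 opposite to `a` and `b`. -/
def angle (G : Vec (n + 2) → Mat (n + 2)) (a b : Fin (n + 3)) (x : Vec (n + 2)) : ℝ :=
  Real.arccos (bil (G x) (T.conormal G a b x) (T.conormal G b a x))

end Element

/-- A triangulation of an open set `Ω` of `ℝ ^ (n + 2)` by finitely many curved simplices, any two
of which meet in a common subsimplex or not at all. -/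
structure Mesh (n : ℕ) where
  Ω : Set (Vec (n + 2))
  isOpen : IsOpen Ω
  ι : Type
  [fintype : Fintype ι]
  elem : ι → Element n
  cover : ⋃ i, (elem i).carrier = closure Ω
  conforming : ∀ i j, i ≠ j → ∃ I : Finset (Fin (n + 3)), I.Nonempty ∧
    (elem i).carrier ∩ (elem j).carrier = (elem i).face I

attribute [instance] Mesh.fintype

namespace Mesh

variable {n : ℕ} (M : Mesh n)

/-- The pairs of an element `T` and a facet of `T`, the facet being given by its opposite
vertex. -/
abbrev Side := M.ι × Fin (n + 3)

/-- The chains `E ⊂ F ⊂ T` of an element, a facet `F` of `T`, and a facet `E` of `F`: the flag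
`(T, a, c)` has `F` opposite to `a` and `E` opposite to `a` and `a.succAbove c`. -/
abbrev Flag := M.ι × Fin (n + 3) × Fin (n + 2)

/-- The facet of a side, as a set. -/
def sideSet (s : M.Side) : Set (Vec (n + 2)) := (M.elem s.1).face {s.2}

/-- The codimension 2 subsimplex of a flag, as a set. -/
def flagSet (f : M.Flag) : Set (Vec (n + 2)) :=
  (M.elem f.1).face {f.2.1, f.2.1.succAbove f.2.2}

/-- The side of which a flag is made. -/
def flagSide (f : M.Flag) : M.Side := (f.1, f.2.1)

/-- The facets of the triangulation. -/
abbrev Facet := {F : Set (Vec (n + 2)) // ∃ s, M.sideSet s = F}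

/-- The subsimplices of codimension 2 of the triangulation. -/
abbrev Ridge := {E : Set (Vec (n + 2)) // ∃ f, M.flagSet f = E}

instance : Finite M.Facet := Set.finite_range M.sideSet

instance : Finite M.Ridge := Set.finite_range M.flagSet

instance : Fintype M.Facet := Fintype.ofFinite _

instance : Fintype M.Ridge := Fintype.ofFinite _

open Classical in
/-- The facets that are not contained in the boundary of `Ω`. -/
def intFacets : Finset M.Facet := {F | ¬ F.1 ⊆ frontier M.Ω}

open Classical in
/-- The subsimplices of codimension 2 that are not contained in the boundary of `Ω`. -/
def intRidges : Finset M.Ridge := {E | ¬ E.1 ⊆ frontier M.Ω}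

open Classical in
/-- The sides of a facet: for an interior facet `F` these are the facet `F` of `T₊` and the facet
`F` of `T₋`. -/
def sides (F : M.Facet) : Finset M.Side := {s | M.sideSet s = F.1}

open Classical in
/-- The facets `F` that have `E` as a facet. -/
def facetsAt (E : M.Ridge) : Finset M.Facet :=
  {F | ∃ f : M.Flag, M.flagSet f = E.1 ∧ M.sideSet (M.flagSide f) = F.1}

open Classical in
/-- The flags `E ⊂ F ⊂ T` for given `E` and `F`. -/
def flagsAt (E : M.Ridge) (F : M.Facet) : Finset M.Flag :=
  {f | M.flagSet f = E.1 ∧ M.sideSet (M.flagSide f) = F.1}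

open Classical in
/-- The elements that have `E` as subsimplex. Each of them is listed once, together with one
enumeration of its two facets that contain `E`. -/
def elementsAt (E : M.Ridge) : Finset M.Flag :=
  {f | M.flagSet f = E.1 ∧ f.2.1 < f.2.1.succAbove f.2.2}

/-- A fixed side of a facet. It provides the parametrization of the facet and the traces on it of
fields whose trace is single-valued. -/
def plus (F : M.Facet) : M.Side := F.2.choose

/-- A fixed flag of a subsimplex of codimension 2, used in the same way. -/
def flag (E : M.Ridge) : M.Flag := E.2.choose

/-- The parametrization of a facet. -/
def facetPar (F : M.Facet) : Vec (n + 1) → Vec (n + 2) :=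
  (M.elem (M.plus F).1).facetMap (M.plus F).2

/-- The parametrization of a subsimplex of codimension 2. -/
def ridgePar (E : M.Ridge) : Vec n → Vec (n + 2) :=
  (M.elem (M.flag E).1).ridgeMap (M.flag E).2.1 (M.flag E).2.2

/-! ### Spaces of piecewise smooth tensor fields

A piecewise field has one branch for each element; only its values on that element matter. -/

/-- Piecewise 2-tensor fields. -/
abbrev Field2 := M.ι → Vec (n + 2) → Mat (n + 2)

/-- Piecewise 4-tensor fields. -/
abbrev Field4 := M.ι → Vec (n + 2) → Tens (n + 2) (Fin 4)

/-- Piecewise fields of covariant tensors with two blocks of `n` arguments. -/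
abbrev FieldU := M.ι → Vec (n + 2) → Tens (n + 2) (Fin n ⊕ Fin n)

/-- A vector is tangent to the facet of the side `s` at the point `x` of that facet. -/
def Tangent (s : M.Side) (x X : Vec (n + 2)) : Prop := (M.elem s.1).dbary s.2 x ⬝ᵥ X = 0

/-- The Regge space: symmetric 2-tensor fields, smooth up to the boundary on each element, with
single-valued restriction to each interior facet. -/
structure IsRegge (σ : M.Field2) : Prop where
  smooth : ∀ i j k, ContDiffOn ℝ ∞ (fun x => σ i x j k) (M.elem i).carrier
  symm : ∀ i, ∀ x ∈ (M.elem i).carrier, (σ i x).IsSymm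
  tt : ∀ F ∈ M.intFacets, ∀ s ∈ M.sides F, ∀ s' ∈ M.sides F, ∀ x ∈ F.1, ∀ X Y,
    M.Tangent s x X → M.Tangent s x Y → bil (σ s.1 x) X Y = bil (σ s'.1 x) X Y

/-- The metrics in the Regge space. -/
structure IsReggeMetric (g : M.Field2) : Prop extends M.IsRegge g where
  pos : ∀ i, ∀ x ∈ (M.elem i).carrier, ∀ X : Vec (n + 2), X ≠ 0 → 0 < bil (g i x) X X

/-- The metric-independent test space, with zero boundary conditions: fields in the symmetric
square of the `n`-forms, smooth up to the boundary on each element, with single-valued restriction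
to each interior facet and with vanishing restriction to each boundary facet. -/
structure IsTest (U : M.FieldU) : Prop where
  smooth : ∀ i I, ContDiffOn ℝ ∞ (fun x => U i x I) (M.elem i).carrier
  form : ∀ i, ∀ x ∈ (M.elem i).carrier, IsSymDyadForm (U i x)
  single : ∀ F ∈ M.intFacets, ∀ s ∈ M.sides F, ∀ s' ∈ M.sides F, ∀ x ∈ F.1,
    ∀ X Y : Fin n → Vec (n + 2), (∀ l, M.Tangent s x (X l)) → (∀ l, M.Tangent s x (Y l)) →
    eval (U s.1 x) (Sum.elim X Y) = eval (U s'.1 x) (Sum.elim X Y)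
  zero : ∀ F : M.Facet, F ∉ M.intFacets → ∀ s ∈ M.sides F, ∀ x ∈ F.1,
    ∀ X Y : Fin n → Vec (n + 2), (∀ l, M.Tangent s x (X l)) → (∀ l, M.Tangent s x (Y l)) →
    eval (U s.1 x) (Sum.elim X Y) = 0

/-- The time derivative `ġ(t)` of a family of piecewise 2-tensor fields. -/
def timeDeriv (g : ℝ → M.Field2) (t : ℝ) : M.Field2 := fun i x =>
  Matrix.of fun j k => deriv (fun s => g s i x j k) t

/-- The family `g` is continuously differentiable in time as a map into the space of piecewise
smooth fields, with the topology of uniform convergence of all spatial derivatives on each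
(compact) element. -/
structure IsC1Family (g : ℝ → M.Field2) : Prop where
  smooth : ∀ t i j k, ContDiffOn ℝ ∞ (fun x => g t i x j k) (M.elem i).carrier
  smooth_deriv : ∀ t i j k,
    ContDiffOn ℝ ∞ (fun x => M.timeDeriv g t i x j k) (M.elem i).carrier
  hasDeriv : ∀ (i : M.ι) (j k : Fin (n + 2)) (l : List (Fin (n + 2))),
    ∀ x ∈ (M.elem i).carrier, ∀ t,
    HasDerivAt (fun s => iterPd (M.elem i).carrier l (fun z => g s i z j k) x)
      (iterPd (M.elem i).carrier l (fun z => M.timeDeriv g t i z j k) x) t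
  cont : ∀ (i : M.ι) (j k : Fin (n + 2)) (l : List (Fin (n + 2))),
    ContinuousOn (fun p : ℝ × Vec (n + 2) =>
      iterPd (M.elem i).carrier l (fun z => M.timeDeriv g p.1 i z j k) p.2)
      (Set.univ ×ˢ (M.elem i).carrier)

/-! ### Traces and jumps -/

/-- The inward normal field at a side. -/
def nrm (g : M.Field2) (s : M.Side) : Vec (n + 2) → Vec (n + 2) := (M.elem s.1).normal (g s.1) s.2

/-- The second fundamental form of a facet, with respect to the inward normal at a side. -/
def secondFF (g : M.Field2) (s : M.Side) : Vec (n + 2) → Mat (n + 2) :=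
  sff (M.elem s.1).carrier (g s.1) (M.nrm g s)

/-- The form `σ_{𝔫𝔫} II + (∇σ)_{F𝔫F} + ∇(𝔫 ⌟ σ) - (∇σ)_{𝔫FF}`, with the inward normal at a
side. -/
def facetForm (g σ : M.Field2) (s : M.Side) (x : Vec (n + 2)) : Mat (n + 2) :=
  bil (σ s.1 x) (M.nrm g s x) (M.nrm g s x) • M.secondFF g s x
    + nablaFnF (M.elem s.1).carrier (g s.1) (M.nrm g s) (σ s.1) x
    + nablaContr (M.elem s.1).carrier (g s.1) (M.nrm g s) (σ s.1) x
    - nablanFF (M.elem s.1).carrier (g s.1) (M.nrm g s) (σ s.1) x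

/-- The restriction to a facet of (the trace from the fixed side of) a 2-tensor field. -/
def onFacet (F : M.Facet) (σ : M.Field2) (y : Vec (n + 1)) : Mat (n + 1) :=
  restrict (M.facetPar F) y (σ (M.plus F).1 (M.facetPar F y))

/-- The jump on a facet of a 2-tensor that depends on the inward normal: the sum over the two
sides of the facet, restricted to tangent vectors of the facet. -/
def jump (F : M.Facet) (B : M.Side → Vec (n + 2) → Mat (n + 2)) (y : Vec (n + 1)) :
    Mat (n + 1) :=
  ∑ s ∈ M.sides F, restrict (M.facetPar F) y (B s (M.facetPar F y))

/-- The 2-tensor `A_{F𝔫𝔫F}` on a facet. -/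
def AFnnF (g : M.Field2) (A : M.Field4) (F : M.Facet) (y : Vec (n + 1)) : Mat (n + 1) :=
  restrict (M.facetPar F) y (contractNN (A (M.plus F).1 (M.facetPar F y))
    (M.nrm g (M.plus F) (M.facetPar F y)))

/-- The conormal pointing from `E` into `F`, for a flag `E ⊂ F ⊂ T`. -/
def conrm (g : M.Field2) (f : M.Flag) : Vec (n + 2) → Vec (n + 2) :=
  (M.elem f.1).conormal (g f.1) f.2.1 (f.2.1.succAbove f.2.2)

/-- The function `A(𝔪, 𝔫, 𝔫, 𝔪)` on a subsimplex of codimension 2, with `𝔪` the conormal. -/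
def AmnnM (g : M.Field2) (A : M.Field4) (E : M.Ridge) (x : Vec (n + 2)) : ℝ :=
  eval (A (M.flag E).1 x) ![M.conrm g (M.flag E) x, M.nrm g (M.flagSide (M.flag E)) x,
    M.nrm g (M.flagSide (M.flag E)) x, M.conrm g (M.flag E) x]

/-- The restriction to a subsimplex of codimension 2 of a 2-tensor field. -/
def onRidge (E : M.Ridge) (σ : M.Field2) (y : Vec n) : Mat n :=
  restrict (M.ridgePar E) y (σ (M.flag E).1 (M.ridgePar E y))

/-- The angle deficit. -/
def deficit (g : M.Field2) (E : M.Ridge) (x : Vec (n + 2)) : ℝ :=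
  2 * Real.pi - ∑ f ∈ M.elementsAt E,
    (M.elem f.1).angle (g f.1) f.2.1 (f.2.1.succAbove f.2.2) x

/-- The jump `σ₊(𝔫_F^{T₊}, 𝔪_E^F) + σ₋(𝔫_F^{T₋}, 𝔪_E^F)` at a facet `F` of a subsimplex `E`
of codimension 2. -/
def jumpNM (g σ : M.Field2) (E : M.Ridge) (F : M.Facet) (x : Vec (n + 2)) : ℝ :=
  ∑ f ∈ M.flagsAt E F, bil (σ f.1 x) (M.nrm g (M.flagSide f) x) (M.conrm g f x)

/-! ### The functionals -/

/-- The integral over an element of a function on that element. -/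
def intElem (g : M.Field2) (i : M.ι) (f : Vec (n + 2) → ℝ) : ℝ :=
  volInt (M.elem i).map (g i) fun y => f ((M.elem i).map y)

/-- The integral over a facet of a function of the parameter. -/
def intFacet (g : M.Field2) (F : M.Facet) (f : Vec (n + 1) → ℝ) : ℝ :=
  volInt (M.facetPar F) (g (M.plus F).1) f

/-- The integral over a subsimplex of codimension 2 of a function of the parameter. -/
def intRidge (g : M.Field2) (E : M.Ridge) (f : Vec n → ℝ) : ℝ :=
  volInt (M.ridgePar E) (g (M.flag E).1) f

/-- The elementwise curvature tensor. -/
def curv (g : M.Field2) (i : M.ι) : Vec (n + 2) → Tens (n + 2) (Fin 4) :=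
  riemann (M.elem i).carrier (g i)

/-- The field `𝔸 U`. -/
def testA (g : M.Field2) (U : M.FieldU) : M.Field4 := fun i x => mapA (g i x) (U i x)

/-- The generalized densitized Riemann curvature of a Regge metric `g`, at `A`. -/
def Rω (g : M.Field2) (A : M.Field4) : ℝ :=
  ∑ i, M.intElem g i (fun x => ip (g i x) (M.curv g i x) (A i x))
    + 4 * ∑ F ∈ M.intFacets, M.intFacet g F (fun y =>
        ip (M.onFacet F g y) (ofMat (M.jump F (M.secondFF g) y)) (ofMat (M.AFnnF g A F y)))
    + 4 * ∑ E ∈ M.intRidges, M.intRidge g E (fun y =>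
        M.deficit g E (M.ridgePar E y) * M.AmnnM g A E (M.ridgePar E y))

/-- The generalized curvature functional on metric-independent test functions. -/
def Qω (g : M.Field2) (U : M.FieldU) : ℝ := M.Rω g (M.testA g U)

/-- The form `a(g; σ, U)`, in terms of `A = 𝔸 U`. -/
def aForm (g σ : M.Field2) (A : M.Field4) : ℝ :=
  ∑ i, M.intElem g i (fun x => ip (g i x) (L1 (g i x) (σ i x) (M.curv g i x)) (A i x)
      - (1 / 2) * tr (g i x) (σ i x) * ip (g i x) (M.curv g i x) (A i x))
    + 2 * ∑ F ∈ M.intFacets, M.intFacet g F (fun y =>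
        triple (M.onFacet F g y) (M.jump F (M.secondFF g) y)
          (traceRev (M.onFacet F g y) (M.onFacet F σ y)) (M.AFnnF g A F y))
    - 2 * ∑ E ∈ M.intRidges, M.intRidge g E (fun y =>
        tr (M.onRidge E g y) (M.onRidge E σ y) * M.deficit g E (M.ridgePar E y)
          * M.AmnnM g A E (M.ridgePar E y))

/-- The form `b(g; σ, U)`, in terms of `A = 𝔸 U`. Note that both normals and conormals point
inward, so that the sign of the last term is positive. -/
def bForm (g σ : M.Field2) (A : M.Field4) : ℝ :=
  2 * ∑ i, M.intElem g i (fun x =>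
      ip (g i x) (hess (M.elem i).carrier (g i) (σ i) x) (swap23 (A i x)))
    + 2 * ∑ F ∈ M.intFacets, M.intFacet g F (fun y =>
        ip (M.onFacet F g y) (ofMat (M.jump F (M.facetForm g σ) y)) (ofMat (M.AFnnF g A F y)))
    + 2 * ∑ E ∈ M.intRidges, M.intRidge g E (fun y =>
        (∑ F ∈ M.facetsAt E, M.jumpNM g σ E F (M.ridgePar E y))
          * M.AmnnM g A E (M.ridgePar E y))

end Mesh

end Regge

end

/-!
The derivative is computed under the integral signs: each element, facet and ridge (subsimplex of
codimension 2) contributes an integral over a fixed reference simplex, and the integrand is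
continuously differentiable in time (`TimeC1`), so that everything reduces to three pointwise
variations.

*Elimination of the metric from the test field.* With `ε` the permutation symbol,
`cofactorTens U` is the tensor `ĉ_{ijkl} = ∑ U_{KL} ε_{ijK} ε_{lkL}`, which does not depend on the
metric. The tensor `𝔸_g U` with raised indices is `(det g)⁻¹ ĉ` (`transform_mapA`). Consequently
`⟨B, 𝔸_g U⟩` is `(det g)⁻¹ ∑ B_{ijkl} ĉ_{ijkl}`. On a facet with conormal covector `ν` (the
differential of a barycentric coordinate), `A_{F𝔫𝔫F}` with raised indices is
`(det g · |ν|²)⁻¹ C_ν` with the metric-independent tangential tensor `C_ν = cofactorMat U ν`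
(`raise_contractNN`). On a ridge where the barycentric coordinates with differentials `ν` and `μ`
vanish, `A(𝔪, 𝔫, 𝔫, 𝔪)` is `(det g · gram(ν, μ))⁻¹ μᵀ C_ν μ` (`eval_mapA_conormal`). Since
`det g`, `det g · |ν|²` and `det g · gram(ν, μ)` differ from the squared volume densities of the
element, facet and ridge by time-independent factors, the products of these factors with the volume
forms vary by `-½ tr σ`, `-½ tr σ_F` and `-½ tr σ_E` (`TimeC1.elementFactor`,
`TimeC1.facetFactor`, `TimeC1.ridgeFactor`). This is the origin of the trace terms in `a`.

*Elements.* Contracted with the antisymmetric `ĉ`, the curvature is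
`2 ĉ_{ijkl} (∂ᵢ∂ₖ g_{jl} + g^{pq} Γ_{p,jl} Γ_{q,ik})` (`contract4_riemann`). Differentiating in
time and comparing with the same contraction of `∇²σ` leaves the term with `L_σ⁽¹⁾ ℛ`
(`contract4_variation`); the symmetry of `ĉ` and `ℛ` under reversal of their arguments moves `L_σ`
to the first argument.

*Facets.* For tangential `C` the contraction of the second fundamental form is that of
`-|ν|⁻¹ (∂ᵢνⱼ - Γᵏᵢⱼ νₖ)` (`SmoothMetric.trace_sff_mul`). Its time derivative is expressed by `∇σ`,
and `∇(𝔫 ⌟ σ)` exceeds `(∇σ)_{F𝔫F}` by `-II : σ` because `∇𝔫` is tangential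
(`SmoothMetric.facet_variation`). Being tangential, the tensor `C_ν` of the fixed side of a facet
can be paired with the second fundamental forms from both sides, and by the tangential-tangential
continuity of `g`, which its time derivative inherits (`Mesh.timeDeriv_tt`), the resulting products
involve the same tangential parts of `g⁻¹` and `σ` (`Mesh.facetInv_eq`,
`Mesh.facetInv_mul_timeDeriv`).

*Ridges.* The dihedral angle is `arccos (-⟨ν, μ⟩ / (|ν| |μ|))`, and its derivative is
`-½ (σ(𝔫, 𝔪) + σ(𝔫', 𝔪'))`, with the pairs of normal and conormal of the two facets of the element
at the ridge (`TimeC1.dihedralAngle`). Summation over the elements around the ridge gives every pair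
of an element and a facet once, whence the jumps of `σ_{𝔪𝔫}` (`Mesh.timeC1_deficit`).
-/

noncomputable section

namespace Regge

/-! ### Tensor algebra at a point -/

theorem sum_cons {α β : Type*} [Fintype α] [AddCommMonoid β] {k : ℕ} (f : (Fin (k + 1) → α) → β) :
    ∑ I, f I = ∑ a, ∑ J : Fin k → α, f (Fin.cons a J) := by
  rw [← (Fin.consEquiv fun _ : Fin (k + 1) => α).sum_comp f, Fintype.sum_prod_type]
  rfl

theorem sum_fin_two {α β : Type*} [Fintype α] [AddCommMonoid β] (f : (Fin 2 → α) → β) :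
    ∑ I, f I = ∑ a, ∑ b, f ![a, b] := by
  simp only [sum_cons, Fintype.sum_unique]
  rfl

theorem sum_fin_four {α β : Type*} [Fintype α] [AddCommMonoid β] (f : (Fin 4 → α) → β) :
    ∑ I, f I = ∑ a, ∑ b, ∑ c, ∑ d, f ![a, b, c, d] := by
  simp only [sum_cons, Fintype.sum_unique]
  rfl

theorem sum_sum_elim {α β κ κ' : Type*} [Fintype α] [AddCommMonoid β] [Fintype κ] [Fintype κ']
    [DecidableEq κ] [DecidableEq κ'] (f : (κ ⊕ κ' → α) → β) :
    ∑ I, f I = ∑ K : κ → α, ∑ L : κ' → α, f (Sum.elim K L) := by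
  rw [← (Equiv.sumArrowEquivProdArrow κ κ' α).symm.sum_comp f, Fintype.sum_prod_type]
  rfl

theorem sum_comm_four {α β : Type*} [Fintype α] [Fintype β] (f : β → α → α → α → α → ℝ) :
    ∑ K, ∑ a, ∑ b, ∑ c, ∑ d, f K a b c d = ∑ a, ∑ b, ∑ c, ∑ d, ∑ K, f K a b c d := by
  rw [Finset.sum_comm]
  refine Finset.sum_congr rfl fun a _ => ?_
  rw [Finset.sum_comm]
  refine Finset.sum_congr rfl fun b _ => ?_
  rw [Finset.sum_comm]
  exact Finset.sum_congr rfl fun c _ => Finset.sum_comm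

/-- The action of a matrix on all arguments of a tensor. With `M = G⁻¹` it raises all indices, with
`M = G` it lowers them. -/
def transform {m : ℕ} {κ : Type} [Fintype κ] [DecidableEq κ] (M : Mat m) (B : Tens m κ) :
    Tens m κ := fun I => ∑ J : κ → Fin m, (∏ l, M (I l) (J l)) * B J

section transform

variable {m : ℕ} {κ : Type} [Fintype κ] [DecidableEq κ]

theorem transform_one (B : Tens m κ) : transform 1 B = B := by
  funext I
  simp only [transform, Matrix.one_apply, Fintype.prod_ite_zero, ← funext_iff]
  simp

theorem transform_mul (M N : Mat m) (B : Tens m κ) :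
    transform M (transform N B) = transform (M * N) B := by
  funext I
  simp only [transform, Matrix.mul_apply, Finset.prod_univ_sum, Finset.mul_sum, Finset.sum_mul,
    Fintype.piFinset_univ]
  rw [Finset.sum_comm]
  refine Finset.sum_congr rfl fun J _ => Finset.sum_congr rfl fun K _ => ?_
  rw [Finset.prod_mul_distrib]
  ring

theorem ip_eq_sum_transform (G : Mat m) (A B : Tens m κ) :
    ip G A B = ∑ I, A I * transform G⁻¹ B I := by
  simp only [ip, transform, Finset.mul_sum, mul_assoc]

theorem transform_smul (M : Mat m) (r : ℝ) (B : Tens m κ) :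
    transform M (r • B) = r • transform M B := by
  funext I
  simp only [transform, Pi.smul_apply, smul_eq_mul, Finset.mul_sum]
  exact Finset.sum_congr rfl fun J _ => by ring

theorem eval_smul (r : ℝ) (B : Tens m κ) (X : κ → Vec m) :
    eval (r • B) X = r * eval B X := by
  simp only [eval, Pi.smul_apply, smul_eq_mul, Finset.mul_sum, mul_assoc]

theorem eval_transform (M : Mat m) (B : Tens m κ) (X : κ → Vec m) :
    eval (transform M B) X = eval B fun l => Mᵀ *ᵥ X l := by
  simp only [eval, transform, Matrix.mulVec, dotProduct, Finset.prod_univ_sum, Finset.mul_sum,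
    Finset.sum_mul, Fintype.piFinset_univ, Matrix.transpose_apply]
  rw [Finset.sum_comm]
  refine Finset.sum_congr rfl fun J _ => Finset.sum_congr rfl fun K _ => ?_
  rw [Finset.prod_mul_distrib]
  ring

end transform

/-- The permutation symbol is an eigenvector of `transform M`, the eigenvalue being `det M`. -/
theorem transform_leviCivita {m : ℕ} (M : Mat m) :
    transform M (leviCivita : Tens m (Fin m)) = M.det • leviCivita := by
  funext I
  have h1 : M.det * leviCivita I = (Matrix.of fun a b => M (I a) b).det := by
    rw [leviCivita, mul_comm, ← Matrix.det_mul]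
    congr 1
    ext a b
    simp [Matrix.mul_apply]
  rw [Pi.smul_apply, smul_eq_mul, h1]
  have h2 : (Matrix.of fun a b => M (I a) b) =
      fun a => ∑ j, M (I a) j • (fun b => if j = b then (1 : ℝ) else 0) := by
    ext a b
    simp
  change _ = Matrix.detRowAlternating (R := ℝ) (Matrix.of fun a b => M (I a) b)
  rw [h2]
  have h3 := MultilinearMap.map_sum (Matrix.detRowAlternating (n := Fin m) (R := ℝ)).toMultilinearMap
    (fun a j => M (I a) j • (fun b => if j = b then (1 : ℝ) else 0))
  rw [AlternatingMap.coe_multilinearMap] at h3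
  rw [h3]
  refine Finset.sum_congr rfl fun J _ => ?_
  have h4 := MultilinearMap.map_smul_univ
    (Matrix.detRowAlternating (n := Fin m) (R := ℝ)).toMultilinearMap
    (fun a => M (I a) (J a)) (fun a b => if J a = b then (1 : ℝ) else 0)
  rw [AlternatingMap.coe_multilinearMap] at h4
  rw [h4]
  rfl

theorem leviCivita_swap {n : ℕ} (i j : Fin (n + 2)) (K : Fin n → Fin (n + 2)) :
    leviCivita (Fin.cons i (Fin.cons j K)) = -leviCivita (Fin.cons j (Fin.cons i K)) := by
  have h := Matrix.det_permute (Equiv.swap (0 : Fin (n + 2)) 1)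
    (Matrix.of fun a b : Fin (n + 2) =>
      if (Fin.cons i (Fin.cons j K) : Fin (n + 2) → Fin (n + 2)) a = b then (1 : ℝ) else 0)
  rw [Equiv.Perm.sign_swap (by simp)] at h
  simp only [Units.val_neg, Units.val_one, Int.cast_neg, Int.cast_one, neg_mul, one_mul] at h
  rw [eq_neg_iff_add_eq_zero, add_comm, ← eq_neg_iff_add_eq_zero, leviCivita, leviCivita, ← h]
  congr 1
  ext a b
  simp only [Matrix.submatrix_apply, Matrix.of_apply, id]
  congr 2
  refine Fin.cases ?_ (fun a => Fin.cases ?_ (fun a => ?_) a) a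
  · rw [Equiv.swap_apply_left]
    rfl
  · rw [show Fin.succ 0 = (1 : Fin (n + 2)) from rfl, Equiv.swap_apply_right]
    rfl
  · rw [Equiv.swap_apply_of_ne_of_ne (Fin.succ_ne_zero _)]
    · rfl
    · exact fun h => Fin.succ_ne_zero a (Fin.succ_injective _ h)

theorem transform_fin_two {m : ℕ} (M : Mat m) (B : Tens m (Fin 2)) (i j : Fin m) :
    transform M B ![i, j] = ∑ a, ∑ b, M i a * M j b * B ![a, b] := by
  simp [transform, sum_fin_two, Fin.prod_univ_two]

/-- Raising two indices and lowering them again. -/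
theorem sum_mul_sum_inv {m : ℕ} {G : Mat m} (hd : IsUnit G.det) (f : Fin m → Fin m → ℝ)
    (i j : Fin m) :
    ∑ a, ∑ b, G i a * G j b * ∑ p, ∑ q, G⁻¹ a p * G⁻¹ b q * f p q = f i j := by
  have h := congrFun (transform_mul G G⁻¹ fun I : Fin 2 → Fin m => f (I 0) (I 1)) ![i, j]
  rw [Matrix.mul_nonsing_inv _ hd, transform_one] at h
  simpa only [transform_fin_two, Matrix.cons_val_zero, Matrix.cons_val_one] using h

/-- The Hodge dual of `∂ᵢ^♭ ∧ ∂ⱼ^♭` is the volume form with `∂ᵢ, ∂ⱼ` inserted. -/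
theorem hodge_wedge_flat {n : ℕ} {G : Mat (n + 2)} (hs : G.IsSymm) (hd : IsUnit G.det)
    (i j : Fin (n + 2)) :
    hodge G (wedge (flat G (frame i)) (flat G (frame j))) =
      fun J => √ G.det * leviCivita (Fin.cons i (Fin.cons j J)) := by
  funext J
  have hf : ∀ i k, flat G (frame i) k = G i k := fun i k => by
    simp [flat, frame, hs.apply]
  have key : ∀ a b : Fin (n + 2), ∑ k, ∑ l, ∑ p, ∑ q, G a k * G b l * G⁻¹ k p * G⁻¹ l q *
      volForm G (Fin.cons p (Fin.cons q J)) = volForm G (Fin.cons a (Fin.cons b J)) := by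
    intro a b
    rw [← sum_mul_sum_inv hd (fun p q => volForm G (Fin.cons p (Fin.cons q J))) a b]
    simp only [Finset.mul_sum]
    refine Finset.sum_congr rfl fun k _ => Finset.sum_congr rfl fun l _ =>
      Finset.sum_congr rfl fun p _ => Finset.sum_congr rfl fun q _ => ?_
    ring
  have e : hodge G (wedge (flat G (frame i)) (flat G (frame j))) J =
      (1 / 2) * (∑ k, ∑ l, ∑ p, ∑ q, G i k * G j l * G⁻¹ k p * G⁻¹ l q *
      volForm G (Fin.cons p (Fin.cons q J)) - ∑ k, ∑ l, ∑ p, ∑ q, G j k * G i l * G⁻¹ k p *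
      G⁻¹ l q * volForm G (Fin.cons p (Fin.cons q J))) := by
    simp only [hodge, wedge, hf, ← Finset.sum_sub_distrib]
    congr 1
    refine Finset.sum_congr rfl fun k _ => Finset.sum_congr rfl fun l _ =>
      Finset.sum_congr rfl fun p _ => Finset.sum_congr rfl fun q _ => ?_
    simp
    ring
  rw [e, key, key]
  simp only [volForm]
  rw [leviCivita_swap j i]
  ring

/-- The metric-independent form of `𝔸 U`: the contraction `ε_{ijK} ε_{lkL} U_{KL}`. The tensor
`𝔸 U` with all indices raised is `(det G)⁻¹` times this. -/
def cofactorTens {n : ℕ} (U : Tens (n + 2) (Fin n ⊕ Fin n)) : Tens (n + 2) (Fin 4) := fun I =>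
  ∑ K : Fin n → Fin (n + 2), ∑ L : Fin n → Fin (n + 2), U (Sum.elim K L) *
    leviCivita (Fin.cons (I 0) (Fin.cons (I 1) K)) * leviCivita (Fin.cons (I 3) (Fin.cons (I 2) L))

theorem cofactorTens_swap_left {n : ℕ} (U : Tens (n + 2) (Fin n ⊕ Fin n)) (i j k l) :
    cofactorTens U ![i, j, k, l] = -cofactorTens U ![j, i, k, l] := by
  simp only [cofactorTens, ← Finset.sum_neg_distrib]
  refine Finset.sum_congr rfl fun K _ => Finset.sum_congr rfl fun L _ => ?_
  simp only [Matrix.cons_val]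
  rw [leviCivita_swap]
  ring

theorem cofactorTens_swap_right {n : ℕ} (U : Tens (n + 2) (Fin n ⊕ Fin n)) (i j k l) :
    cofactorTens U ![i, j, k, l] = -cofactorTens U ![i, j, l, k] := by
  simp only [cofactorTens, ← Finset.sum_neg_distrib]
  refine Finset.sum_congr rfl fun K _ => Finset.sum_congr rfl fun L _ => ?_
  simp only [Matrix.cons_val]
  rw [leviCivita_swap l k]
  ring

theorem cofactorTens_reverse {n : ℕ} {U : Tens (n + 2) (Fin n ⊕ Fin n)} (hU : IsSymDyadForm U)
    (i j k l) : cofactorTens U ![i, j, k, l] = cofactorTens U ![l, k, j, i] := by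
  simp only [cofactorTens]
  rw [Finset.sum_comm]
  refine Finset.sum_congr rfl fun K _ => Finset.sum_congr rfl fun L _ => ?_
  simp only [Matrix.cons_val]
  rw [hU.2 L K]
  ring

/-- Raising the indices of the permutation symbol except for the first two. -/
theorem sum_prod_inv_leviCivita {n : ℕ} {G : Mat (n + 2)} (hd : IsUnit G.det)
    (i j : Fin (n + 2)) (K : Fin n → Fin (n + 2)) :
    ∑ K', (∏ l, G⁻¹ (K l) (K' l)) * leviCivita (Fin.cons i (Fin.cons j K')) =
      G.det⁻¹ * ∑ a, ∑ b, G i a * G j b * leviCivita (Fin.cons a (Fin.cons b K)) := by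
  have h : ∀ a b, G.det⁻¹ * leviCivita (Fin.cons a (Fin.cons b K)) =
      ∑ p, ∑ q, ∑ K', G⁻¹ a p * G⁻¹ b q * ((∏ l, G⁻¹ (K l) (K' l)) *
        leviCivita (Fin.cons p (Fin.cons q K'))) := fun a b => by
    have := congrFun (transform_leviCivita G⁻¹) (Fin.cons a (Fin.cons b K))
    rw [Pi.smul_apply, smul_eq_mul, Matrix.det_nonsing_inv, Ring.inverse_eq_inv'] at this
    rw [← this, transform, sum_cons]
    simp only [sum_cons, Fin.prod_univ_succ, Fin.cons_zero, Fin.cons_succ]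
    refine Finset.sum_congr rfl fun p _ => Finset.sum_congr rfl fun q _ =>
      Finset.sum_congr rfl fun K' _ => ?_
    ring
  rw [← sum_mul_sum_inv hd (fun p q => ∑ K', (∏ l, G⁻¹ (K l) (K' l)) *
    leviCivita (Fin.cons p (Fin.cons q K'))) i j]
  simp only [Finset.mul_sum _ _ G.det⁻¹]
  refine Finset.sum_congr rfl fun a _ => Finset.sum_congr rfl fun b _ => ?_
  rw [show G.det⁻¹ * (G i a * G j b * leviCivita (Fin.cons a (Fin.cons b K))) =
    G i a * G j b * (G.det⁻¹ * leviCivita (Fin.cons a (Fin.cons b K))) by ring, h]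
  simp only [Finset.mul_sum]

/-- `𝔸 U` is `cofactorTens U` with lowered indices, up to the factor `det G`. -/
theorem mapA_eq {n : ℕ} {G : Mat (n + 2)} (hs : G.IsSymm) (hd : 0 < G.det)
    {U : Tens (n + 2) (Fin n ⊕ Fin n)} (hU : IsSymDyadForm U) :
    mapA G U = G.det⁻¹ • transform G (cofactorTens U) := by
  have hu : IsUnit G.det := hd.ne'.isUnit
  have hsq : √ G.det * √ G.det = G.det := Real.mul_self_sqrt hd.le
  funext I
  set e : Fin (n + 2) → Fin (n + 2) → (Fin n → Fin (n + 2)) → ℝ := fun i j K =>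
    √ G.det * leviCivita (Fin.cons i (Fin.cons j K)) with he
  -- the raised factors `⋆(∂ᵢ^♭ ∧ ∂ⱼ^♭)`
  set r : Fin (n + 2) → Fin (n + 2) → (Fin n → Fin (n + 2)) → ℝ := fun i j K =>
    ∑ K', (∏ l, G⁻¹ (K l) (K' l)) * e i j K' with hr
  have hre : ∀ i j K, r i j K = (√ G.det)⁻¹ *
      ∑ a, ∑ b, G i a * G j b * leviCivita (Fin.cons a (Fin.cons b K)) := by
    intro i j K
    have h1 : (√ G.det)⁻¹ = √ G.det * G.det⁻¹ := by
      have := (Real.sqrt_pos.mpr hd).ne'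
      field_simp
      exact (Real.sq_sqrt hd.le).symm
    rw [h1, mul_assoc, ← sum_prod_inv_leviCivita hu, Finset.mul_sum]
    exact Finset.sum_congr rfl fun _ _ => by simp only [he]; ring
  have h1 : mapA G U I = ∑ K, ∑ L, U (Sum.elim K L) *
      ((1 / 2) * (r (I 0) (I 1) K * r (I 3) (I 2) L + r (I 3) (I 2) K * r (I 0) (I 1) L)) := by
    simp only [mapA, hodge_wedge_flat hs hu, ip, sum_sum_elim, Fintype.prod_sum_type, symDyad,
      Sum.elim_inl, Sum.elim_inr, Sum.elim_comp_inl, Sum.elim_comp_inr]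
    refine Finset.sum_congr rfl fun K _ => Finset.sum_congr rfl fun L _ => ?_
    simp only [hr, Finset.sum_mul_sum]
    simp only [← Finset.sum_add_distrib, Finset.mul_sum]
    refine Finset.sum_congr rfl fun K' _ => Finset.sum_congr rfl fun L' _ => ?_
    simp only [he]
    ring
  have h2 : ∑ K, ∑ L, U (Sum.elim K L) * (r (I 3) (I 2) K * r (I 0) (I 1) L) =
      ∑ K, ∑ L, U (Sum.elim K L) * (r (I 0) (I 1) K * r (I 3) (I 2) L) := by
    rw [Finset.sum_comm]
    refine Finset.sum_congr rfl fun K _ => Finset.sum_congr rfl fun L _ => ?_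
    rw [hU.2 L K]
    ring
  have h3 : mapA G U I = ∑ K, ∑ L, U (Sum.elim K L) * (r (I 0) (I 1) K * r (I 3) (I 2) L) := by
    have h0 : mapA G U I = (1 / 2) *
        (∑ K, ∑ L, U (Sum.elim K L) * (r (I 0) (I 1) K * r (I 3) (I 2) L) +
          ∑ K, ∑ L, U (Sum.elim K L) * (r (I 3) (I 2) K * r (I 0) (I 1) L)) := by
      rw [h1]
      simp only [← Finset.sum_add_distrib, Finset.mul_sum]
      refine Finset.sum_congr rfl fun K _ => Finset.sum_congr rfl fun L _ => ?_
      ring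
    rw [h0, h2]
    ring
  have h4 : (√ G.det)⁻¹ * (√ G.det)⁻¹ = G.det⁻¹ := by rw [← mul_inv, hsq]
  rw [h3, Pi.smul_apply, smul_eq_mul, transform, sum_fin_four, ← h4]
  simp only [hre, Fin.prod_univ_four, cofactorTens, Matrix.cons_val]
  have h5 : ∀ (i j k l : Fin (n + 2)) (K L : Fin n → Fin (n + 2)),
      (∑ a, ∑ b, G i a * G j b * leviCivita (Fin.cons a (Fin.cons b K))) *
        (∑ d, ∑ c, G l d * G k c * leviCivita (Fin.cons d (Fin.cons c L))) =
      ∑ a, ∑ b, ∑ c, ∑ d, G i a * G j b * G k c * G l d *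
        (leviCivita (Fin.cons a (Fin.cons b K)) * leviCivita (Fin.cons d (Fin.cons c L))) := by
    intro i j k l K L
    simp only [Finset.sum_mul]
    refine Finset.sum_congr rfl fun a _ => Finset.sum_congr rfl fun b _ => ?_
    rw [Finset.mul_sum, Finset.sum_congr rfl fun d _ => Finset.mul_sum _ _ _, Finset.sum_comm]
    refine Finset.sum_congr rfl fun c _ => Finset.sum_congr rfl fun d _ => ?_
    ring
  calc _ = ∑ K, ∑ L, (√ G.det)⁻¹ * (√ G.det)⁻¹ * ∑ a, ∑ b, ∑ c, ∑ d,
        G (I 0) a * G (I 1) b * G (I 2) c * G (I 3) d * (U (Sum.elim K L) *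
        leviCivita (Fin.cons a (Fin.cons b K)) * leviCivita (Fin.cons d (Fin.cons c L))) := by
        refine Finset.sum_congr rfl fun K _ => Finset.sum_congr rfl fun L _ => ?_
        rw [show ∀ x u p q : ℝ, u * (x * p * (x * q)) = x * x * (u * (p * q)) by intros; ring, h5]
        simp only [Finset.mul_sum]
        refine Finset.sum_congr rfl fun a _ => Finset.sum_congr rfl fun b _ =>
          Finset.sum_congr rfl fun c _ => Finset.sum_congr rfl fun d _ => ?_
        ring
    _ = _ := by
        simp only [← Finset.mul_sum]
        congr 1
        simp only [Finset.mul_sum]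
        rw [Finset.sum_congr rfl fun K _ => sum_comm_four _, sum_comm_four]

theorem transform_mapA {n : ℕ} {G : Mat (n + 2)} (hs : G.IsSymm) (hd : 0 < G.det)
    {U : Tens (n + 2) (Fin n ⊕ Fin n)} (hU : IsSymDyadForm U) :
    transform G⁻¹ (mapA G U) = G.det⁻¹ • cofactorTens U := by
  rw [mapA_eq hs hd hU, transform_smul, transform_mul, Matrix.nonsing_inv_mul _ hd.ne'.isUnit,
    transform_one]

/-- Inner products with `𝔸 U` in terms of `cofactorTens U`. -/
theorem ip_mapA {n : ℕ} {G : Mat (n + 2)} (hs : G.IsSymm) (hd : 0 < G.det)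
    {U : Tens (n + 2) (Fin n ⊕ Fin n)} (hU : IsSymDyadForm U) (B : Tens (n + 2) (Fin 4)) :
    ip G B (mapA G U) = G.det⁻¹ * ∑ I, B I * cofactorTens U I := by
  rw [ip_eq_sum_transform, transform_mapA hs hd hU, Finset.mul_sum]
  refine Finset.sum_congr rfl fun I _ => ?_
  rw [Pi.smul_apply, smul_eq_mul]
  ring

theorem transform_swap23 {m : ℕ} (M : Mat m) (B : Tens m (Fin 4)) :
    transform M (swap23 B) = swap23 (transform M B) := by
  funext I
  simp only [transform, swap23, sum_fin_four, Fin.prod_univ_four, Matrix.cons_val]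
  refine Finset.sum_congr rfl fun a _ => ?_
  rw [Finset.sum_comm]
  refine Finset.sum_congr rfl fun b _ => Finset.sum_congr rfl fun c _ =>
    Finset.sum_congr rfl fun d _ => ?_
  ring

theorem ip_swap23_mapA {n : ℕ} {G : Mat (n + 2)} (hs : G.IsSymm) (hd : 0 < G.det)
    {U : Tens (n + 2) (Fin n ⊕ Fin n)} (hU : IsSymDyadForm U) (B : Tens (n + 2) (Fin 4)) :
    ip G B (swap23 (mapA G U)) = G.det⁻¹ * ∑ I, B I * swap23 (cofactorTens U) I := by
  rw [ip_eq_sum_transform, transform_swap23, transform_mapA hs hd hU, Finset.mul_sum]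
  refine Finset.sum_congr rfl fun I _ => ?_
  simp only [swap23, Pi.smul_apply, smul_eq_mul]
  ring

/-- The matrix `C_ν` of the quadratic form `(α, β) ↦ cofactorTens U (α, ν, ν, β)` of covectors. -/
def cofactorMat {n : ℕ} (U : Tens (n + 2) (Fin n ⊕ Fin n)) (ν : Vec (n + 2)) : Mat (n + 2) :=
  Matrix.of fun i j => ∑ b, ∑ c, cofactorTens U ![i, b, c, j] * ν b * ν c

theorem cofactorMat_isSymm {n : ℕ} {U : Tens (n + 2) (Fin n ⊕ Fin n)} (hU : IsSymDyadForm U)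
    (ν : Vec (n + 2)) : (cofactorMat U ν).IsSymm := by
  ext i j
  simp only [cofactorMat, Matrix.transpose_apply, Matrix.of_apply]
  rw [Finset.sum_comm]
  refine Finset.sum_congr rfl fun b _ => Finset.sum_congr rfl fun c _ => ?_
  rw [cofactorTens_reverse hU]
  ring

theorem vecMul_cofactorMat {n : ℕ} (U : Tens (n + 2) (Fin n ⊕ Fin n)) (ν : Vec (n + 2)) :
    ν ᵥ* cofactorMat U ν = 0 := by
  funext j
  simp only [cofactorMat, Matrix.vecMul, dotProduct, Matrix.of_apply, Finset.mul_sum,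
    Pi.zero_apply]
  have h : ∀ x : ℝ, x = -x → x = 0 := fun x hx => by linarith
  refine h _ ?_
  nth_rewrite 1 [Finset.sum_comm]
  simp only [← Finset.sum_neg_distrib]
  refine Finset.sum_congr rfl fun b _ => Finset.sum_congr rfl fun i _ =>
    Finset.sum_congr rfl fun c _ => ?_
  rw [cofactorTens_swap_left]
  ring

theorem cofactorMat_mulVec {n : ℕ} {U : Tens (n + 2) (Fin n ⊕ Fin n)} (hU : IsSymDyadForm U)
    (ν : Vec (n + 2)) : cofactorMat U ν *ᵥ ν = 0 := by
  rw [← Matrix.vecMul_transpose, (cofactorMat_isSymm hU ν).eq, vecMul_cofactorMat]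

theorem eval_cofactorTens {n : ℕ} (U : Tens (n + 2) (Fin n ⊕ Fin n)) (α ν β : Vec (n + 2)) :
    eval (cofactorTens U) ![α, ν, ν, β] = α ⬝ᵥ (cofactorMat U ν *ᵥ β) := by
  simp only [eval, sum_fin_four, Fin.prod_univ_four, Matrix.cons_val, cofactorMat, dotProduct,
    Matrix.mulVec, Matrix.of_apply, Finset.mul_sum, Finset.sum_mul]
  refine Finset.sum_congr rfl fun i _ => ?_
  rw [Finset.sum_congr rfl fun b _ => Finset.sum_comm, Finset.sum_comm]
  refine Finset.sum_congr rfl fun j _ => Finset.sum_congr rfl fun b _ =>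
    Finset.sum_congr rfl fun c _ => ?_
  ring

theorem eval_mapA {n : ℕ} {G : Mat (n + 2)} (hs : G.IsSymm) (hd : 0 < G.det)
    {U : Tens (n + 2) (Fin n ⊕ Fin n)} (hU : IsSymDyadForm U) (X N Y : Vec (n + 2)) :
    eval (mapA G U) ![X, N, N, Y] =
      G.det⁻¹ * ((G *ᵥ X) ⬝ᵥ (cofactorMat U (G *ᵥ N) *ᵥ (G *ᵥ Y))) := by
  rw [mapA_eq hs hd hU, eval_smul, eval_transform, hs.eq, ← eval_cofactorTens]
  congr 2
  funext l
  fin_cases l <;> rfl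

theorem cofactorMat_smul {n : ℕ} (U : Tens (n + 2) (Fin n ⊕ Fin n)) (r : ℝ) (ν : Vec (n + 2)) :
    cofactorMat U (r • ν) = (r * r) • cofactorMat U ν := by
  ext i j
  simp only [cofactorMat, Matrix.of_apply, Matrix.smul_apply, Pi.smul_apply, smul_eq_mul,
    Finset.mul_sum]
  refine Finset.sum_congr rfl fun b _ => Finset.sum_congr rfl fun c _ => ?_
  ring

/-! ### Families that are continuously differentiable in time -/

/-- `f' s x` is the time derivative of `f s x` for `x ∈ D`, and both are jointly continuous. -/
structure TimeC1 {X : Type*} [TopologicalSpace X] (D : Set X) (f f' : ℝ → X → ℝ) : Prop where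
  deriv : ∀ s, ∀ x ∈ D, HasDerivAt (fun s => f s x) (f' s x) s
  cont : ContinuousOn (fun p : ℝ × X => f p.1 p.2) (Set.univ ×ˢ D)
  cont' : ContinuousOn (fun p : ℝ × X => f' p.1 p.2) (Set.univ ×ˢ D)

namespace TimeC1

variable {X Y : Type*} [TopologicalSpace X] [TopologicalSpace Y] {D : Set X}
  {f f' h h' : ℝ → X → ℝ}

theorem const {c : X → ℝ} (hc : ContinuousOn c D) : TimeC1 D (fun _ x => c x) fun _ _ => 0 where
  deriv s x _ := hasDerivAt_const s (c x)
  cont := hc.comp continuousOn_snd fun _ hp => hp.2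
  cont' := continuousOn_const

theorem congr {k k' : ℝ → X → ℝ} (hf : TimeC1 D f f') (e : ∀ s, ∀ x ∈ D, k s x = f s x)
    (e' : ∀ s, ∀ x ∈ D, k' s x = f' s x) : TimeC1 D k k' where
  deriv s x hx := by
    rw [e' s x hx, funext fun s => e s x hx]
    exact hf.deriv s x hx
  cont := hf.cont.congr fun p hp => e p.1 p.2 hp.2
  cont' := hf.cont'.congr fun p hp => e' p.1 p.2 hp.2

theorem add (hf : TimeC1 D f f') (hh : TimeC1 D h h') :
    TimeC1 D (fun s x => f s x + h s x) fun s x => f' s x + h' s x where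
  deriv s x hx := (hf.deriv s x hx).add (hh.deriv s x hx)
  cont := hf.cont.add hh.cont
  cont' := hf.cont'.add hh.cont'

theorem neg (hf : TimeC1 D f f') : TimeC1 D (fun s x => -f s x) fun s x => -f' s x where
  deriv s x hx := (hf.deriv s x hx).neg
  cont := hf.cont.neg
  cont' := hf.cont'.neg

theorem sub (hf : TimeC1 D f f') (hh : TimeC1 D h h') :
    TimeC1 D (fun s x => f s x - h s x) fun s x => f' s x - h' s x where
  deriv s x hx := (hf.deriv s x hx).sub (hh.deriv s x hx)
  cont := hf.cont.sub hh.cont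
  cont' := hf.cont'.sub hh.cont'

theorem mul (hf : TimeC1 D f f') (hh : TimeC1 D h h') :
    TimeC1 D (fun s x => f s x * h s x) fun s x => f' s x * h s x + f s x * h' s x where
  deriv s x hx := (hf.deriv s x hx).mul (hh.deriv s x hx)
  cont := hf.cont.mul hh.cont
  cont' := (hf.cont'.mul hh.cont).add (hf.cont.mul hh.cont')

theorem const_mul {c : X → ℝ} (hc : ContinuousOn c D) (hf : TimeC1 D f f') :
    TimeC1 D (fun s x => c x * f s x) fun s x => c x * f' s x :=
  ((const hc).mul hf).congr (fun _ _ _ => rfl) fun _ _ _ => by ring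

theorem sum {ι : Type*} (S : Finset ι) {f f' : ι → ℝ → X → ℝ}
    (hf : ∀ i ∈ S, TimeC1 D (f i) (f' i)) :
    TimeC1 D (fun s x => ∑ i ∈ S, f i s x) fun s x => ∑ i ∈ S, f' i s x where
  deriv s x hx := HasDerivAt.fun_sum fun i hi => (hf i hi).deriv s x hx
  cont := continuousOn_finsetSum S fun i hi => (hf i hi).cont
  cont' := continuousOn_finsetSum S fun i hi => (hf i hi).cont'

theorem inv (hf : TimeC1 D f f') (h0 : ∀ s, ∀ x ∈ D, f s x ≠ 0) :
    TimeC1 D (fun s x => (f s x)⁻¹) fun s x => -f' s x / f s x ^ 2 where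
  deriv s x hx := (hf.deriv s x hx).fun_inv (h0 s x hx)
  cont := hf.cont.inv₀ fun p hp => h0 p.1 p.2 hp.2
  cont' := hf.cont'.neg.div (hf.cont.pow 2) fun p hp => pow_ne_zero 2 (h0 p.1 p.2 hp.2)

theorem sqrt (hf : TimeC1 D f f') (h0 : ∀ s, ∀ x ∈ D, 0 < f s x) :
    TimeC1 D (fun s x => √ (f s x)) fun s x => f' s x / (2 * √ (f s x)) where
  deriv s x hx := (hf.deriv s x hx).sqrt (h0 s x hx).ne'
  cont := hf.cont.sqrt
  cont' := hf.cont'.div (continuousOn_const.mul hf.cont.sqrt) fun p hp =>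
    mul_ne_zero two_ne_zero (Real.sqrt_pos.mpr (h0 p.1 p.2 hp.2)).ne'

theorem arccos (hf : TimeC1 D f f') (h1 : ∀ s, ∀ x ∈ D, f s x ^ 2 < 1) :
    TimeC1 D (fun s x => Real.arccos (f s x)) fun s x => -f' s x / √ (1 - f s x ^ 2) where
  deriv s x hx := by
    have h := sq_lt_one_iff_abs_lt_one _ |>.mp (h1 s x hx)
    have := (Real.hasDerivAt_arccos (abs_lt.mp h).1.ne' (abs_lt.mp h).2.ne).comp s
      (hf.deriv s x hx)
    refine this.congr_deriv ?_
    ring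
  cont := Real.continuous_arccos.comp_continuousOn hf.cont
  cont' := hf.cont'.neg.div (continuousOn_const.sub (hf.cont.pow 2)).sqrt fun p hp =>
    (Real.sqrt_pos.mpr (sub_pos.mpr (h1 p.1 p.2 hp.2))).ne'

theorem comp {E : Set Y} {Ψ : Y → X} (hf : TimeC1 D f f') (hΨ : ContinuousOn Ψ E)
    (hm : Set.MapsTo Ψ E D) : TimeC1 E (fun s y => f s (Ψ y)) fun s y => f' s (Ψ y) where
  deriv s _ hy := hf.deriv s _ (hm hy)
  cont := hf.cont.comp (continuousOn_fst.prodMk (hΨ.comp continuousOn_snd fun _ hp => hp.2))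
    fun _ hp => ⟨trivial, hm hp.2⟩
  cont' := hf.cont'.comp (continuousOn_fst.prodMk (hΨ.comp continuousOn_snd fun _ hp => hp.2))
    fun _ hp => ⟨trivial, hm hp.2⟩

theorem continuousOn_at (hf : TimeC1 D f f') (t : ℝ) : ContinuousOn (f t) D :=
  hf.cont.comp (continuousOn_const.prodMk continuousOn_id) fun _ hx => ⟨trivial, hx⟩

theorem continuousOn_deriv_at (hf : TimeC1 D f f') (t : ℝ) : ContinuousOn (f' t) D :=
  hf.cont'.comp (continuousOn_const.prodMk continuousOn_id) fun _ hx => ⟨trivial, hx⟩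

/-- The joint continuity of `f` follows from that of `f'` and the continuity of `f s` for each
`s`. -/
theorem of_deriv (hD : IsCompact D) (hd : ∀ s, ∀ x ∈ D, HasDerivAt (fun s => f s x) (f' s x) s)
    (hc : ∀ s, ContinuousOn (f s) D)
    (hc' : ContinuousOn (fun p : ℝ × X => f' p.1 p.2) (Set.univ ×ˢ D)) : TimeC1 D f f' where
  deriv := hd
  cont' := hc'
  cont := by
    rintro ⟨t, x⟩ ⟨-, hx⟩
    obtain ⟨C, hC⟩ := ((isCompact_Icc (a := t - 1) (b := t + 1)).prod hD).exists_bound_of_continuousOn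
      (hc'.mono (Set.prod_mono_left (Set.subset_univ _)))
    have hb : ∀ s ∈ Set.Icc (t - 1) (t + 1), ∀ z ∈ D, |f s z - f t z| ≤ C * |s - t| := by
      intro s hs z hz
      exact (convex_Icc (t - 1) (t + 1)).norm_image_sub_le_of_norm_hasDerivWithin_le
        (f' := fun r => f' r z)
        (fun r _ => (hd r z hz).hasDerivWithinAt) (fun r hr => hC (r, z) ⟨hr, hz⟩)
        ⟨by linarith, by linarith⟩ hs
    have h1 : Filter.Tendsto (fun p : ℝ × X => C * |p.1 - t|)
        (nhdsWithin (t, x) (Set.univ ×ˢ D)) (nhds 0) := by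
      have : Continuous fun p : ℝ × X => C * |p.1 - t| := by fun_prop
      simpa using this.continuousWithinAt (s := Set.univ ×ˢ D) (x := (t, x)) |>.tendsto
    have h2 : Filter.Tendsto (fun p : ℝ × X => f t p.2)
        (nhdsWithin (t, x) (Set.univ ×ˢ D)) (nhds (f t x)) :=
      ((hc t).comp continuousOn_snd fun p hp => hp.2 : ContinuousOn (fun p : ℝ × X => f t p.2) _)
        (t, x) ⟨trivial, hx⟩
    have h3 : Filter.Tendsto (fun p : ℝ × X => f p.1 p.2 - f t p.2)
        (nhdsWithin (t, x) (Set.univ ×ˢ D)) (nhds 0) := by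
      refine squeeze_zero_norm' ?_ h1
      have hn : {p : ℝ × X | p.1 ∈ Set.Icc (t - 1) (t + 1)} ∈ nhds (t, x) :=
        continuous_fst.continuousAt (Icc_mem_nhds (by simp) (by simp))
      filter_upwards [mem_nhdsWithin_of_mem_nhds hn, self_mem_nhdsWithin] with p hp hp'
      exact hb p.1 hp p.2 hp'.2
    simpa [ContinuousWithinAt] using h3.add h2

/-- Differentiation under the integral sign over a compact set. -/
theorem hasDerivAt_integral [MeasurableSpace X] [OpensMeasurableSpace X] [T2Space X]
    {μ : Measure X} [IsFiniteMeasureOnCompacts μ] [TopologicalSpace.PseudoMetrizableSpace X]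
    (hD : IsCompact D) (hf : TimeC1 D f f') (t : ℝ) :
    HasDerivAt (fun s => ∫ x in D, f s x ∂μ) (∫ x in D, f' t x ∂μ) t := by
  obtain ⟨C, hC⟩ := ((isCompact_Icc (a := t - 1) (b := t + 1)).prod hD).exists_bound_of_continuousOn
    (hf.cont'.mono (Set.prod_mono_left (Set.subset_univ _)))
  have hfin : IsFiniteMeasure (μ.restrict D) := ⟨by
    rw [Measure.restrict_apply_univ]
    exact hD.measure_lt_top⟩
  refine (hasDerivAt_integral_of_dominated_loc_of_deriv_le (bound := fun _ => C)
    (F' := f') (Icc_mem_nhds (by simp) (by simp) : Set.Icc (t - 1) (t + 1) ∈ nhds t) ?_ ?_ ?_ ?_ ?_ ?_).2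
  · exact Filter.Eventually.of_forall fun s =>
      ((hf.continuousOn_at s).integrableOn_compact hD).aestronglyMeasurable
  · exact (hf.continuousOn_at t).integrableOn_compact hD
  · exact ((hf.continuousOn_deriv_at t).integrableOn_compact hD).aestronglyMeasurable
  · filter_upwards [ae_restrict_mem hD.measurableSet] with x hx s hs
    exact hC (s, x) ⟨hs, hx⟩
  · exact integrable_const C
  · filter_upwards [ae_restrict_mem hD.measurableSet] with x hx s _
    exact hf.deriv s x hx

end TimeC1

theorem continuousOn_matrix_det {X : Type*} [TopologicalSpace X] {D : Set X} {m : ℕ}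
    {G : X → Mat m} (hG : ∀ i j, ContinuousOn (fun x => G x i j) D) :
    ContinuousOn (fun x => (G x).det) D :=
  (continuous_id.matrix_det (n := Fin m) (R := ℝ)).comp_continuousOn
    (continuousOn_pi.mpr fun i => continuousOn_pi.mpr fun j => hG i j)

theorem continuousOn_matrix_inv {X : Type*} [TopologicalSpace X] {D : Set X} {m : ℕ}
    {G : X → Mat m} (hG : ∀ i j, ContinuousOn (fun x => G x i j) D)
    (h0 : ∀ x ∈ D, (G x).det ≠ 0) (i j : Fin m) : ContinuousOn (fun x => (G x)⁻¹ i j) D := by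
  have h1 : ContinuousOn G D := continuousOn_pi.mpr fun i => continuousOn_pi.mpr fun j => hG i j
  intro x hx
  have h2 : ContinuousAt Inv.inv (G x) := by
    refine continuousAt_matrix_inv (G x) ?_
    rw [Ring.inverse_eq_inv']
    exact continuousAt_inv₀ (h0 x hx)
  have h3 : ContinuousWithinAt (fun x => (G x)⁻¹) D x := h2.comp_continuousWithinAt (h1 x hx)
  exact (((continuous_apply j).comp (continuous_apply i)).continuousAt.comp_continuousWithinAt h3 :)

theorem continuousOn_matrix_mul {X : Type*} [TopologicalSpace X] {D : Set X} {a b c : Type*}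
    [Fintype b] {A : X → Matrix a b ℝ} {B : X → Matrix b c ℝ}
    (hA : ∀ i j, ContinuousOn (fun x => A x i j) D)
    (hB : ∀ i j, ContinuousOn (fun x => B x i j) D) (i : a) (j : c) :
    ContinuousOn (fun x => (A x * B x) i j) D := by
  simp only [Matrix.mul_apply]
  exact continuousOn_finsetSum _ fun k _ => (hA i k).mul (hB k j)

/-- Jacobi's formula for the derivative of a determinant. -/
theorem hasDerivAt_det {m : ℕ} {G : ℝ → Mat m} {σ : Mat m} {t : ℝ}
    (hG : ∀ i j, HasDerivAt (fun s => G s i j) (σ i j) t) :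
    HasDerivAt (fun s => (G s).det) ((G t).adjugate * σ).trace t := by
  have h1 : ∀ π : Equiv.Perm (Fin m), HasDerivAt (fun s => ∏ i, G s (π i) i)
      (∑ k, ∏ i, ((G t).updateCol k fun j => σ j k) (π i) i) t := by
    intro π
    have := HasDerivAt.fun_finsetProd (u := Finset.univ) fun i _ => hG (π i) i
    refine this.congr_deriv (Finset.sum_congr rfl fun k _ => ?_)
    rw [← Finset.mul_prod_erase _ _ (Finset.mem_univ k), smul_eq_mul, mul_comm]
    congr 1
    · simp
    · refine Finset.prod_congr rfl fun i hi => ?_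
      rw [Matrix.updateCol_ne (Finset.ne_of_mem_erase hi)]
  have h2 : HasDerivAt (fun s => (G s).det) (∑ π : Equiv.Perm (Fin m),
      ((Equiv.Perm.sign π : ℤ) : ℝ) * ∑ k, ∏ i, ((G t).updateCol k fun j => σ j k) (π i) i) t := by
    simp only [Matrix.det_apply']
    exact HasDerivAt.fun_sum fun π _ => (h1 π).const_mul _
  refine h2.congr_deriv ?_
  simp only [Finset.mul_sum]
  rw [Finset.sum_comm, Matrix.trace]
  refine Finset.sum_congr rfl fun k _ => ?_
  rw [← Matrix.det_apply', ← Matrix.cramer_apply, Matrix.cramer_eq_adjugate_mulVec]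
  rfl

theorem hasDerivAt_det' {m : ℕ} {G : ℝ → Mat m} {σ : Mat m} {t : ℝ}
    (hG : ∀ i j, HasDerivAt (fun s => G s i j) (σ i j) t) (h0 : (G t).det ≠ 0) :
    HasDerivAt (fun s => (G s).det) ((G t).det * tr (G t) σ) t := by
  refine (hasDerivAt_det hG).congr_deriv ?_
  rw [tr, Lend, Matrix.inv_def, Ring.inverse_eq_inv', Matrix.smul_mul, Matrix.trace_smul,
    smul_eq_mul, mul_inv_cancel_left₀ h0]

theorem hasDerivAt_mul_entry {a b c : Type*} [Fintype b] {A : ℝ → Matrix a b ℝ}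
    {B : ℝ → Matrix b c ℝ} {A' : Matrix a b ℝ} {B' : Matrix b c ℝ} {t : ℝ}
    (hA : ∀ i j, HasDerivAt (fun s => A s i j) (A' i j) t)
    (hB : ∀ i j, HasDerivAt (fun s => B s i j) (B' i j) t) (i : a) (j : c) :
    HasDerivAt (fun s => (A s * B s) i j) ((A' * B t + A t * B') i j) t := by
  simp only [Matrix.mul_apply, Matrix.add_apply, ← Finset.sum_add_distrib]
  exact HasDerivAt.fun_sum fun k _ => (hA i k).mul (hB k j)

theorem hasDerivAt_inv_entry {m : ℕ} {G : ℝ → Mat m} {σ : Mat m} {t : ℝ}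
    (hG : ∀ i j, HasDerivAt (fun s => G s i j) (σ i j) t) (h0 : ∀ s, (G s).det ≠ 0)
    (i j : Fin m) :
    HasDerivAt (fun s => (G s)⁻¹ i j) ((-((G t)⁻¹ * σ * (G t)⁻¹)) i j) t := by
  have h1 : ∀ i j, ∃ τ, HasDerivAt (fun s => (G s)⁻¹ i j) τ t := by
    intro i j
    have hadj := hasDerivAt_det (G := fun s => (G s).updateRow j (Pi.single i 1))
      (σ := σ.updateRow j 0) (t := t) fun a b => by
      by_cases h : a = j
      · subst h
        simp only [Matrix.updateRow_self, Pi.zero_apply]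
        exact hasDerivAt_const _ _
      · simp only [Matrix.updateRow_ne h]
        exact hG a b
    have := ((hasDerivAt_det hG).fun_inv (h0 t)).mul hadj
    refine ⟨_, this.congr_of_eventuallyEq (Filter.Eventually.of_forall fun s => ?_)⟩
    simp [Matrix.inv_def, Ring.inverse_eq_inv', Matrix.adjugate_apply]
  choose τ hτ using h1
  have h2 := hasDerivAt_mul_entry hτ hG
  -- differentiate `G⁻¹ G = 1`
  have h3 : Matrix.of τ * G t + (G t)⁻¹ * σ = 0 := by
    ext a b
    refine (h2 a b).unique ?_
    have : (fun s => ((G s)⁻¹ * G s) a b) = fun _ => (1 : Mat m) a b := by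
      funext s
      rw [Matrix.nonsing_inv_mul _ (h0 s).isUnit]
    rw [this]
    exact hasDerivAt_const _ _
  have h4 : Matrix.of τ = -((G t)⁻¹ * σ * (G t)⁻¹) := by
    rw [← Matrix.neg_mul, ← eq_neg_of_add_eq_zero_left h3,
      Matrix.mul_nonsing_inv_cancel_right _ _ (h0 t).isUnit]
  rw [← h4]
  exact hτ i j

section TimeC1Matrix

variable {X : Type*} [TopologicalSpace X] {D : Set X} {m : ℕ} {G σ : ℝ → X → Mat m}

theorem TimeC1.det (hG : ∀ i j, TimeC1 D (fun s x => G s x i j) fun s x => σ s x i j)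
    (h0 : ∀ s, ∀ x ∈ D, (G s x).det ≠ 0) :
    TimeC1 D (fun s x => (G s x).det) fun s x => (G s x).det * tr (G s x) (σ s x) where
  deriv s x hx := hasDerivAt_det' (fun i j => (hG i j).deriv s x hx) (h0 s x hx)
  cont := continuousOn_matrix_det fun i j => (hG i j).cont
  cont' := by
    refine (continuousOn_matrix_det fun i j => (hG i j).cont).mul ?_
    simp only [tr, Lend, Matrix.trace, Matrix.diag_apply]
    exact continuousOn_finsetSum _ fun i _ => continuousOn_matrix_mul
      (continuousOn_matrix_inv (fun i j => (hG i j).cont) fun p hp => h0 p.1 p.2 hp.2)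
      (fun i j => (hG i j).cont') i i

theorem TimeC1.matrix_inv (hG : ∀ i j, TimeC1 D (fun s x => G s x i j) fun s x => σ s x i j)
    (h0 : ∀ s, ∀ x ∈ D, (G s x).det ≠ 0) (i j : Fin m) :
    TimeC1 D (fun s x => (G s x)⁻¹ i j)
      fun s x => (-((G s x)⁻¹ * σ s x * (G s x)⁻¹)) i j where
  deriv s x hx := hasDerivAt_inv_entry (G := fun s => G s x) (fun i j => (hG i j).deriv s x hx)
    (fun s => h0 s x hx) i j
  cont := continuousOn_matrix_inv (fun i j => (hG i j).cont) (fun p hp => h0 p.1 p.2 hp.2) i j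
  cont' := by
    have h1 := continuousOn_matrix_inv (fun i j => (hG i j).cont) fun p hp => h0 p.1 p.2 hp.2
    exact (continuousOn_matrix_mul (continuousOn_matrix_mul h1 fun i j => (hG i j).cont') h1
      i j).neg

/-- The time derivative of the form that a metric induces on covectors. -/
theorem TimeC1.inv_form (hG : ∀ i j, TimeC1 D (fun s x => G s x i j) fun s x => σ s x i j)
    (hs : ∀ s, ∀ x ∈ D, (G s x).IsSymm) (h0 : ∀ s, ∀ x ∈ D, (G s x).det ≠ 0) {ν μ : X → Vec m}
    (hν : ∀ i, ContinuousOn (fun x => ν x i) D) (hμ : ∀ i, ContinuousOn (fun x => μ x i) D) :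
    TimeC1 D (fun s x => ν x ⬝ᵥ ((G s x)⁻¹ *ᵥ μ x))
      fun s x => -bil (σ s x) ((G s x)⁻¹ *ᵥ ν x) ((G s x)⁻¹ *ᵥ μ x) := by
  have h := TimeC1.sum Finset.univ fun i _ => (TimeC1.sum Finset.univ fun j _ =>
    ((TimeC1.matrix_inv hG h0 i j).mul (TimeC1.const (hμ j)))).const_mul (hν i)
  refine h.congr (fun s x _ => rfl) fun s x hx => ?_
  have hsi : ((G s x)⁻¹).IsSymm := by
    rw [Matrix.IsSymm, Matrix.transpose_nonsing_inv, (hs s x hx).eq]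
  calc -bil (σ s x) ((G s x)⁻¹ *ᵥ ν x) ((G s x)⁻¹ *ᵥ μ x)
      = ν x ⬝ᵥ ((-((G s x)⁻¹ * σ s x * (G s x)⁻¹)) *ᵥ μ x) := by
        rw [bil, Matrix.neg_mulVec, dotProduct_neg, ← Matrix.mulVec_mulVec, ← Matrix.mulVec_mulVec,
          Matrix.dotProduct_mulVec (ν x), ← Matrix.mulVec_transpose, hsi.eq]
    _ = _ := by
        refine Finset.sum_congr rfl fun i _ => ?_
        congr 1
        simp [Matrix.mulVec, dotProduct]

end TimeC1Matrix

/-! ### Subspaces of an inner product space and the induced metrics -/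

section Metric

variable {m : ℕ} {G : Mat m}

theorem inv_isSymm (hs : G.IsSymm) : (G⁻¹).IsSymm := by
  rw [Matrix.IsSymm, Matrix.transpose_nonsing_inv, hs.eq]

theorem det_pos_of_pos (hs : G.IsSymm) (hp : ∀ X : Vec m, X ≠ 0 → 0 < bil G X X) : 0 < G.det := by
  refine Matrix.PosDef.det_pos (Matrix.PosDef.of_dotProduct_mulVec_pos ?_ fun X hX => ?_)
  · rw [Matrix.IsHermitian, Matrix.conjTranspose_eq_transpose_of_trivial, hs.eq]
  · simpa [bil] using hp X hX

theorem bil_sub_right (X Y Y' : Vec m) : bil G X (Y - Y') = bil G X Y - bil G X Y' := by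
  simp [bil, Matrix.mulVec_sub]

theorem bil_transpose_mul_mul {k : ℕ} (G : Mat k) (J : Matrix (Fin k) (Fin m) ℝ) (X Y : Vec m) :
    bil (Jᵀ * G * J) X Y = bil G (J *ᵥ X) (J *ᵥ Y) := by
  rw [bil, bil, ← Matrix.mulVec_mulVec, ← Matrix.mulVec_mulVec, Matrix.dotProduct_mulVec X,
    Matrix.vecMul_transpose]

theorem restrict_isSymm {k : ℕ} {G : Mat k} (hs : G.IsSymm) (J : Matrix (Fin k) (Fin m) ℝ) :
    (Jᵀ * G * J).IsSymm := by
  rw [Matrix.IsSymm, Matrix.transpose_mul, Matrix.transpose_mul, Matrix.transpose_transpose, hs.eq,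
    Matrix.mul_assoc]

theorem restrict_pos {k : ℕ} {G : Mat k} (hp : ∀ X : Vec k, X ≠ 0 → 0 < bil G X X)
    {J : Matrix (Fin k) (Fin m) ℝ} (hJ : ∀ w, J *ᵥ w = 0 → w = 0) (X : Vec m) (hX : X ≠ 0) :
    0 < bil (Jᵀ * G * J) X X := by
  rw [bil_transpose_mul_mul]
  exact hp _ fun h => hX (hJ X h)

/-- Vectors that form, together with the columns of `J`, a basis, and that are orthonormal and
orthogonal to these columns, complete the inverse of the induced metric to that of the metric. -/
theorem inv_eq_of_frame {k : ℕ} {r : Type} [Fintype r] [DecidableEq r]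
    {J : Matrix (Fin m) (Fin k) ℝ} {N : Matrix (Fin m) r ℝ} (hc : k + Fintype.card r = m)
    (hs : G.IsSymm) (hJN : Jᵀ * G * N = 0) (hN : Nᵀ * G * N = 1) (hJ : IsUnit (Jᵀ * G * J).det) :
    G⁻¹ = J * (Jᵀ * G * J)⁻¹ * Jᵀ + N * Nᵀ := by
  have hNJ : Nᵀ * G * J = 0 := by
    have := congrArg Matrix.transpose hJN
    rwa [Matrix.transpose_mul, Matrix.transpose_mul, Matrix.transpose_transpose, hs.eq,
      Matrix.transpose_zero, ← Matrix.mul_assoc] at this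
  have h1 : Matrix.fromRows ((Jᵀ * G * J)⁻¹ * Jᵀ * G) (Nᵀ * G) * Matrix.fromCols J N = 1 := by
    rw [Matrix.fromRows_mul_fromCols, hN, hNJ, Matrix.mul_assoc _ Jᵀ G, Matrix.mul_assoc _ _ J,
      Matrix.nonsing_inv_mul _ hJ, Matrix.mul_assoc _ _ N, hJN, Matrix.mul_zero,
      Matrix.fromBlocks_one]
  have h2 := (Matrix.mul_eq_one_comm_of_card_eq (Fin k ⊕ r) (Fin m) ℝ (by simp [hc])).mp h1
  rw [Matrix.fromCols_mul_fromRows] at h2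
  refine Matrix.inv_eq_left_inv ?_
  rw [Matrix.add_mul, ← h2]
  simp only [Matrix.mul_assoc]

theorem inv_eq_of_orthonormal {k : ℕ} {r : Type} [Fintype r] [DecidableEq r]
    {J : Matrix (Fin m) (Fin k) ℝ} {e : r → Vec m} (hc : k + Fintype.card r = m) (hs : G.IsSymm)
    (hJe : ∀ a, (G *ᵥ e a) ᵥ* J = 0) (he : ∀ a b, bil G (e a) (e b) = if a = b then 1 else 0)
    (hJ : IsUnit (Jᵀ * G * J).det) :
    G⁻¹ = J * (Jᵀ * G * J)⁻¹ * Jᵀ + ∑ a, Matrix.vecMulVec (e a) (e a) := by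
  rw [inv_eq_of_frame (J := J) (N := Matrix.of fun i a => e a i) hc hs ?_ ?_ hJ]
  · congr 1
    ext i j
    simp [Matrix.mul_apply, Matrix.sum_apply, Matrix.vecMulVec_apply]
  · ext p a
    rw [Matrix.mul_assoc]
    have := congrFun (hJe a) p
    simp only [Matrix.vecMul, dotProduct, Pi.zero_apply] at this
    simp only [Matrix.mul_apply, Matrix.transpose_apply, Matrix.of_apply, Matrix.zero_apply]
    rw [← this]
    exact Finset.sum_congr rfl fun i _ => mul_comm _ _
  · ext a b
    rw [Matrix.mul_assoc, Matrix.one_apply, ← he a b]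
    rfl

theorem trace_vecMulVec_mul (X Y : Vec m) (σ : Mat m) :
    (Matrix.vecMulVec X Y * σ).trace = bil σ Y X := by
  rw [Matrix.vecMulVec_mul, Matrix.trace_vecMulVec, bil, Matrix.dotProduct_mulVec, dotProduct_comm]

theorem trace_tangential {k : ℕ} (J : Matrix (Fin m) (Fin k) ℝ) (H : Mat k) (σ : Mat m) :
    (J * H⁻¹ * Jᵀ * σ).trace = tr H (Jᵀ * σ * J) := by
  rw [tr, Lend, Matrix.mul_assoc, Matrix.mul_assoc, Matrix.trace_mul_comm]
  simp only [Matrix.mul_assoc]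

variable (hs : G.IsSymm) (hp : ∀ X : Vec m, X ≠ 0 → 0 < bil G X X)
include hs hp

omit hs in
theorem mulVec_unitNormal (ν : Vec m) :
    G *ᵥ unitNormal G ν = (√ (ν ⬝ᵥ (G⁻¹ *ᵥ ν)))⁻¹ • ν := by
  rw [unitNormal, Matrix.mulVec_smul, mulVec_inv_mulVec hp]

omit hp in
theorem inv_form_comm (ν μ : Vec m) : ν ⬝ᵥ (G⁻¹ *ᵥ μ) = μ ⬝ᵥ (G⁻¹ *ᵥ ν) :=
  bil_comm (inv_isSymm hs) ν μ

/-- The Gram determinant of two independent covectors is positive. -/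
theorem inv_form_gram_pos {ν μ : Vec m} (hν : ν ≠ 0) (hμ : ∀ r : ℝ, μ ≠ r • ν) :
    0 < (ν ⬝ᵥ (G⁻¹ *ᵥ ν)) * (μ ⬝ᵥ (G⁻¹ *ᵥ μ)) - (ν ⬝ᵥ (G⁻¹ *ᵥ μ)) ^ 2 := by
  set P := ν ⬝ᵥ (G⁻¹ *ᵥ ν) with hP
  set R := ν ⬝ᵥ (G⁻¹ *ᵥ μ) with hR
  have hPp : 0 < P := inv_form_pos hs hp hν
  have h := inv_form_pos hs hp (sub_ne_zero.mpr (hμ (R / P)))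
  have h2 : μ ⬝ᵥ (G⁻¹ *ᵥ ν) = R := inv_form_comm hs _ _
  have e : (μ - (R / P) • ν) ⬝ᵥ (G⁻¹ *ᵥ (μ - (R / P) • ν)) = μ ⬝ᵥ (G⁻¹ *ᵥ μ) - R ^ 2 / P := by
    simp only [Matrix.mulVec_sub, Matrix.mulVec_smul, dotProduct_sub, sub_dotProduct,
      dotProduct_smul, smul_dotProduct, smul_eq_mul, h2, ← hR, ← hP]
    field_simp
    ring
  rw [e, sub_pos, div_lt_iff₀ hPp] at h
  linarith

theorem tangentialGrad_eq {ν : Vec m} (hν : ν ≠ 0) (μ : Vec m) :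
    tangentialGrad G ν μ =
      G⁻¹ *ᵥ μ - ((ν ⬝ᵥ (G⁻¹ *ᵥ μ)) / (ν ⬝ᵥ (G⁻¹ *ᵥ ν))) • (G⁻¹ *ᵥ ν) := by
  have hP := inv_form_pos hs hp hν
  rw [tangentialGrad, unitNormal, dotProduct_smul, smul_smul, inv_form_comm hs μ ν, smul_eq_mul]
  congr 2
  rw [mul_right_comm, ← mul_inv, Real.mul_self_sqrt hP.le, div_eq_inv_mul]

theorem bil_tangentialGrad {ν : Vec m} (hν : ν ≠ 0) (μ : Vec m) :
    bil G (tangentialGrad G ν μ) (tangentialGrad G ν μ) =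
      μ ⬝ᵥ (G⁻¹ *ᵥ μ) - (ν ⬝ᵥ (G⁻¹ *ᵥ μ)) ^ 2 / (ν ⬝ᵥ (G⁻¹ *ᵥ ν)) := by
  have hP := (inv_form_pos hs hp hν).ne'
  rw [tangentialGrad_eq hs hp hν]
  simp only [bil_sub_left, bil_sub_right, bil_smul_left, bil_smul_right, bil_inv_mulVec hs hp,
    inv_form_comm hs μ ν]
  field_simp
  ring

theorem bil_tangentialGrad_pos {ν μ : Vec m} (hν : ν ≠ 0) (hμ : ∀ r : ℝ, μ ≠ r • ν) :
    0 < bil G (tangentialGrad G ν μ) (tangentialGrad G ν μ) := by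
  have h := inv_form_gram_pos hs hp hν hμ
  have hP := inv_form_pos hs hp hν
  rw [bil_tangentialGrad hs hp hν, sub_pos, div_lt_iff₀ hP]
  linarith

theorem mulVec_unitConormal {ν : Vec m} (hν : ν ≠ 0) (μ : Vec m) :
    G *ᵥ unitConormal G ν μ =
      (√ (bil G (tangentialGrad G ν μ) (tangentialGrad G ν μ)))⁻¹ •
        (μ - ((ν ⬝ᵥ (G⁻¹ *ᵥ μ)) / (ν ⬝ᵥ (G⁻¹ *ᵥ ν))) • ν) := by
  rw [unitConormal, Matrix.mulVec_smul]
  nth_rewrite 3 [tangentialGrad_eq hs hp hν]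
  rw [Matrix.mulVec_sub, Matrix.mulVec_smul, mulVec_inv_mulVec hp, mulVec_inv_mulVec hp]

/-- The derivative of the inverse norm of a conormal covector is a component of `σ`. -/
theorem bil_unitNormal_unitNormal (σ : Mat m) (ν : Vec m) (hν : ν ≠ 0) :
    bil σ (unitNormal G ν) (unitNormal G ν) =
      bil σ (G⁻¹ *ᵥ ν) (G⁻¹ *ᵥ ν) / (ν ⬝ᵥ (G⁻¹ *ᵥ ν)) := by
  rw [unitNormal, bil_smul_left, bil_smul_right, ← mul_assoc, ← mul_inv,
    Real.mul_self_sqrt (inv_form_pos hs hp hν).le, inv_mul_eq_div]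

theorem bil_unitConormal_unitConormal (σ : Mat m) {ν μ : Vec m} (hν : ν ≠ 0)
    (hμ : ∀ r : ℝ, μ ≠ r • ν) :
    bil σ (unitConormal G ν μ) (unitConormal G ν μ) =
      bil σ (tangentialGrad G ν μ) (tangentialGrad G ν μ) /
        bil G (tangentialGrad G ν μ) (tangentialGrad G ν μ) := by
  rw [unitConormal, bil_smul_left, bil_smul_right, ← mul_assoc, ← mul_inv,
    Real.mul_self_sqrt (bil_tangentialGrad_pos hs hp hν hμ).le, inv_mul_eq_div]

end Metric

/-- The inverse metric on a hypersurface, as a tensor of the ambient space. -/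
def tangentialInv {m k : ℕ} (G : Mat k) (J : Matrix (Fin k) (Fin m) ℝ) : Mat k :=
  J * (Jᵀ * G * J)⁻¹ * Jᵀ

section Facet

variable {m : ℕ} {G : Mat (m + 1)} (hs : G.IsSymm)
  (hp : ∀ X : Vec (m + 1), X ≠ 0 → 0 < bil G X X) {J : Matrix (Fin (m + 1)) (Fin m) ℝ}
  (hJ : ∀ w, J *ᵥ w = 0 → w = 0) {ν : Vec (m + 1)} (hν : ν ≠ 0) (hνJ : ν ᵥ* J = 0)
include hs hp hJ hν hνJ

theorem inv_eq_tangentialInv_add :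
    G⁻¹ = tangentialInv G J + Matrix.vecMulVec (unitNormal G ν) (unitNormal G ν) := by
  have h := unitNormal_spec hs hp hν
  have h1 : (G *ᵥ unitNormal G ν) ᵥ* J = 0 := by
    rw [mulVec_unitNormal hp, Matrix.smul_vecMul, hνJ, smul_zero]
  rw [inv_eq_of_orthonormal (r := Unit) (J := J) (e := fun _ => unitNormal G ν) (by simp) hs
    (fun _ => h1) (fun _ _ => by simp [h.1]) (isUnit_det_of_pos (restrict_pos hp hJ)), tangentialInv]
  simp

theorem tr_eq_facet (σ : Mat (m + 1)) :
    tr G σ = tr (Jᵀ * G * J) (Jᵀ * σ * J) + bil σ (unitNormal G ν) (unitNormal G ν) := by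
  rw [tr, Lend, inv_eq_tangentialInv_add hs hp hJ hν hνJ, Matrix.add_mul, Matrix.trace_add,
    trace_vecMulVec_mul, tangentialInv, trace_tangential]

/-- A tensor whose contractions with the conormal vanish is determined by its restriction. -/
theorem tangentialInv_mul_mul {C : Mat (m + 1)} (hC : ν ᵥ* C = 0) :
    tangentialInv G J * (G * C) = C := by
  have h : tangentialInv G J = G⁻¹ - Matrix.vecMulVec (unitNormal G ν) (unitNormal G ν) :=
    eq_sub_of_add_eq (inv_eq_tangentialInv_add hs hp hJ hν hνJ).symm
  have h2 : unitNormal G ν ᵥ* (G * C) = 0 := by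
    rw [← Matrix.vecMul_vecMul, ← Matrix.mulVec_transpose G, hs.eq, mulVec_unitNormal hp,
      Matrix.smul_vecMul, hC, smul_zero]
  rw [h, Matrix.sub_mul, Matrix.nonsing_inv_mul_cancel_left _ _ (isUnit_det_of_pos hp),
    Matrix.vecMulVec_mul, h2, Matrix.vecMulVec_zero, sub_zero]

end Facet

section FacetA

variable {n : ℕ} {G : Mat (n + 2)} (hs : G.IsSymm)
  (hp : ∀ X : Vec (n + 2), X ≠ 0 → 0 < bil G X X)
  {U : Tens (n + 2) (Fin n ⊕ Fin n)} (hU : IsSymDyadForm U) {ν : Vec (n + 2)} (hν : ν ≠ 0)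
include hs hp hU hν

/-- The factor `(det G |ν|²)⁻¹` in `A_{F𝔫𝔫F}`. -/
theorem contractNN_mapA :
    contractNN (mapA G U) (unitNormal G ν) =
      (G.det * (ν ⬝ᵥ (G⁻¹ *ᵥ ν)))⁻¹ • (G * cofactorMat U ν * G) := by
  have hP := inv_form_pos hs hp hν
  ext i j
  rw [contractNN, Matrix.of_apply, eval_mapA hs (det_pos_of_pos hs hp) hU, mulVec_unitNormal hp,
    cofactorMat_smul, ← mul_inv, Real.mul_self_sqrt hP.le, Matrix.smul_mulVec, dotProduct_smul,
    smul_eq_mul, ← mul_assoc, ← mul_inv, Matrix.smul_apply, smul_eq_mul]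
  congr 1
  rw [frame, frame, Matrix.mulVec_single_one, Matrix.mulVec_single_one, Matrix.mul_assoc]
  simp only [Matrix.mul_apply, dotProduct, Matrix.mulVec, Matrix.col_apply]
  exact Finset.sum_congr rfl fun a _ => by rw [hs.apply]

variable {J : Matrix (Fin (n + 2)) (Fin (n + 1)) ℝ} (hJ : ∀ w, J *ᵥ w = 0 → w = 0)
  (hνJ : ν ᵥ* J = 0)
include hJ hνJ

/-- Raising the indices of `A_{F𝔫𝔫F}`. -/
theorem raise_contractNN :
    J * ((Jᵀ * G * J)⁻¹ * (Jᵀ * contractNN (mapA G U) (unitNormal G ν) * J) * (Jᵀ * G * J)⁻¹) * Jᵀ =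
      (G.det * (ν ⬝ᵥ (G⁻¹ *ᵥ ν)))⁻¹ • cofactorMat U ν := by
  rw [contractNN_mapA hs hp hU hν]
  simp only [Matrix.mul_smul, Matrix.smul_mul]
  congr 1
  have h1 := tangentialInv_mul_mul hs hp hJ hν hνJ (vecMul_cofactorMat U ν)
  have h2 := congrArg Matrix.transpose h1
  have hT : (tangentialInv G J)ᵀ = tangentialInv G J := by
    rw [tangentialInv, Matrix.transpose_mul, Matrix.transpose_mul, Matrix.transpose_transpose,
      (inv_isSymm (restrict_isSymm hs J)).eq]
    simp only [Matrix.mul_assoc]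
  rw [Matrix.transpose_mul, Matrix.transpose_mul, (cofactorMat_isSymm hU ν).eq, hs.eq, hT] at h2
  calc _ = tangentialInv G J * (G * (cofactorMat U ν * G * tangentialInv G J)) := by
        simp only [tangentialInv, Matrix.mul_assoc]
    _ = _ := by rw [h2, h1]

/-- The inner product of `A_{F𝔫𝔫F}` with the restriction of an ambient form. -/
theorem ip_contractNN (B : Mat (n + 2)) :
    ip (Jᵀ * G * J) (ofMat (Jᵀ * B * J))
        (ofMat (Jᵀ * contractNN (mapA G U) (unitNormal G ν) * J)) =
      (G.det * (ν ⬝ᵥ (G⁻¹ *ᵥ ν)))⁻¹ * (B * cofactorMat U ν).trace := by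
  set A := Jᵀ * contractNN (mapA G U) (unitNormal G ν) * J with hA
  set H := Jᵀ * G * J with hH
  have hHs : (H⁻¹).IsSymm := inv_isSymm (restrict_isSymm hs J)
  have hB : ∀ B' : Mat (n + 1), ip H (ofMat B') (ofMat A) = (B'ᵀ * (H⁻¹ * A * H⁻¹)).trace := by
    intro B'
    simp only [ip, sum_fin_two, ofMat, Fin.prod_univ_two, Matrix.cons_val, Matrix.trace,
      Matrix.diag_apply, Matrix.mul_apply, Matrix.transpose_apply, Finset.sum_mul, Finset.mul_sum]
    rw [Finset.sum_comm]
    refine Finset.sum_congr rfl fun b _ => Finset.sum_congr rfl fun a _ => ?_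
    rw [Finset.sum_comm]
    refine Finset.sum_congr rfl fun d _ => Finset.sum_congr rfl fun c _ => ?_
    rw [hHs.apply, ← hHs.apply b d]
    ring
  have hC : (Bᵀ * cofactorMat U ν).trace = (B * cofactorMat U ν).trace := by
    rw [← Matrix.trace_transpose, Matrix.transpose_mul, Matrix.transpose_transpose,
      (cofactorMat_isSymm hU ν).eq, Matrix.trace_mul_comm]
  have h1 := congrArg (fun K => (Bᵀ * K).trace) (raise_contractNN hs hp hU hν hJ hνJ)
  simp only [Matrix.mul_smul, Matrix.trace_smul, smul_eq_mul] at h1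
  rw [hB, ← hC, ← h1, ← Matrix.mul_assoc Bᵀ, Matrix.trace_mul_comm _ Jᵀ, ← hH, ← hA]
  simp only [Matrix.transpose_mul, Matrix.transpose_transpose, Matrix.mul_assoc]

theorem triple_contractNN (B σ : Mat (n + 2)) :
    triple (Jᵀ * G * J) (Jᵀ * B * J) (Jᵀ * σ * J)
        (Jᵀ * contractNN (mapA G U) (unitNormal G ν) * J) =
      (G.det * (ν ⬝ᵥ (G⁻¹ *ᵥ ν)))⁻¹ * (B * tangentialInv G J * σ * cofactorMat U ν).trace := by
  have h1 := congrArg (fun K => (B * tangentialInv G J * σ * K).trace)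
    (raise_contractNN hs hp hU hν hJ hνJ)
  simp only [Matrix.mul_smul, Matrix.trace_smul, smul_eq_mul] at h1
  rw [← h1, ← Matrix.mul_assoc _ _ Jᵀ, Matrix.trace_mul_comm _ Jᵀ, triple, tangentialInv]
  simp only [Matrix.mul_assoc]

theorem triple_traceRev_contractNN (B σ : Mat (n + 2)) :
    triple (Jᵀ * G * J) (Jᵀ * B * J) (traceRev (Jᵀ * G * J) (Jᵀ * σ * J))
        (Jᵀ * contractNN (mapA G U) (unitNormal G ν) * J) =
      (G.det * (ν ⬝ᵥ (G⁻¹ *ᵥ ν)))⁻¹ * ((B * tangentialInv G J * σ * cofactorMat U ν).trace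
        - tr (Jᵀ * G * J) (Jᵀ * σ * J) * (B * cofactorMat U ν).trace) := by
  have h1 : ∀ ρ ρ' τ η : Mat (n + 1), ∀ r : ℝ, triple (Jᵀ * G * J) τ (ρ - r • ρ') η =
      triple (Jᵀ * G * J) τ ρ η - r * triple (Jᵀ * G * J) τ ρ' η := by
    intro ρ ρ' τ η r
    simp [triple, Matrix.mul_sub, Matrix.sub_mul]
  rw [traceRev, h1, triple_contractNN hs hp hU hν hJ hνJ, triple_contractNN hs hp hU hν hJ hνJ,
    Matrix.mul_assoc (B * tangentialInv G J) G, Matrix.mul_assoc B _ (G * _),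
    tangentialInv_mul_mul hs hp hJ hν hνJ (vecMul_cofactorMat U ν)]
  ring

end FacetA

section Ridge

variable {m : ℕ} {G : Mat (m + 2)} (hs : G.IsSymm)
  (hp : ∀ X : Vec (m + 2), X ≠ 0 → 0 < bil G X X) {ν μ : Vec (m + 2)}
  (hν : ν ≠ 0) (hμ : ∀ r : ℝ, μ ≠ r • ν)
include hs hp hν hμ

theorem tr_eq_ridge {J : Matrix (Fin (m + 2)) (Fin m) ℝ} (hJ : ∀ w, J *ᵥ w = 0 → w = 0)
    (hνJ : ν ᵥ* J = 0) (hμJ : μ ᵥ* J = 0) (σ : Mat (m + 2)) :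
    tr G σ = tr (Jᵀ * G * J) (Jᵀ * σ * J) + bil σ (unitNormal G ν) (unitNormal G ν) +
      bil σ (unitConormal G ν μ) (unitConormal G ν μ) := by
  have h := unitNormal_spec hs hp hν
  have h' := unitConormal_spec hs hp hν hμ
  have h1 : (G *ᵥ unitNormal G ν) ᵥ* J = 0 := by
    rw [mulVec_unitNormal hp, Matrix.smul_vecMul, hνJ, smul_zero]
  have h2 : (G *ᵥ unitConormal G ν μ) ᵥ* J = 0 := by
    rw [mulVec_unitConormal hs hp hν, Matrix.smul_vecMul, Matrix.sub_vecMul, Matrix.smul_vecMul,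
      hνJ, hμJ, smul_zero, sub_zero, smul_zero]
  have h3 : bil G (unitNormal G ν) (unitConormal G ν μ) = 0 := h.2.1 _ h'.1
  have := inv_eq_of_orthonormal (J := J)
    (e := ![unitNormal G ν, unitConormal G ν μ]) (by simp) hs
    (fun a => by fin_cases a; exacts [h1, h2])
    (fun a b => by
      fin_cases a <;> fin_cases b
      · simpa using h.1
      · simpa using h3
      · simpa [bil_comm hs] using h3
      · simpa using h'.2.1) (isUnit_det_of_pos (restrict_pos hp hJ))
  rw [tr, Lend, this, Fin.sum_univ_two, ← add_assoc, Matrix.add_mul, Matrix.add_mul,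
    Matrix.trace_add, Matrix.trace_add, Matrix.cons_val_zero, Matrix.cons_val_one,
    trace_vecMulVec_mul, trace_vecMulVec_mul, trace_tangential, Matrix.cons_val_zero]

/-- The function `A(𝔪, 𝔫, 𝔫, 𝔪)` in terms of the metric-independent number `μᵀ C_ν μ`. -/
theorem eval_mapA_conormal {U : Tens (m + 2) (Fin m ⊕ Fin m)} (hU : IsSymDyadForm U) :
    eval (mapA G U) ![unitConormal G ν μ, unitNormal G ν, unitNormal G ν, unitConormal G ν μ] =
      (G.det * ((ν ⬝ᵥ (G⁻¹ *ᵥ ν)) * (μ ⬝ᵥ (G⁻¹ *ᵥ μ)) - (ν ⬝ᵥ (G⁻¹ *ᵥ μ)) ^ 2))⁻¹ *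
        (μ ⬝ᵥ (cofactorMat U ν *ᵥ μ)) := by
  have hP := inv_form_pos hs hp hν
  have hb := bil_tangentialGrad_pos hs hp hν hμ
  have hl := vecMul_cofactorMat U ν
  have hr := cofactorMat_mulVec hU ν
  have hg : (ν ⬝ᵥ (G⁻¹ *ᵥ ν)) * (μ ⬝ᵥ (G⁻¹ *ᵥ μ)) - (ν ⬝ᵥ (G⁻¹ *ᵥ μ)) ^ 2 =
      (ν ⬝ᵥ (G⁻¹ *ᵥ ν)) * bil G (tangentialGrad G ν μ) (tangentialGrad G ν μ) := by
    rw [bil_tangentialGrad hs hp hν]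
    field_simp
  rw [eval_mapA hs (det_pos_of_pos hs hp) hU, mulVec_unitNormal hp, cofactorMat_smul,
    mulVec_unitConormal hs hp hν, hg]
  set b := bil G (tangentialGrad G ν μ) (tangentialGrad G ν μ)
  set P := ν ⬝ᵥ (G⁻¹ *ᵥ ν)
  set c := (ν ⬝ᵥ (G⁻¹ *ᵥ μ)) / P
  have e : (μ - c • ν) ⬝ᵥ (cofactorMat U ν *ᵥ (μ - c • ν)) = μ ⬝ᵥ (cofactorMat U ν *ᵥ μ) := by
    rw [Matrix.mulVec_sub, Matrix.mulVec_smul, hr, smul_zero, sub_zero, sub_dotProduct,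
      smul_dotProduct, Matrix.dotProduct_mulVec ν, hl, zero_dotProduct, smul_zero, sub_zero]
  rw [Matrix.smul_mulVec, Matrix.mulVec_smul, dotProduct_smul, dotProduct_smul, smul_dotProduct, e,
    smul_eq_mul, smul_eq_mul, smul_eq_mul, ← mul_inv, Real.mul_self_sqrt hP.le,
    ← mul_assoc (√ b)⁻¹, ← mul_inv, Real.mul_self_sqrt hb.le, mul_inv, mul_inv]
  ring

omit hμ in
theorem bil_unitNormal_unitConormal (σ : Mat (m + 2)) :
    bil σ (unitNormal G ν) (unitConormal G ν μ) =
      (bil σ (G⁻¹ *ᵥ ν) (G⁻¹ *ᵥ μ) -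
        (ν ⬝ᵥ (G⁻¹ *ᵥ μ)) / (ν ⬝ᵥ (G⁻¹ *ᵥ ν)) * bil σ (G⁻¹ *ᵥ ν) (G⁻¹ *ᵥ ν)) /
      √ ((ν ⬝ᵥ (G⁻¹ *ᵥ ν)) * (μ ⬝ᵥ (G⁻¹ *ᵥ μ)) - (ν ⬝ᵥ (G⁻¹ *ᵥ μ)) ^ 2) := by
  have hP := inv_form_pos hs hp hν
  have hg : (ν ⬝ᵥ (G⁻¹ *ᵥ ν)) * (μ ⬝ᵥ (G⁻¹ *ᵥ μ)) - (ν ⬝ᵥ (G⁻¹ *ᵥ μ)) ^ 2 =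
      (ν ⬝ᵥ (G⁻¹ *ᵥ ν)) * bil G (tangentialGrad G ν μ) (tangentialGrad G ν μ) := by
    rw [bil_tangentialGrad hs hp hν]
    field_simp
  rw [unitNormal, unitConormal, bil_smul_left, bil_smul_right, hg, Real.sqrt_mul hP.le]
  nth_rewrite 3 [tangentialGrad_eq hs hp hν]
  rw [bil_sub_right, bil_smul_right, div_eq_mul_inv _ (_ * _), mul_inv]
  ring

/-- The cosine of the dihedral angle is that of the angle of the gradients, up to sign. -/
theorem bil_unitConormal_unitConormal_swap :
    bil G (unitConormal G ν μ) (unitConormal G μ ν) =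
      -(ν ⬝ᵥ (G⁻¹ *ᵥ μ)) * (√ ((ν ⬝ᵥ (G⁻¹ *ᵥ ν)) * (μ ⬝ᵥ (G⁻¹ *ᵥ μ))))⁻¹ := by
  have hμ0 : μ ≠ 0 := by simpa using hμ 0
  have hP := inv_form_pos hs hp hν
  have hQ := inv_form_pos hs hp hμ0
  have hD := inv_form_gram_pos hs hp hν hμ
  rw [unitConormal, unitConormal, bil_smul_left, bil_smul_right, bil_tangentialGrad hs hp hν,
    bil_tangentialGrad hs hp hμ0, tangentialGrad_eq hs hp hν, tangentialGrad_eq hs hp hμ0]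
  simp only [bil_sub_left, bil_sub_right, bil_smul_left, bil_smul_right, bil_inv_mulVec hs hp,
    inv_form_comm hs μ ν]
  set P := ν ⬝ᵥ (G⁻¹ *ᵥ ν)
  set Q := μ ⬝ᵥ (G⁻¹ *ᵥ μ)
  set R := ν ⬝ᵥ (G⁻¹ *ᵥ μ)
  rw [show Q - R ^ 2 / P = (P * Q - R ^ 2) / P by field_simp,
    show P - R ^ 2 / Q = (P * Q - R ^ 2) / Q by field_simp, Real.sqrt_div hD.le,
    Real.sqrt_div hD.le, Real.sqrt_mul hP.le]
  have e1 := Real.sq_sqrt hD.le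
  have e2 := Real.sq_sqrt hP.le
  have e3 := Real.sq_sqrt hQ.le
  have n1 := (Real.sqrt_pos.mpr hD).ne'
  have n2 := (Real.sqrt_pos.mpr hP).ne'
  have n3 := (Real.sqrt_pos.mpr hQ).ne'
  set a := √ (P * Q - R ^ 2)
  set p := √ P
  set q := √ Q
  have e4 : R ^ 2 = p ^ 2 * q ^ 2 - a ^ 2 := by rw [e1, e2, e3]; ring
  rw [← e2, ← e3]
  field_simp
  linear_combination R * e4

end Ridge

/-! ### Time derivatives of volumes and angles -/

theorem tr_transpose_mul_mul {k : ℕ} {G : Mat k} (σ : Mat k) {J : Mat k}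
    (hJ : IsUnit J.det) : tr (Jᵀ * G * J) (Jᵀ * σ * J) = tr G σ := by
  have hJt : IsUnit (Jᵀ).det := by rwa [Matrix.det_transpose]
  rw [← trace_tangential, tr, Lend, Matrix.mul_inv_rev, Matrix.mul_inv_rev, ← Matrix.mul_assoc J,
    Matrix.mul_nonsing_inv _ hJ, Matrix.one_mul, Matrix.mul_assoc G⁻¹, Matrix.nonsing_inv_mul _ hJt,
    Matrix.mul_one]

section Factors

variable {X : Type*} [TopologicalSpace X] {D : Set X} {m k : ℕ}

theorem TimeC1.sqrt_det {G σ : ℝ → X → Mat m}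
    (hG : ∀ i j, TimeC1 D (fun s x => G s x i j) fun s x => σ s x i j)
    (h0 : ∀ s, ∀ x ∈ D, 0 < (G s x).det) :
    TimeC1 D (fun s x => √ (G s x).det) fun s x => (1 / 2) * tr (G s x) (σ s x) * √ (G s x).det := by
  refine ((TimeC1.det hG fun s x hx => (h0 s x hx).ne').sqrt h0).congr (fun _ _ _ => rfl)
    fun s x hx => ?_
  have h := Real.sqrt_pos.mpr (h0 s x hx)
  rw [eq_div_iff (by positivity)]
  linear_combination (tr (G s x) (σ s x)) * Real.mul_self_sqrt (h0 s x hx).le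

variable {G σ : ℝ → X → Mat k}
  (hG : ∀ i j, TimeC1 D (fun s x => G s x i j) fun s x => σ s x i j)
  (hs : ∀ s, ∀ x ∈ D, (G s x).IsSymm)
  (hp : ∀ s, ∀ x ∈ D, ∀ X : Vec k, X ≠ 0 → 0 < bil (G s x) X X)
include hG

theorem TimeC1.transpose_mul_mul {J : X → Matrix (Fin k) (Fin m) ℝ}
    (hJc : ∀ i j, ContinuousOn (fun x => J x i j) D) (p q : Fin m) :
    TimeC1 D (fun s x => ((J x)ᵀ * G s x * J x) p q) fun s x => ((J x)ᵀ * σ s x * J x) p q := by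
  simp only [Matrix.mul_apply, Matrix.transpose_apply]
  refine TimeC1.sum _ fun j _ => ?_
  refine ((TimeC1.sum _ fun i _ => (hG i j).const_mul (hJc i p)).mul (TimeC1.const (hJc j q))).congr
    (fun _ _ _ => rfl) fun _ _ _ => by ring

include hs hp

theorem TimeC1.inv_det : TimeC1 D (fun s x => (G s x).det⁻¹)
    fun s x => -tr (G s x) (σ s x) * (G s x).det⁻¹ := by
  have h0 : ∀ s, ∀ x ∈ D, (G s x).det ≠ 0 := fun s x hx =>
    (det_pos_of_pos (hs s x hx) (hp s x hx)).ne'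
  refine ((TimeC1.det hG h0).inv h0).congr (fun _ _ _ => rfl) fun s x hx => ?_
  have := h0 s x hx
  field_simp

theorem TimeC1.inv_norm {ν : X → Vec k} (hνc : ∀ i, ContinuousOn (fun x => ν x i) D)
    (hν : ∀ x ∈ D, ν x ≠ 0) :
    TimeC1 D (fun s x => (ν x ⬝ᵥ ((G s x)⁻¹ *ᵥ ν x))⁻¹) fun s x =>
      bil (σ s x) (unitNormal (G s x) (ν x)) (unitNormal (G s x) (ν x)) *
        (ν x ⬝ᵥ ((G s x)⁻¹ *ᵥ ν x))⁻¹ := by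
  have h0 : ∀ s, ∀ x ∈ D, (G s x).det ≠ 0 := fun s x hx =>
    (det_pos_of_pos (hs s x hx) (hp s x hx)).ne'
  have hP : ∀ s, ∀ x ∈ D, ν x ⬝ᵥ ((G s x)⁻¹ *ᵥ ν x) ≠ 0 := fun s x hx =>
    (inv_form_pos (hs s x hx) (hp s x hx) (hν x hx)).ne'
  refine ((TimeC1.inv_form hG hs h0 hνc hνc).inv hP).congr (fun _ _ _ => rfl) fun s x hx => ?_
  rw [bil_unitNormal_unitNormal (hs s x hx) (hp s x hx) _ _ (hν x hx)]
  have := hP s x hx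
  field_simp

variable {J : X → Matrix (Fin k) (Fin m) ℝ} (hJc : ∀ i j, ContinuousOn (fun x => J x i j) D)
  (hJ : ∀ x ∈ D, ∀ w, J x *ᵥ w = 0 → w = 0)
include hJc hJ

theorem TimeC1.volume :
    TimeC1 D (fun s x => √ ((J x)ᵀ * G s x * J x).det) fun s x =>
      (1 / 2) * tr ((J x)ᵀ * G s x * J x) ((J x)ᵀ * σ s x * J x) *
        √ ((J x)ᵀ * G s x * J x).det :=
  TimeC1.sqrt_det (TimeC1.transpose_mul_mul hG hJc) fun s x hx =>
    det_pos_of_pos (restrict_isSymm (hs s x hx) _) (restrict_pos (hp s x hx) (hJ x hx))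

end Factors

section ElementFactor

variable {X : Type*} [TopologicalSpace X] {D : Set X} {k : ℕ} {G σ : ℝ → X → Mat k}
  (hG : ∀ i j, TimeC1 D (fun s x => G s x i j) fun s x => σ s x i j)
  (hs : ∀ s, ∀ x ∈ D, (G s x).IsSymm)
  (hp : ∀ s, ∀ x ∈ D, ∀ X : Vec k, X ≠ 0 → 0 < bil (G s x) X X)
  {J : X → Matrix (Fin k) (Fin k) ℝ} (hJc : ∀ i j, ContinuousOn (fun x => J x i j) D)
  (hJ : ∀ x ∈ D, ∀ w, J x *ᵥ w = 0 → w = 0)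
include hG hs hp hJc hJ

/-- The volume element of a simplex of full dimension, times the factor in `𝔸`. -/
theorem TimeC1.elementFactor :
    TimeC1 D (fun s x => √ ((J x)ᵀ * G s x * J x).det * (G s x).det⁻¹) fun s x =>
      -((1 / 2) * tr (G s x) (σ s x)) *
        (√ ((J x)ᵀ * G s x * J x).det * (G s x).det⁻¹) := by
  refine ((TimeC1.volume hG hs hp hJc hJ).mul (TimeC1.inv_det hG hs hp)).congr
    (fun _ _ _ => rfl) fun s x hx => ?_
  have hJu : IsUnit (J x).det := by
    rw [isUnit_iff_ne_zero]
    intro h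
    obtain ⟨w, hw, hw'⟩ := Matrix.exists_mulVec_eq_zero_iff.mpr h
    exact hw (hJ x hx w hw')
  rw [tr_transpose_mul_mul _ hJu]
  ring

end ElementFactor

section FacetFactor

variable {X : Type*} [TopologicalSpace X] {D : Set X} {m : ℕ} {G σ : ℝ → X → Mat (m + 1)}
  (hG : ∀ i j, TimeC1 D (fun s x => G s x i j) fun s x => σ s x i j)
  (hs : ∀ s, ∀ x ∈ D, (G s x).IsSymm)
  (hp : ∀ s, ∀ x ∈ D, ∀ X : Vec (m + 1), X ≠ 0 → 0 < bil (G s x) X X)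
  {J : X → Matrix (Fin (m + 1)) (Fin m) ℝ} (hJc : ∀ i j, ContinuousOn (fun x => J x i j) D)
  (hJ : ∀ x ∈ D, ∀ w, J x *ᵥ w = 0 → w = 0)
  {ν : X → Vec (m + 1)} (hνc : ∀ i, ContinuousOn (fun x => ν x i) D) (hν : ∀ x ∈ D, ν x ≠ 0)
  (hνJ : ∀ x ∈ D, ν x ᵥ* J x = 0)
include hG hs hp hJc hJ hνc hν hνJ

/-- The volume element of a facet, times the factor in `A_{F𝔫𝔫F}`. -/
theorem TimeC1.facetFactor :
    TimeC1 D (fun s x => √ ((J x)ᵀ * G s x * J x).det *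
        ((G s x).det * (ν x ⬝ᵥ ((G s x)⁻¹ *ᵥ ν x)))⁻¹) fun s x =>
      -((1 / 2) * tr ((J x)ᵀ * G s x * J x) ((J x)ᵀ * σ s x * J x)) *
        (√ ((J x)ᵀ * G s x * J x).det * ((G s x).det * (ν x ⬝ᵥ ((G s x)⁻¹ *ᵥ ν x)))⁻¹) := by
  refine ((TimeC1.volume hG hs hp hJc hJ).mul ((TimeC1.inv_det hG hs hp).mul
    (TimeC1.inv_norm hG hs hp hνc hν))).congr
    (fun _ _ _ => by rw [mul_inv]) fun s x hx => ?_
  rw [tr_eq_facet (hs s x hx) (hp s x hx) (hJ x hx) (hν x hx) (hνJ x hx), mul_inv]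
  ring

end FacetFactor

section RidgeFactor

variable {X : Type*} [TopologicalSpace X] {D : Set X} {m : ℕ} {G σ : ℝ → X → Mat (m + 2)}
  (hG : ∀ i j, TimeC1 D (fun s x => G s x i j) fun s x => σ s x i j)
  (hs : ∀ s, ∀ x ∈ D, (G s x).IsSymm)
  (hp : ∀ s, ∀ x ∈ D, ∀ X : Vec (m + 2), X ≠ 0 → 0 < bil (G s x) X X)
  (hσ : ∀ s, ∀ x ∈ D, (σ s x).IsSymm)
  {ν μ : X → Vec (m + 2)} (hνc : ∀ i, ContinuousOn (fun x => ν x i) D)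
  (hμc : ∀ i, ContinuousOn (fun x => μ x i) D) (hν : ∀ x ∈ D, ν x ≠ 0)
  (hμ : ∀ x ∈ D, ∀ r : ℝ, μ x ≠ r • ν x)
include hG hs hp hσ hνc hμc hν hμ

/-- The volume element of a subsimplex of codimension 2, times the factor in `A(𝔪, 𝔫, 𝔫, 𝔪)`. -/
theorem TimeC1.ridgeFactor {J : X → Matrix (Fin (m + 2)) (Fin m) ℝ}
    (hJc : ∀ i j, ContinuousOn (fun x => J x i j) D)
    (hJ : ∀ x ∈ D, ∀ w, J x *ᵥ w = 0 → w = 0) (hνJ : ∀ x ∈ D, ν x ᵥ* J x = 0)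
    (hμJ : ∀ x ∈ D, μ x ᵥ* J x = 0) :
    TimeC1 D (fun s x => √ ((J x)ᵀ * G s x * J x).det *
        ((G s x).det * ((ν x ⬝ᵥ ((G s x)⁻¹ *ᵥ ν x)) * (μ x ⬝ᵥ ((G s x)⁻¹ *ᵥ μ x)) -
          (ν x ⬝ᵥ ((G s x)⁻¹ *ᵥ μ x)) ^ 2))⁻¹) fun s x =>
      -((1 / 2) * tr ((J x)ᵀ * G s x * J x) ((J x)ᵀ * σ s x * J x)) *
        (√ ((J x)ᵀ * G s x * J x).det *
        ((G s x).det * ((ν x ⬝ᵥ ((G s x)⁻¹ *ᵥ ν x)) * (μ x ⬝ᵥ ((G s x)⁻¹ *ᵥ μ x)) -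
          (ν x ⬝ᵥ ((G s x)⁻¹ *ᵥ μ x)) ^ 2))⁻¹) := by
  have h0 : ∀ s, ∀ x ∈ D, (G s x).det ≠ 0 := fun s x hx =>
    (det_pos_of_pos (hs s x hx) (hp s x hx)).ne'
  have hD : ∀ s, ∀ x ∈ D, (ν x ⬝ᵥ ((G s x)⁻¹ *ᵥ ν x)) * (μ x ⬝ᵥ ((G s x)⁻¹ *ᵥ μ x)) -
      (ν x ⬝ᵥ ((G s x)⁻¹ *ᵥ μ x)) * (ν x ⬝ᵥ ((G s x)⁻¹ *ᵥ μ x)) ≠ 0 := fun s x hx => by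
    rw [← sq]
    exact (inv_form_gram_pos (hs s x hx) (hp s x hx) (hν x hx) (hμ x hx)).ne'
  have hR := TimeC1.inv_form hG hs h0 hνc hμc
  have hgram := (((TimeC1.inv_form hG hs h0 hνc hνc).mul
    (TimeC1.inv_form hG hs h0 hμc hμc)).sub (hR.mul hR)).inv hD
  refine ((TimeC1.volume hG hs hp hJc hJ).mul ((TimeC1.inv_det hG hs hp).mul hgram)).congr
    (fun _ _ _ => by rw [mul_inv, sq]) fun s x hx => ?_
  have hσ := bil_comm (hσ s x hx) ((G s x)⁻¹ *ᵥ ν x) ((G s x)⁻¹ *ᵥ μ x)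
  have hP := (inv_form_pos (hs s x hx) (hp s x hx) (hν x hx)).ne'
  have hb := bil_tangentialGrad_pos (hs s x hx) (hp s x hx) (hν x hx) (hμ x hx)
  rw [tr_eq_ridge (hs s x hx) (hp s x hx) (hν x hx) (hμ x hx) (hJ x hx) (hνJ x hx) (hμJ x hx),
    bil_unitNormal_unitNormal (hs s x hx) (hp s x hx) _ _ (hν x hx),
    bil_unitConormal_unitConormal (hs s x hx) (hp s x hx) _ (hν x hx) (hμ x hx)]
  have hD' := hD s x hx
  rw [bil_tangentialGrad (hs s x hx) (hp s x hx) (hν x hx)] at hb ⊢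
  rw [tangentialGrad_eq (hs s x hx) (hp s x hx) (hν x hx)]
  simp only [bil_sub_left, bil_sub_right, bil_smul_left, bil_smul_right, ← hσ]
  have hd := h0 s x hx
  set P := ν x ⬝ᵥ ((G s x)⁻¹ *ᵥ ν x)
  set Q := μ x ⬝ᵥ ((G s x)⁻¹ *ᵥ μ x)
  set R := ν x ⬝ᵥ ((G s x)⁻¹ *ᵥ μ x)
  have e : Q - R ^ 2 / P = (P * Q - R * R) / P := by field_simp
  rw [e, mul_inv, sq]
  set d := P * Q - R * R with hdd
  have hPQ : P * Q = d + R * R := by rw [hdd]; ring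
  generalize tr ((J x)ᵀ * G s x * J x) ((J x)ᵀ * σ s x * J x) = τ
  generalize √ ((J x)ᵀ * G s x * J x).det = v
  field_simp
  rw [hdd]
  ring

/-- The time derivative of the dihedral angle. -/
theorem TimeC1.dihedralAngle :
    TimeC1 D (fun s x => Real.arccos (bil (G s x) (unitConormal (G s x) (ν x) (μ x))
        (unitConormal (G s x) (μ x) (ν x)))) fun s x =>
      -((1 / 2) * (bil (σ s x) (unitNormal (G s x) (ν x)) (unitConormal (G s x) (ν x) (μ x)) +
        bil (σ s x) (unitNormal (G s x) (μ x)) (unitConormal (G s x) (μ x) (ν x)))) := by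
  have h0 : ∀ s, ∀ x ∈ D, (G s x).det ≠ 0 := fun s x hx =>
    (det_pos_of_pos (hs s x hx) (hp s x hx)).ne'
  have hμ0 : ∀ x ∈ D, μ x ≠ 0 := fun x hx => by simpa using hμ x hx 0
  have hP : ∀ s, ∀ x ∈ D, 0 < ν x ⬝ᵥ ((G s x)⁻¹ *ᵥ ν x) := fun s x hx =>
    inv_form_pos (hs s x hx) (hp s x hx) (hν x hx)
  have hQ : ∀ s, ∀ x ∈ D, 0 < μ x ⬝ᵥ ((G s x)⁻¹ *ᵥ μ x) := fun s x hx =>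
    inv_form_pos (hs s x hx) (hp s x hx) (hμ0 x hx)
  have hgram := fun s x hx => inv_form_gram_pos (hs s x hx) (hp s x hx) (hν x hx) (hμ x hx)
  have hR := TimeC1.inv_form hG hs h0 hνc hμc
  have hsq := ((TimeC1.inv_form hG hs h0 hνc hνc).mul (TimeC1.inv_form hG hs h0 hμc hμc)).sqrt
    fun s x hx => mul_pos (hP s x hx) (hQ s x hx)
  have hsq0 : ∀ s, ∀ x ∈ D,
      0 < √ ((ν x ⬝ᵥ ((G s x)⁻¹ *ᵥ ν x)) * (μ x ⬝ᵥ ((G s x)⁻¹ *ᵥ μ x))) := fun s x hx =>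
    Real.sqrt_pos.mpr (mul_pos (hP s x hx) (hQ s x hx))
  have hcos := hR.neg.mul (hsq.inv fun s x hx => (hsq0 s x hx).ne')
  have hc1 : ∀ s, ∀ x ∈ D, (-(ν x ⬝ᵥ ((G s x)⁻¹ *ᵥ μ x)) *
      (√ ((ν x ⬝ᵥ ((G s x)⁻¹ *ᵥ ν x)) * (μ x ⬝ᵥ ((G s x)⁻¹ *ᵥ μ x))))⁻¹) ^ 2 < 1 := by
    intro s x hx
    have := hgram s x hx
    rw [mul_pow, inv_pow, Real.sq_sqrt (mul_pos (hP s x hx) (hQ s x hx)).le, neg_sq,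
      ← div_eq_mul_inv, div_lt_one (mul_pos (hP s x hx) (hQ s x hx))]
    linarith
  refine (hcos.arccos hc1).congr (fun s x hx => ?_) fun s x hx => ?_
  · rw [bil_unitConormal_unitConormal_swap (hs s x hx) (hp s x hx) (hν x hx) (hμ x hx)]
  rw [bil_unitNormal_unitConormal (hs s x hx) (hp s x hx) (hν x hx),
    bil_unitNormal_unitConormal (hs s x hx) (hp s x hx) (hμ0 x hx), inv_form_comm (hs s x hx) (μ x) (ν x),
    bil_comm (hσ s x hx) ((G s x)⁻¹ *ᵥ μ x) ((G s x)⁻¹ *ᵥ ν x)]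
  have hg := hgram s x hx
  have hP1 := hP s x hx
  have hQ1 := hQ s x hx
  have hS := hsq0 s x hx
  set P := ν x ⬝ᵥ ((G s x)⁻¹ *ᵥ ν x)
  set Q := μ x ⬝ᵥ ((G s x)⁻¹ *ᵥ μ x)
  set R := ν x ⬝ᵥ ((G s x)⁻¹ *ᵥ μ x)
  have hS2 : √ (P * Q) ^ 2 = P * Q := Real.sq_sqrt (mul_pos hP1 hQ1).le
  rw [mul_comm Q P]
  set S := √ (P * Q)
  have hE : √ (1 - (-R * S⁻¹) ^ 2) = √ (P * Q - R ^ 2) / S := by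
    rw [Real.sqrt_eq_iff_mul_self_eq (by
      have := (hc1 s x hx).le
      linarith) (by positivity), div_mul_div_comm, Real.mul_self_sqrt hg.le, ← sq S, hS2, mul_pow,
      inv_pow, hS2]
    field_simp
  rw [hE]
  have hE0 := Real.sqrt_pos.mpr hg
  set E := √ (P * Q - R ^ 2)
  field_simp
  rw [hS2]
  field_simp
  ring

end RidgeFactor

/-! ### Partial derivatives within a domain -/

section PartialDerivatives

variable {m : ℕ} {D : Set (Vec m)} {f h : Vec m → ℝ} {x : Vec m}

theorem pd_congr (e : Set.EqOn f h D) (hx : x ∈ D) (k : Fin m) : pd D k f x = pd D k h x := by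
  rw [pd, pd, fderivWithin_congr e (e hx)]

theorem pd_smooth (hD : UniqueDiffOn ℝ D) (hf : ContDiffOn ℝ ∞ f D) (k : Fin m) :
    ContDiffOn ℝ ∞ (pd D k f) D :=
  (hf.fderivWithin hD (by simp)).clm_apply contDiffOn_const

theorem differentiableOn_of_smooth (hf : ContDiffOn ℝ ∞ f D) : DifferentiableOn ℝ f D :=
  hf.differentiableOn (by simp)

theorem pd_const (k : Fin m) (c : ℝ) :
    pd D k (fun _ => c) x = 0 := by
  rw [pd, fderivWithin_fun_const]
  rfl

theorem pd_add (hD : UniqueDiffOn ℝ D) (hf : ContDiffOn ℝ ∞ f D) (hh : ContDiffOn ℝ ∞ h D)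
    (hx : x ∈ D) (k : Fin m) :
    pd D k (fun z => f z + h z) x = pd D k f x + pd D k h x := by
  rw [pd, fderivWithin_fun_add (hD x hx) (differentiableOn_of_smooth hf x hx)
    (differentiableOn_of_smooth hh x hx)]
  rfl

theorem pd_sub (hD : UniqueDiffOn ℝ D) (hf : ContDiffOn ℝ ∞ f D) (hh : ContDiffOn ℝ ∞ h D)
    (hx : x ∈ D) (k : Fin m) :
    pd D k (fun z => f z - h z) x = pd D k f x - pd D k h x := by
  rw [pd, fderivWithin_fun_sub (hD x hx) (differentiableOn_of_smooth hf x hx)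
    (differentiableOn_of_smooth hh x hx)]
  rfl

theorem pd_mul (hD : UniqueDiffOn ℝ D) (hf : ContDiffOn ℝ ∞ f D) (hh : ContDiffOn ℝ ∞ h D)
    (hx : x ∈ D) (k : Fin m) :
    pd D k (fun z => f z * h z) x = pd D k f x * h x + f x * pd D k h x := by
  rw [pd, fderivWithin_fun_mul (hD x hx) (differentiableOn_of_smooth hf x hx)
    (differentiableOn_of_smooth hh x hx)]
  simp only [_root_.add_apply, _root_.smul_apply, smul_eq_mul, pd]
  ring

theorem pd_sum (hD : UniqueDiffOn ℝ D) {ι : Type*} (S : Finset ι) {f : ι → Vec m → ℝ}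
    (hf : ∀ i ∈ S, ContDiffOn ℝ ∞ (f i) D) (hx : x ∈ D) (k : Fin m) :
    pd D k (fun z => ∑ i ∈ S, f i z) x = ∑ i ∈ S, pd D k (f i) x := by
  rw [pd, fderivWithin_fun_sum (hD x hx) fun i hi => differentiableOn_of_smooth (hf i hi) x hx]
  simp only [_root_.sum_apply, pd]

theorem pd_const_mul (hD : UniqueDiffOn ℝ D) (hf : ContDiffOn ℝ ∞ f D) (hx : x ∈ D) (k : Fin m)
    (c : ℝ) : pd D k (fun z => c * f z) x = c * pd D k f x := by
  rw [pd_mul hD contDiffOn_const hf hx, pd_const]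
  ring

/-- Partial derivatives commute up to the boundary of a domain with dense interior. -/
theorem pd_comm (hD : UniqueDiffOn ℝ D) (hf : ContDiffOn ℝ ∞ f D) (hx : x ∈ D)
    (hi : x ∈ closure (interior D)) (k l : Fin m) :
    pd D k (pd D l f) x = pd D l (pd D k f) x := by
  have hd : DifferentiableWithinAt ℝ (fderivWithin ℝ f D) D x :=
    (hf.fderivWithin (m := ∞) hD (by simp)).differentiableOn (by simp) x hx
  have h : ∀ k l, pd D k (pd D l f) x =
      fderivWithin ℝ (fderivWithin ℝ f D) D x (frame k) (frame l) := by
    intro k l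
    change fderivWithin ℝ (fun z => fderivWithin ℝ f D z (frame l)) D x (frame k) = _
    rw [fderivWithin_clm_apply (hD x hx) hd (differentiableWithinAt_const _)]
    simp
  rw [h, h]
  exact (hf x hx).isSymmSndFDerivWithinAt
    (by simpa using WithTop.coe_le_coe.mpr (le_top (a := (2 : ℕ∞)))) hD hi hx (frame k) (frame l)

theorem smooth_det {k : ℕ} {A : Vec m → Mat k} (hA : ∀ i j, ContDiffOn ℝ ∞ (fun z => A z i j) D) :
    ContDiffOn ℝ ∞ (fun z => (A z).det) D := by
  simp only [Matrix.det_apply']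
  exact ContDiffOn.sum fun π _ => contDiffOn_const.mul (contDiffOn_prod fun i _ => hA _ _)

theorem smooth_inv {k : ℕ} {A : Vec m → Mat k} (hA : ∀ i j, ContDiffOn ℝ ∞ (fun z => A z i j) D)
    (h0 : ∀ z ∈ D, (A z).det ≠ 0) (i j : Fin k) : ContDiffOn ℝ ∞ (fun z => (A z)⁻¹ i j) D := by
  simp only [Matrix.inv_def, Ring.inverse_eq_inv', Matrix.smul_apply, smul_eq_mul,
    Matrix.adjugate_apply]
  refine ((smooth_det hA).inv h0).mul (smooth_det fun a b => ?_)
  by_cases h : a = j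
  · subst h
    simp only [Matrix.updateRow_self]
    exact contDiffOn_const
  · simp only [Matrix.updateRow_ne h]
    exact hA a b

end PartialDerivatives

/-! ### Christoffel symbols and curvature -/

/-- A smooth Riemannian metric on `D`. -/
structure SmoothMetric {m : ℕ} (D : Set (Vec m)) (G : Vec m → Mat m) : Prop where
  uniq : UniqueDiffOn ℝ D
  smooth : ∀ i j, ContDiffOn ℝ ∞ (fun z => G z i j) D
  symm : ∀ z ∈ D, (G z).IsSymm
  pos : ∀ z ∈ D, ∀ X : Vec m, X ≠ 0 → 0 < bil (G z) X X

/-- The Christoffel symbols of the first kind, `g(∇_{∂ᵢ} ∂ⱼ, ∂ₗ)`. For an arbitrary symmetric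
2-tensor field the same combination of derivatives is also used. -/
def lowChristoffel {m : ℕ} (D : Set (Vec m)) (G : Vec m → Mat m) (x : Vec m) (l i j : Fin m) : ℝ :=
  (1 / 2) * (pd D i (fun z => G z j l) x + pd D j (fun z => G z i l) x
    - pd D l (fun z => G z i j) x)

theorem christoffel_eq {m : ℕ} (D : Set (Vec m)) (G : Vec m → Mat m) (x : Vec m) (l i j : Fin m) :
    christoffel D G x l i j = ∑ k, (G x)⁻¹ l k * lowChristoffel D G x k i j := by
  simp only [christoffel, lowChristoffel, Finset.mul_sum]
  exact Finset.sum_congr rfl fun k _ => by ring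

theorem lowChristoffel_smooth {m : ℕ} {D : Set (Vec m)} {G : Vec m → Mat m}
    (hD : UniqueDiffOn ℝ D) (hG : ∀ i j, ContDiffOn ℝ ∞ (fun z => G z i j) D) (l i j : Fin m) :
    ContDiffOn ℝ ∞ (fun z => lowChristoffel D G z l i j) D :=
  contDiffOn_const.mul (((pd_smooth hD (hG _ _) _).add (pd_smooth hD (hG _ _) _)).sub
    (pd_smooth hD (hG _ _) _))

theorem lowChristoffel_symm {m : ℕ} {D : Set (Vec m)} {G : Vec m → Mat m}
    (hG : ∀ z ∈ D, (G z).IsSymm) {x : Vec m} (hx : x ∈ D) (l i j : Fin m) :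
    lowChristoffel D G x l i j = lowChristoffel D G x l j i := by
  have : pd D l (fun z => G z i j) x = pd D l (fun z => G z j i) x :=
    pd_congr (fun z hz => (hG z hz).apply j i) hx l
  rw [lowChristoffel, lowChristoffel, this]
  ring

/-- The metric property of the Levi-Civita connection. -/
theorem pd_eq_lowChristoffel {m : ℕ} {D : Set (Vec m)} {G : Vec m → Mat m}
    (hG : ∀ z ∈ D, (G z).IsSymm) {x : Vec m} (hx : x ∈ D) (i j k : Fin m) :
    pd D i (fun z => G z j k) x = lowChristoffel D G x j i k + lowChristoffel D G x k i j := by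
  have h : pd D i (fun z => G z k j) x = pd D i (fun z => G z j k) x :=
    pd_congr (fun z hz => (hG z hz).apply j k) hx i
  rw [lowChristoffel, lowChristoffel]
  linarith

namespace SmoothMetric

variable {m : ℕ} {D : Set (Vec m)} {G : Vec m → Mat m} (hG : SmoothMetric D G) {x : Vec m}
include hG

theorem det_ne_zero (hx : x ∈ D) : (G x).det ≠ 0 :=
  (det_pos_of_pos (hG.symm x hx) (hG.pos x hx)).ne'

theorem smooth_inv (i j : Fin m) : ContDiffOn ℝ ∞ (fun z => (G z)⁻¹ i j) D :=
  Regge.smooth_inv hG.smooth (fun _ hz => hG.det_ne_zero hz) i j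

theorem christoffel_smooth (l i j : Fin m) :
    ContDiffOn ℝ ∞ (fun z => christoffel D G z l i j) D := by
  simp only [christoffel_eq]
  exact ContDiffOn.sum fun k _ => (hG.smooth_inv l k).mul
    (lowChristoffel_smooth hG.uniq hG.smooth k i j)

theorem christoffel_symm (hx : x ∈ D) (l i j : Fin m) :
    christoffel D G x l i j = christoffel D G x l j i := by
  simp only [christoffel_eq, lowChristoffel_symm hG.symm hx _ i j]

theorem sum_mul_christoffel (hx : x ∈ D) (l i j : Fin m) :
    ∑ k, G x l k * christoffel D G x k i j = lowChristoffel D G x l i j := by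
  have h : (G x *ᵥ ((G x)⁻¹ *ᵥ fun k => lowChristoffel D G x k i j)) l =
      lowChristoffel D G x l i j := by
    rw [mulVec_inv_mulVec (hG.pos x hx)]
  rw [← h]
  simp only [Matrix.mulVec, dotProduct, christoffel_eq]

theorem pd_lowChristoffel (hx : x ∈ D) (a l i j : Fin m) :
    pd D a (fun z => lowChristoffel D G z l i j) x =
      ∑ k, (pd D a (fun z => G z l k) x * christoffel D G x k i j +
        G x l k * pd D a (fun z => christoffel D G z k i j) x) := by
  rw [pd_congr (fun z hz => (hG.sum_mul_christoffel hz l i j).symm) hx,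
    pd_sum hG.uniq _ (fun k _ => (hG.smooth l k).mul (hG.christoffel_smooth k i j)) hx]
  exact Finset.sum_congr rfl fun k _ => pd_mul hG.uniq (hG.smooth l k)
    (hG.christoffel_smooth k i j) hx a

/-- The curvature tensor in terms of the Christoffel symbols of the first kind. -/
theorem riemann_eq (hx : x ∈ D) (i j k l : Fin m) :
    riemann D G x ![i, j, k, l] =
      pd D i (fun z => lowChristoffel D G z l j k) x
        - pd D j (fun z => lowChristoffel D G z l i k) x
        - ∑ p, lowChristoffel D G x p i l * christoffel D G x p j k
        + ∑ p, lowChristoffel D G x p j l * christoffel D G x p i k := by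
  have h1 : ∀ i j, ∑ p, G x l p * ∑ q, christoffel D G x p i q * christoffel D G x q j k =
      ∑ p, lowChristoffel D G x l i p * christoffel D G x p j k := by
    intro i j
    simp only [← hG.sum_mul_christoffel hx l, Finset.sum_mul, Finset.mul_sum]
    rw [Finset.sum_comm]
    exact Finset.sum_congr rfl fun p _ => Finset.sum_congr rfl fun q _ => by ring
  have h2 : ∀ i j, pd D i (fun z => lowChristoffel D G z l j k) x =
      ∑ p, lowChristoffel D G x l i p * christoffel D G x p j k +
      ∑ p, lowChristoffel D G x p i l * christoffel D G x p j k +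
      ∑ p, G x l p * pd D i (fun z => christoffel D G z p j k) x := by
    intro i j
    rw [hG.pd_lowChristoffel hx]
    simp only [← Finset.sum_add_distrib]
    refine Finset.sum_congr rfl fun p _ => ?_
    rw [pd_eq_lowChristoffel hG.symm hx]
    ring
  have h3 : riemann D G x ![i, j, k, l] =
      ∑ p, G x l p * pd D i (fun z => christoffel D G z p j k) x
      - ∑ p, G x l p * pd D j (fun z => christoffel D G z p i k) x
      + (∑ p, G x l p * ∑ q, christoffel D G x p i q * christoffel D G x q j k
      - ∑ p, G x l p * ∑ q, christoffel D G x p j q * christoffel D G x q i k) := by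
    simp only [riemann, Matrix.cons_val, ← Finset.sum_sub_distrib, ← Finset.sum_add_distrib]
    refine Finset.sum_congr rfl fun p _ => ?_
    rw [Finset.sum_sub_distrib]
    ring
  rw [h3, h1, h1, h2, h2]
  ring

/-- The pair symmetry of the curvature tensor, in the form that reverses the four arguments. -/
theorem riemann_reverse (hx : x ∈ D) (hi : x ∈ closure (interior D)) (i j k l : Fin m) :
    riemann D G x ![i, j, k, l] = riemann D G x ![l, k, j, i] := by
  have hl : ∀ a l i j, pd D a (fun z => lowChristoffel D G z l i j) x =
      (1 / 2) * (pd D a (pd D i fun z => G z j l) x + pd D a (pd D j fun z => G z i l) x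
        - pd D a (pd D l fun z => G z i j) x) := by
    intro a l i j
    simp only [lowChristoffel]
    have h1 := fun i j l => pd_smooth hG.uniq (hG.smooth j l) i
    rw [pd_const_mul hG.uniq (((h1 _ _ _).add (h1 _ _ _)).sub (h1 _ _ _)) hx,
      pd_sub hG.uniq ((h1 _ _ _).add (h1 _ _ _)) (h1 _ _ _) hx,
      pd_add hG.uniq (h1 _ _ _) (h1 _ _ _) hx]
  have hc : ∀ a b i j, pd D a (pd D b fun z => G z i j) x = pd D b (pd D a fun z => G z i j) x :=
    fun a b i j => pd_comm hG.uniq (hG.smooth i j) hx hi a b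
  have hs : ∀ a b i j, pd D a (pd D b fun z => G z i j) x = pd D a (pd D b fun z => G z j i) x :=
    fun a b i j => pd_congr (fun z hz => pd_congr (fun w hw => (hG.symm w hw).apply j i) hz b) hx a
  have hw : ∀ i l j k, ∑ p, lowChristoffel D G x p i l * christoffel D G x p j k =
      ∑ p, lowChristoffel D G x p j k * christoffel D G x p i l := by
    intro i l j k
    simp only [christoffel_eq, Finset.mul_sum]
    rw [Finset.sum_comm]
    refine Finset.sum_congr rfl fun p _ => Finset.sum_congr rfl fun q _ => ?_
    rw [(inv_isSymm (hG.symm x hx)).apply]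
    ring
  have h4 : ∑ p, lowChristoffel D G x p i l * christoffel D G x p j k =
      ∑ p, lowChristoffel D G x p l i * christoffel D G x p k j := by
    simp only [lowChristoffel_symm hG.symm hx _ i l, hG.christoffel_symm hx _ j k]
  have h5 : ∑ p, lowChristoffel D G x p j l * christoffel D G x p i k =
      ∑ p, lowChristoffel D G x p k i * christoffel D G x p l j := by
    rw [hw]
    simp only [lowChristoffel_symm hG.symm hx _ i k, hG.christoffel_symm hx _ j l]
  rw [hG.riemann_eq hx, hG.riemann_eq hx, hl, hl, hl, hl, h4, h5]
  linear_combination (1 / 2) * (hc i j k l + hc i k j l + hs k i j l - hc l k j i - hc i l j k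
    - hs l i j k - hc j k i l - hs k j i l + hc j l i k + hs l j i k)

end SmoothMetric

/-! ### The variation of the curvature -/

/-- The contraction of a 4-index array with `c`. -/
def contract4 {m : ℕ} (c F : Fin m → Fin m → Fin m → Fin m → ℝ) : ℝ :=
  ∑ i, ∑ j, ∑ k, ∑ l, c i j k l * F i j k l

section contract4

variable {m : ℕ} {c : Fin m → Fin m → Fin m → Fin m → ℝ}

theorem contract4_add (F F' : Fin m → Fin m → Fin m → Fin m → ℝ) :
    contract4 c (fun i j k l => F i j k l + F' i j k l) = contract4 c F + contract4 c F' := by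
  simp only [contract4, mul_add, Finset.sum_add_distrib]

theorem contract4_sub (F F' : Fin m → Fin m → Fin m → Fin m → ℝ) :
    contract4 c (fun i j k l => F i j k l - F' i j k l) = contract4 c F - contract4 c F' := by
  simp only [contract4, mul_sub, Finset.sum_sub_distrib]

theorem contract4_mul (r : ℝ) (F : Fin m → Fin m → Fin m → Fin m → ℝ) :
    contract4 c (fun i j k l => r * F i j k l) = r * contract4 c F := by
  simp only [contract4, Finset.mul_sum, mul_left_comm]

theorem contract4_swap_left (hc : ∀ i j k l, c i j k l = -c j i k l)
    (F : Fin m → Fin m → Fin m → Fin m → ℝ) :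
    contract4 c (fun i j k l => F j i k l) = -contract4 c F := by
  rw [contract4, Finset.sum_comm]
  simp only [contract4, ← Finset.sum_neg_distrib]
  refine Finset.sum_congr rfl fun i _ => Finset.sum_congr rfl fun j _ =>
    Finset.sum_congr rfl fun k _ => Finset.sum_congr rfl fun l _ => ?_
  rw [hc]
  ring

theorem contract4_swap_right (hc : ∀ i j k l, c i j k l = -c i j l k)
    (F : Fin m → Fin m → Fin m → Fin m → ℝ) :
    contract4 c (fun i j k l => F i j l k) = -contract4 c F := by
  simp only [contract4, ← Finset.sum_neg_distrib]
  refine Finset.sum_congr rfl fun i _ => Finset.sum_congr rfl fun j _ => ?_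
  rw [Finset.sum_comm]
  refine Finset.sum_congr rfl fun k _ => Finset.sum_congr rfl fun l _ => ?_
  rw [hc]
  ring

theorem contract4_reverse (hc : ∀ i j k l, c i j k l = c l k j i)
    (F : Fin m → Fin m → Fin m → Fin m → ℝ) :
    contract4 c (fun i j k l => F l k j i) = contract4 c F := by
  have h := Equiv.sum_comp (Equiv.arrowCongr (Fin.revPerm (n := 4)) (Equiv.refl (Fin m)))
    fun I : Fin 4 → Fin m => c (I 0) (I 1) (I 2) (I 3) * F (I 0) (I 1) (I 2) (I 3)
  rw [sum_fin_four, sum_fin_four] at h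
  rw [contract4, contract4]
  refine Eq.trans ?_ h
  refine Finset.sum_congr rfl fun i _ => Finset.sum_congr rfl fun j _ =>
    Finset.sum_congr rfl fun k _ => Finset.sum_congr rfl fun l _ => ?_
  rw [hc]
  rfl

end contract4

theorem covDeriv_ofMat {m : ℕ} (D : Set (Vec m)) (G σ : Vec m → Mat m) (x : Vec m)
    (k j l : Fin m) :
    covDeriv D G (fun z => ofMat (σ z)) x ![k, j, l] =
      pd D k (fun z => σ z j l) x - ∑ q, christoffel D G x q k j * σ x q l
        - ∑ q, christoffel D G x q k l * σ x j q := by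
  simp [covDeriv, ofMat, Fin.sum_univ_two, Fin.tail, Function.update, sub_sub]

theorem hess_eq {m : ℕ} {D : Set (Vec m)} {G σ : Vec m → Mat m} (hG : SmoothMetric D G)
    (hσ : ∀ i j, ContDiffOn ℝ ∞ (fun z => σ z i j) D) {x : Vec m} (hx : x ∈ D) (i k j l : Fin m) :
    hess D G σ x ![i, k, j, l] =
      pd D i (pd D k fun z => σ z j l) x
      - ∑ q, (pd D i (fun z => christoffel D G z q k j) x * σ x q l +
          christoffel D G x q k j * pd D i (fun z => σ z q l) x)
      - ∑ q, (pd D i (fun z => christoffel D G z q k l) x * σ x j q +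
          christoffel D G x q k l * pd D i (fun z => σ z j q) x)
      - ∑ q, christoffel D G x q i k * covDeriv D G (fun z => ofMat (σ z)) x ![q, j, l]
      - ∑ q, christoffel D G x q i j * covDeriv D G (fun z => ofMat (σ z)) x ![k, q, l]
      - ∑ q, christoffel D G x q i l * covDeriv D G (fun z => ofMat (σ z)) x ![k, j, q] := by
  have h1 : ∀ k j l, ContDiffOn ℝ ∞ (fun z => ∑ q, christoffel D G z q k j * σ z q l) D :=
    fun k j l => ContDiffOn.sum fun q _ => (hG.christoffel_smooth q k j).mul (hσ q l)
  have h2 : ∀ k j l, ContDiffOn ℝ ∞ (fun z => ∑ q, christoffel D G z q k l * σ z j q) D :=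
    fun k j l => ContDiffOn.sum fun q _ => (hG.christoffel_smooth q k l).mul (hσ j q)
  have h3 : pd D i (fun z => covDeriv D G (fun z => ofMat (σ z)) z ![k, j, l]) x =
      pd D i (pd D k fun z => σ z j l) x
      - ∑ q, (pd D i (fun z => christoffel D G z q k j) x * σ x q l +
          christoffel D G x q k j * pd D i (fun z => σ z q l) x)
      - ∑ q, (pd D i (fun z => christoffel D G z q k l) x * σ x j q +
          christoffel D G x q k l * pd D i (fun z => σ z j q) x) := by
    simp only [covDeriv_ofMat]
    have h0 := pd_smooth hG.uniq (hσ j l) k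
    rw [pd_sub hG.uniq (h0.sub (h1 k j l)) (h2 k j l) hx, pd_sub hG.uniq h0 (h1 k j l) hx,
      pd_sum hG.uniq _ (fun q _ => (hG.christoffel_smooth q k j).mul (hσ q l)) hx,
      pd_sum hG.uniq _ (fun q _ => (hG.christoffel_smooth q k l).mul (hσ j q)) hx,
      Finset.sum_congr rfl fun q _ => pd_mul hG.uniq (hG.christoffel_smooth q k j) (hσ q l) hx i,
      Finset.sum_congr rfl fun q _ => pd_mul hG.uniq (hG.christoffel_smooth q k l) (hσ j q) hx i]
  have h4 : hess D G σ x ![i, k, j, l] =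
      pd D i (fun z => covDeriv D G (fun z => ofMat (σ z)) z ![k, j, l]) x
      - (∑ q, christoffel D G x q i k * covDeriv D G (fun z => ofMat (σ z)) x ![q, j, l]
      + ∑ q, christoffel D G x q i j * covDeriv D G (fun z => ofMat (σ z)) x ![k, q, l]
      + ∑ q, christoffel D G x q i l * covDeriv D G (fun z => ofMat (σ z)) x ![k, j, q]) := by
    have e0 : ∀ q, Function.update ![k, j, l] 0 q = ![q, j, l] := fun q => by
      funext a; fin_cases a <;> rfl
    have e1 : ∀ q, Function.update ![k, j, l] 1 q = ![k, q, l] := fun q => by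
      funext a; fin_cases a <;> rfl
    have e2 : ∀ q, Function.update ![k, j, l] 2 q = ![k, j, q] := fun q => by
      funext a; fin_cases a <;> rfl
    have e : Fin.tail ![i, k, j, l] = ![k, j, l] := rfl
    rw [hess, covDeriv, e, Fin.sum_univ_three]
    simp only [e0, e1, e2]
    rfl
  rw [h4, h3]
  ring

/-- The contraction of the curvature tensor with a tensor that is alternating in the first and in
the last two arguments involves only one of the second derivatives of the metric. -/
theorem contract4_riemann {m : ℕ} {D : Set (Vec m)} {G : Vec m → Mat m} (hG : SmoothMetric D G)
    {x : Vec m} (hx : x ∈ D) {c : Fin m → Fin m → Fin m → Fin m → ℝ}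
    (hl : ∀ i j k l, c i j k l = -c j i k l) (hr : ∀ i j k l, c i j k l = -c i j l k) :
    contract4 c (fun i j k l => riemann D G x ![i, j, k, l]) =
      2 * contract4 c fun i j k l => pd D i (pd D k fun z => G z j l) x +
        ∑ p, lowChristoffel D G x p j l * christoffel D G x p i k := by
  have h1 : ∀ i j k l, pd D i (fun z => lowChristoffel D G z l j k) x =
      (1 / 2) * (pd D i (pd D j fun z => G z k l) x + pd D i (pd D k fun z => G z j l) x
        - pd D i (pd D l fun z => G z j k) x) := by
    intro i j k l
    simp only [lowChristoffel]
    have h1 := fun i j l => pd_smooth hG.uniq (hG.smooth j l) i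
    rw [pd_const_mul hG.uniq (((h1 _ _ _).add (h1 _ _ _)).sub (h1 _ _ _)) hx,
      pd_sub hG.uniq ((h1 _ _ _).add (h1 _ _ _)) (h1 _ _ _) hx,
      pd_add hG.uniq (h1 _ _ _) (h1 _ _ _) hx]
  have h2 : contract4 c (fun i j k l => pd D i (fun z => lowChristoffel D G z l j k) x) =
      contract4 c fun i j k l => pd D i (pd D k fun z => G z j l) x := by
    simp only [h1]
    rw [contract4_mul, contract4_sub, contract4_add]
    have e1 := contract4_swap_right hr fun i j k l => pd D i (pd D k fun z => G z j l) x
    have e2 := contract4_swap_right hr fun i j k l => pd D i (pd D j fun z => G z k l) x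
    have e3 : ∀ i j k l, pd D i (pd D j fun z => G z l k) x = pd D i (pd D j fun z => G z k l) x :=
      fun i j k l => pd_congr (fun z hz => pd_congr (fun w hw => (hG.symm w hw).apply k l) hz j) hx i
    simp only [e3] at e2
    rw [e1]
    linarith
  have h3 := contract4_swap_left hl fun i j k l =>
    pd D i (fun z => lowChristoffel D G z l j k) x
  have h4 := contract4_swap_left hl fun i j k l =>
    ∑ p, lowChristoffel D G x p i l * christoffel D G x p j k
  simp only [hG.riemann_eq hx]
  rw [contract4_add, contract4_sub, contract4_sub, contract4_add, h3, ← h2]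
  linarith

/-- The algebraic core of the variation of the curvature. -/
theorem contract4_hess {m : ℕ} {D : Set (Vec m)} {G σ : Vec m → Mat m} (hG : SmoothMetric D G)
    (hσ : ∀ i j, ContDiffOn ℝ ∞ (fun z => σ z i j) D) (hσs : ∀ z ∈ D, (σ z).IsSymm)
    {x : Vec m} (hx : x ∈ D) {c : Fin m → Fin m → Fin m → Fin m → ℝ}
    (hl : ∀ i j k l, c i j k l = -c j i k l) (hr : ∀ i j k l, c i j k l = -c i j l k) :
    2 * contract4 c (fun i j k l => hess D G σ x ![i, k, j, l]) +
      contract4 c (fun i j k l => ∑ q, Lend (G x) (σ x) q l * riemann D G x ![i, j, k, q]) =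
    2 * (contract4 c (fun i j k l => pd D i (pd D k fun z => σ z j l) x)
      + 2 * contract4 c (fun i j k l =>
          ∑ q, lowChristoffel D σ x q j l * christoffel D G x q i k)
      - contract4 c fun i j k l =>
          ∑ q, ∑ p, christoffel D G x q i k * (christoffel D G x p l j * σ x p q)) := by
  set Γ := christoffel D G x with hΓ
  have hΓs : ∀ q i j, Γ q i j = Γ q j i := fun q i j => hG.christoffel_symm hx q i j
  have hs : ∀ i j, σ x i j = σ x j i := fun i j => (hσs x hx).apply j i
  have hds : ∀ k i j, pd D k (fun z => σ z i j) x = pd D k (fun z => σ z j i) x := fun k i j =>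
    pd_congr (fun z hz => (hσs z hz).apply j i) hx k
  set a1 : Fin m → Fin m → Fin m → Fin m → ℝ := fun i j k l =>
    ∑ q, pd D i (fun z => christoffel D G z q k j) x * σ x q l with ha1
  set e2 : Fin m → Fin m → Fin m → Fin m → ℝ := fun i j k l =>
    ∑ q, Γ q i k * pd D j (fun z => σ z q l) x with he2
  set e3 : Fin m → Fin m → Fin m → Fin m → ℝ := fun i j k l =>
    ∑ q, Γ q i k * pd D l (fun z => σ z j q) x with he3
  set b1 : Fin m → Fin m → Fin m → Fin m → ℝ := fun i j k l =>
    ∑ q, Γ q i k * pd D q (fun z => σ z j l) x with hb1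
  set b2 : Fin m → Fin m → Fin m → Fin m → ℝ := fun i j k l =>
    ∑ q, ∑ p, Γ q i k * (Γ p q j * σ x p l) with hb2
  set b3 : Fin m → Fin m → Fin m → Fin m → ℝ := fun i j k l =>
    ∑ q, ∑ p, Γ q i k * (Γ p q l * σ x j p) with hb3
  set w : Fin m → Fin m → Fin m → Fin m → ℝ := fun i j k l =>
    ∑ q, ∑ p, Γ q i k * (Γ p l j * σ x p q) with hw
  set a3 : Fin m → Fin m → Fin m → Fin m → ℝ := fun i j k l =>
    ∑ q, (pd D i (fun z => christoffel D G z q k l) x * σ x j q +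
      Γ q k l * pd D i (fun z => σ z j q) x) with ha3
  set a5 : Fin m → Fin m → Fin m → Fin m → ℝ := fun i j k l =>
    ∑ q, Γ q i j * covDeriv D G (fun z => ofMat (σ z)) x ![k, q, l] with ha5
  have hdΓ : ∀ i q k l, pd D i (fun z => christoffel D G z q k l) x =
      pd D i (fun z => christoffel D G z q l k) x := fun i q k l =>
    pd_congr (fun z hz => hG.christoffel_symm hz q k l) hx i
  have h2 : ∀ i j k l, ∑ q, (pd D i (fun z => christoffel D G z q k j) x * σ x q l +
      Γ q k j * pd D i (fun z => σ z q l) x) = a1 i j k l + e2 j i k l := fun i j k l => by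
    simp only [ha1, he2, Finset.sum_add_distrib, hΓs _ k j]
  have h4 : ∀ i j k l, ∑ q, Γ q i k * covDeriv D G (fun z => ofMat (σ z)) x ![q, j, l] =
      b1 i j k l - b2 i j k l - b3 i j k l := fun i j k l => by
    simp only [hb1, hb2, hb3, covDeriv_ofMat, mul_sub, Finset.sum_sub_distrib, Finset.mul_sum, hΓ]
  have h6 : ∀ i j k l, ∑ q, Γ q i l * covDeriv D G (fun z => ofMat (σ z)) x ![k, j, q] =
      e3 i j l k - w i j l k - b3 i j l k := fun i j k l => by
    simp only [he3, hw, hb3, covDeriv_ofMat, mul_sub, Finset.sum_sub_distrib, Finset.mul_sum]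
    congr 1
    refine Finset.sum_congr rfl fun q _ => Finset.sum_congr rfl fun p _ => ?_
    rw [hΓs p q k]
  have hH : ∀ i j k l, hess D G σ x ![i, k, j, l] =
      pd D i (pd D k fun z => σ z j l) x - a1 i j k l - e2 j i k l - a3 i j k l
      - b1 i j k l + b2 i j k l + b3 i j k l - a5 i j k l - e3 i j l k + w i j l k + b3 i j l k := by
    intro i j k l
    rw [hess_eq hG hσ hx, h2, h4, h6]
    ring
  have hRL : ∀ i j k l, ∑ q, Lend (G x) (σ x) q l * riemann D G x ![i, j, k, q] =
      a1 i j k l - a1 j i k l + b2 j i k l - b2 i j k l := by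
    intro i j k l
    have hL : ∀ r, ∑ q, Lend (G x) (σ x) q l * G x q r = σ x r l := fun r => by
      have : (G x * Lend (G x) (σ x)) r l = σ x r l := by
        rw [Lend, Matrix.mul_nonsing_inv_cancel_left _ _ (isUnit_det_of_pos (hG.pos x hx))]
      rw [← this, Matrix.mul_apply]
      exact Finset.sum_congr rfl fun q _ => by rw [(hG.symm x hx).apply, mul_comm]
    have e1 : ∀ i j, b2 j i k l = ∑ q, ∑ p, σ x q l * (Γ q i p * Γ p j k) := fun i j => by
      simp only [hb2]
      rw [Finset.sum_comm]
      refine Finset.sum_congr rfl fun q _ => Finset.sum_congr rfl fun p _ => ?_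
      rw [hΓs q p i]
      ring
    calc _ = ∑ r, (∑ q, Lend (G x) (σ x) q l * G x q r) *
          (pd D i (fun z => christoffel D G z r j k) x - pd D j (fun z => christoffel D G z r i k) x
            + ∑ q, (Γ r i q * Γ q j k - Γ r j q * Γ q i k)) := by
          simp only [riemann, Finset.mul_sum, Finset.sum_mul]
          rw [Finset.sum_comm]
          refine Finset.sum_congr rfl fun r _ => Finset.sum_congr rfl fun q _ => ?_
          simp only [Matrix.cons_val, ← mul_assoc]
          rfl
      _ = _ := by
          simp only [hL, e1, ha1, mul_add, mul_sub, Finset.sum_add_distrib, Finset.sum_sub_distrib,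
            Finset.mul_sum, hdΓ _ _ k _, mul_comm (σ x _ l) (pd _ _ _ _)]
          ring
  have s1 := contract4_swap_left hl a1
  have s2 := contract4_swap_left hl e2
  have s3 := contract4_swap_right hr a3
  have s3' : (fun i j k l => a3 i j l k) = a3 := by
    funext i j k l
    simp only [ha3, hdΓ i _ l k, hΓs _ l k]
  have s5 := contract4_swap_left hl a5
  have s5' : (fun i j k l => a5 j i k l) = a5 := by
    funext i j k l
    simp only [ha5, hΓs _ j i]
  have s6 := contract4_swap_right hr e3
  have s7 := contract4_swap_right hr w
  have s8 := contract4_swap_right hr b3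
  have s9 := contract4_swap_left hl b2
  rw [s3'] at s3
  rw [s5'] at s5
  have hγ : ∀ i j k l, ∑ q, lowChristoffel D σ x q j l * Γ q i k =
      (1 / 2) * (e2 i j k l + e3 i j k l - b1 i j k l) := by
    intro i j k l
    simp only [lowChristoffel, he2, he3, hb1, ← Finset.sum_add_distrib, ← Finset.sum_sub_distrib,
      Finset.mul_sum]
    refine Finset.sum_congr rfl fun q _ => ?_
    rw [hds j q l]
    ring
  simp only [hH, hRL, hγ]
  simp only [contract4_sub, contract4_add, contract4_mul]
  rw [s1, s2, s6, s7, s8, s9]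
  linarith

/-- A family of metrics on a compact domain that is continuously differentiable in time together
with all its spatial derivatives; `σ` is its time derivative. -/
structure MetricFamily {m : ℕ} (D : Set (Vec m)) (g σ : ℝ → Vec m → Mat m) : Prop where
  metric : ∀ s, SmoothMetric D (g s)
  smooth : ∀ s i j, ContDiffOn ℝ ∞ (fun z => σ s z i j) D
  symm : ∀ s, ∀ z ∈ D, (σ s z).IsSymm
  timeC1 : ∀ l i j, TimeC1 D (fun s => iterPd D l fun z => g s z i j)
    fun s => iterPd D l fun z => σ s z i j

namespace MetricFamily

variable {m : ℕ} {D : Set (Vec m)} {g σ : ℝ → Vec m → Mat m} (hg : MetricFamily D g σ)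
include hg

theorem timeC1_entry (i j : Fin m) : TimeC1 D (fun s x => g s x i j) fun s x => σ s x i j :=
  hg.timeC1 [] i j

theorem isSymm (s : ℝ) (x : Vec m) (hx : x ∈ D) : (g s x).IsSymm := (hg.metric s).symm x hx

theorem pos (s : ℝ) (x : Vec m) (hx : x ∈ D) : ∀ X : Vec m, X ≠ 0 → 0 < bil (g s x) X X :=
  (hg.metric s).pos x hx

theorem timeC1_lowChristoffel (l i j : Fin m) :
    TimeC1 D (fun s x => lowChristoffel D (g s) x l i j)
      fun s x => lowChristoffel D (σ s) x l i j :=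
  TimeC1.const_mul continuousOn_const
    (((hg.timeC1 [i] j l).add (hg.timeC1 [j] i l)).sub (hg.timeC1 [l] i j))

/-- The variation of the Christoffel symbols. -/
theorem timeC1_christoffel (l i j : Fin m) :
    TimeC1 D (fun s x => christoffel D (g s) x l i j) fun s x =>
      ∑ p, (g s x)⁻¹ l p * (lowChristoffel D (σ s) x p i j -
        ∑ q, σ s x p q * christoffel D (g s) x q i j) := by
  have h := TimeC1.sum Finset.univ fun p _ => (TimeC1.matrix_inv hg.timeC1_entry
    (fun s x hx => (hg.metric s).det_ne_zero hx) l p).mul (hg.timeC1_lowChristoffel p i j)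
  refine h.congr (fun s x hx => christoffel_eq _ _ _ _ _ _) fun s x hx => ?_
  rw [Finset.sum_add_distrib]
  simp only [mul_sub, Finset.sum_sub_distrib]
  rw [add_comm, sub_eq_add_neg]
  congr 1
  have e : ∑ p, (g s x)⁻¹ l p * ∑ q, σ s x p q * christoffel D (g s) x q i j =
      (((g s x)⁻¹ * σ s x * (g s x)⁻¹) *ᵥ fun p => lowChristoffel D (g s) x p i j) l := by
    have e1 : (fun q => christoffel D (g s) x q i j) =
        (g s x)⁻¹ *ᵥ fun p => lowChristoffel D (g s) x p i j := by
      funext q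
      rw [christoffel_eq]
      rfl
    rw [← Matrix.mulVec_mulVec, ← e1, ← Matrix.mulVec_mulVec]
    rfl
  rw [e, ← Pi.neg_apply, ← Matrix.neg_mulVec]
  rfl

/-- The time derivative of the expression that represents the curvature in `contract4_riemann`. -/
theorem timeC1_riemann (i j k l : Fin m) :
    TimeC1 D (fun s x => pd D i (pd D k fun z => g s z j l) x +
        ∑ p, lowChristoffel D (g s) x p j l * christoffel D (g s) x p i k)
      fun s x => pd D i (pd D k fun z => σ s z j l) x +
        (∑ p, lowChristoffel D (σ s) x p j l * christoffel D (g s) x p i k +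
        ∑ p, lowChristoffel D (σ s) x p i k * christoffel D (g s) x p j l -
        ∑ q, ∑ p, christoffel D (g s) x q i k * (christoffel D (g s) x p l j * σ s x p q)) := by
  refine ((hg.timeC1 [i, k] j l).add (TimeC1.sum Finset.univ fun p _ =>
    (hg.timeC1_lowChristoffel p j l).mul (hg.timeC1_christoffel p i k))).congr
    (fun s x hx => rfl) fun s x hx => ?_
  rw [Finset.sum_add_distrib, add_sub_assoc]
  refine congrArg₂ _ rfl (congrArg₂ _ rfl ?_)
  have h : ∀ f : Fin m → ℝ, ∑ p, lowChristoffel D (g s) x p j l * ∑ r, (g s x)⁻¹ p r * f r =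
      ∑ r, christoffel D (g s) x r j l * f r := by
    intro f
    simp only [christoffel_eq, Finset.mul_sum, Finset.sum_mul]
    rw [Finset.sum_comm]
    refine Finset.sum_congr rfl fun r _ => Finset.sum_congr rfl fun p _ => ?_
    rw [(inv_isSymm (hg.isSymm s x hx)).apply]
    ring
  rw [h, Finset.sum_comm, ← Finset.sum_sub_distrib]
  refine Finset.sum_congr rfl fun r _ => ?_
  rw [mul_sub, Finset.mul_sum, mul_comm]
  congr 1
  refine Finset.sum_congr rfl fun q _ => ?_
  rw [(hg.metric s).christoffel_symm hx r l j]
  ring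

end MetricFamily

/-- The variation of the curvature, tested with `𝔸 U`. -/
theorem contract4_variation {m : ℕ} {D : Set (Vec m)} {G σ : Vec m → Mat m} (hG : SmoothMetric D G)
    (hσ : ∀ i j, ContDiffOn ℝ ∞ (fun z => σ z i j) D) (hσs : ∀ z ∈ D, (σ z).IsSymm)
    {x : Vec m} (hx : x ∈ D) (hi : x ∈ closure (interior D))
    {c : Fin m → Fin m → Fin m → Fin m → ℝ} (hl : ∀ i j k l, c i j k l = -c j i k l)
    (hr : ∀ i j k l, c i j k l = -c i j l k) (hc : ∀ i j k l, c i j k l = c l k j i) :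
    2 * contract4 c (fun i j k l => pd D i (pd D k fun z => σ z j l) x +
        (∑ p, lowChristoffel D σ x p j l * christoffel D G x p i k +
        ∑ p, lowChristoffel D σ x p i k * christoffel D G x p j l -
        ∑ q, ∑ p, christoffel D G x q i k * (christoffel D G x p l j * σ x p q))) =
      2 * contract4 c (fun i j k l => hess D G σ x ![i, k, j, l]) +
      contract4 c (fun i j k l => L1 (G x) (σ x) (riemann D G x) ![i, j, k, l]) := by
  have h1 : contract4 c (fun i j k l => L1 (G x) (σ x) (riemann D G x) ![i, j, k, l]) =
      contract4 c fun i j k l =>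
        ∑ q, Lend (G x) (σ x) q l * riemann D G x ![i, j, k, q] := by
    rw [← contract4_reverse hc]
    congr 1
    funext i j k l
    simp only [L1]
    refine Finset.sum_congr rfl fun q _ => ?_
    rw [hG.riemann_reverse hx hi i j k q]
    congr 2
    funext a
    fin_cases a <;> rfl
  have h2 : contract4 c (fun i j k l =>
        ∑ p, lowChristoffel D σ x p i k * christoffel D G x p j l) =
      contract4 c fun i j k l => ∑ p, lowChristoffel D σ x p j l * christoffel D G x p i k := by
    have s1 := contract4_swap_left hl fun i j k l =>
      ∑ p, lowChristoffel D σ x p i l * christoffel D G x p j k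
    have s2 := contract4_swap_right hr fun i j k l =>
      ∑ p, lowChristoffel D σ x p i l * christoffel D G x p j k
    rw [s2, s1]
  rw [h1, contract4_hess hG hσ hσs hx hl hr, contract4_add, contract4_sub, contract4_add, h2]
  ring

theorem sum_mul_cofactorTens {n : ℕ} (U : Tens (n + 2) (Fin n ⊕ Fin n)) (B : Tens (n + 2) (Fin 4)) :
    ∑ I, B I * cofactorTens U I =
      contract4 (fun i j k l => cofactorTens U ![i, j, k, l]) fun i j k l => B ![i, j, k, l] := by
  rw [sum_fin_four]
  simp only [contract4, mul_comm]

theorem sum_mul_swap23_cofactorTens {n : ℕ} (U : Tens (n + 2) (Fin n ⊕ Fin n))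
    (B : Tens (n + 2) (Fin 4)) :
    ∑ I, B I * swap23 (cofactorTens U) I =
      contract4 (fun i j k l => cofactorTens U ![i, j, k, l]) fun i j k l => B ![i, k, j, l] := by
  rw [sum_fin_four]
  simp only [contract4, swap23, Matrix.cons_val]
  refine Finset.sum_congr rfl fun i _ => ?_
  rw [Finset.sum_comm]
  simp only [mul_comm]

theorem continuousOn_cofactorTens {X : Type*} [TopologicalSpace X] {K : Set X} {n : ℕ}
    {U : X → Tens (n + 2) (Fin n ⊕ Fin n)} (hU : ∀ I, ContinuousOn (fun y => U y I) K)
    (I : Fin 4 → Fin (n + 2)) : ContinuousOn (fun y => cofactorTens (U y) I) K :=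
  continuousOn_finsetSum _ fun _ _ => continuousOn_finsetSum _ fun _ _ =>
    ((hU _).mul continuousOn_const).mul continuousOn_const

/-- The integrand of the curvature functional on an element, and its time derivative. -/
theorem MetricFamily.timeC1_element {n : ℕ} {D : Set (Vec (n + 2))}
    {g σ : ℝ → Vec (n + 2) → Mat (n + 2)} (hg : MetricFamily D g σ) (hi : D ⊆ closure (interior D))
    {X : Type*} [TopologicalSpace X] {K : Set X} {Ψ : X → Vec (n + 2)} (hΨ : ContinuousOn Ψ K)
    (hm : Set.MapsTo Ψ K D) {J : X → Mat (n + 2)} (hJc : ∀ i j, ContinuousOn (fun y => J y i j) K)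
    (hJ : ∀ y ∈ K, ∀ w, J y *ᵥ w = 0 → w = 0)
    {U : X → Tens (n + 2) (Fin n ⊕ Fin n)} (hUc : ∀ I, ContinuousOn (fun y => U y I) K)
    (hU : ∀ y ∈ K, IsSymDyadForm (U y)) :
    TimeC1 K (fun s y => ip (g s (Ψ y)) (riemann D (g s) (Ψ y)) (mapA (g s (Ψ y)) (U y)) *
        √ ((J y)ᵀ * g s (Ψ y) * J y).det)
      fun s y => (ip (g s (Ψ y)) (L1 (g s (Ψ y)) (σ s (Ψ y)) (riemann D (g s) (Ψ y)))
          (mapA (g s (Ψ y)) (U y))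
        - (1 / 2) * tr (g s (Ψ y)) (σ s (Ψ y)) *
          ip (g s (Ψ y)) (riemann D (g s) (Ψ y)) (mapA (g s (Ψ y)) (U y))) *
          √ ((J y)ᵀ * g s (Ψ y) * J y).det
        + 2 * (ip (g s (Ψ y)) (hess D (g s) (σ s) (Ψ y)) (swap23 (mapA (g s (Ψ y)) (U y))) *
          √ ((J y)ᵀ * g s (Ψ y) * J y).det) := by
  have hf := TimeC1.elementFactor (fun i j => (hg.timeC1_entry i j).comp hΨ hm)
    (fun s y hy => hg.isSymm s _ (hm hy)) (fun s y hy => hg.pos s _ (hm hy)) hJc hJ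
  have hR := TimeC1.const_mul (continuousOn_const (c := (2 : ℝ))) <|
    TimeC1.sum Finset.univ fun i _ => TimeC1.sum Finset.univ fun j _ =>
    TimeC1.sum Finset.univ fun k _ => TimeC1.sum Finset.univ fun l _ =>
    ((hg.timeC1_riemann i j k l).comp hΨ hm).const_mul (continuousOn_cofactorTens hUc ![i, j, k, l])
  refine (hf.mul hR).congr (fun s y hy => ?_) fun s y hy => ?_
  · have hx := hm hy
    rw [ip_mapA (hg.isSymm s _ hx) (det_pos_of_pos (hg.isSymm s _ hx) (hg.pos s _ hx)) (hU y hy),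
      sum_mul_cofactorTens, contract4_riemann (hg.metric s) hx (cofactorTens_swap_left _)
      (cofactorTens_swap_right _), contract4]
    ring
  · have hx := hm hy
    have hd := det_pos_of_pos (hg.isSymm s _ hx) (hg.pos s _ hx)
    have h1 := contract4_variation (hg.metric s) (hg.smooth s) (hg.symm s) hx (hi hx)
      (cofactorTens_swap_left (U y)) (cofactorTens_swap_right _) (cofactorTens_reverse (hU y hy))
    have h2 := contract4_riemann (hg.metric s) hx (cofactorTens_swap_left (U y))
      (cofactorTens_swap_right _)
    rw [ip_mapA (hg.isSymm s _ hx) hd (hU y hy), ip_mapA (hg.isSymm s _ hx) hd (hU y hy),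
      ip_swap23_mapA (hg.isSymm s _ hx) hd (hU y hy), sum_mul_cofactorTens, sum_mul_cofactorTens,
      sum_mul_swap23_cofactorTens]
    simp only [contract4] at h1 h2 ⊢
    rw [h1, ← h2]
    ring

/-! ### The variation of the second fundamental form -/

/-- The inverse norm of the covector field `ν`. -/
def invNorm {m : ℕ} (G : Mat m) (ν : Vec m) : ℝ := (√ (ν ⬝ᵥ (G⁻¹ *ᵥ ν)))⁻¹

/-- The second fundamental form of the level sets of a function with differential `ν`, up to terms
that vanish on tangent vectors: `-|ν|⁻¹ (∂ᵢ νⱼ - Γᵏᵢⱼ νₖ)`. -/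
def levelForm {m : ℕ} (D : Set (Vec m)) (G : Vec m → Mat m) (ν : Vec m → Vec m) (x : Vec m)
    (i j : Fin m) : ℝ :=
  -(invNorm (G x) (ν x) * (pd D i (fun z => ν z j) x - ∑ k, christoffel D G x k i j * ν x k))

namespace SmoothMetric

variable {m : ℕ} {D : Set (Vec m)} {G : Vec m → Mat m} (hG : SmoothMetric D G) {x : Vec m}
  {ν : Vec m → Vec m} (hν : ∀ i, ContDiffOn ℝ ∞ (fun z => ν z i) D) (hν0 : ∀ z ∈ D, ν z ≠ 0)
include hG hν

theorem inv_mulVec_smooth (i : Fin m) : ContDiffOn ℝ ∞ (fun z => ((G z)⁻¹ *ᵥ ν z) i) D := by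
  simp only [Matrix.mulVec, dotProduct]
  exact ContDiffOn.sum fun j _ => (hG.smooth_inv i j).mul (hν j)

include hν0

theorem invNorm_smooth : ContDiffOn ℝ ∞ (fun z => invNorm (G z) (ν z)) D := by
  have h : ContDiffOn ℝ ∞ (fun z => ν z ⬝ᵥ ((G z)⁻¹ *ᵥ ν z)) D := by
    simp only [dotProduct]
    exact ContDiffOn.sum fun i _ => (hν i).mul (hG.inv_mulVec_smooth hν i)
  have hp := fun z hz => inv_form_pos (hG.symm z hz) (hG.pos z hz) (hν0 z hz)
  exact (h.sqrt fun z hz => (hp z hz).ne').inv fun z hz => (Real.sqrt_pos.mpr (hp z hz)).ne'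

theorem unitNormal_smooth (l : Fin m) :
    ContDiffOn ℝ ∞ (fun z => unitNormal (G z) (ν z) l) D :=
  (hG.invNorm_smooth hν hν0).mul (hG.inv_mulVec_smooth hν l)

omit hν hν0 in
theorem mulVec_unitNormal_apply (hx : x ∈ D) (j : Fin m) :
    ∑ l, unitNormal (G x) (ν x) l * G x l j = invNorm (G x) (ν x) * ν x j := by
  have := congrFun (mulVec_unitNormal (hG.pos x hx) (ν x)) j
  rw [Pi.smul_apply, smul_eq_mul] at this
  rw [invNorm, ← this, Matrix.mulVec, dotProduct]
  exact Finset.sum_congr rfl fun l _ => by rw [(hG.symm x hx).apply, mul_comm]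

/-- The covariant derivative of the unit normal, with lowered index. -/
theorem sum_covDerivVec_mul (hx : x ∈ D) (i j : Fin m) :
    ∑ l, covDerivVec D G (fun z => unitNormal (G z) (ν z)) x i l * G x l j =
      -levelForm D G ν x i j + pd D i (fun z => invNorm (G z) (ν z)) x * ν x j := by
  have hn := hG.unitNormal_smooth hν hν0
  set n : Vec m → Vec m := fun z => unitNormal (G z) (ν z) with hndef
  -- differentiate `g(n, ∂ⱼ) = |ν|⁻¹ νⱼ`
  have h1 : ∑ l, (pd D i (fun z => n z l) x * G x l j + n x l * pd D i (fun z => G z l j) x) =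
      pd D i (fun z => invNorm (G z) (ν z)) x * ν x j +
        invNorm (G x) (ν x) * pd D i (fun z => ν z j) x := by
    rw [← pd_mul hG.uniq (hG.invNorm_smooth hν hν0) (hν j) hx,
      ← pd_congr (fun z hz => hG.mulVec_unitNormal_apply hz j) hx,
      pd_sum hG.uniq _ (fun l _ => (hn l).mul (hG.smooth l j)) hx]
    exact Finset.sum_congr rfl fun l _ => (pd_mul hG.uniq (hn l) (hG.smooth l j) hx i).symm
  have h2 : ∑ l, (∑ q, christoffel D G x l i q * n x q) * G x l j =
      ∑ l, n x l * lowChristoffel D G x j i l := by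
    simp only [← hG.sum_mul_christoffel hx j, Finset.sum_mul, Finset.mul_sum]
    rw [Finset.sum_comm]
    refine Finset.sum_congr rfl fun q _ => Finset.sum_congr rfl fun l _ => ?_
    rw [(hG.symm x hx).apply]
    ring
  have h3 : ∑ l, n x l * lowChristoffel D G x l i j =
      invNorm (G x) (ν x) * ∑ k, christoffel D G x k i j * ν x k := by
    simp only [← hG.sum_mul_christoffel hx, Finset.mul_sum]
    rw [Finset.sum_comm]
    refine Finset.sum_congr rfl fun k _ => ?_
    rw [mul_left_comm, ← hG.mulVec_unitNormal_apply hx k, Finset.mul_sum]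
    exact Finset.sum_congr rfl fun l _ => by ring
  have h4 : ∑ l, n x l * pd D i (fun z => G z l j) x =
      ∑ l, n x l * lowChristoffel D G x l i j + ∑ l, n x l * lowChristoffel D G x j i l := by
    simp only [pd_eq_lowChristoffel hG.symm hx, mul_add, Finset.sum_add_distrib]
  simp only [covDerivVec, add_mul, Finset.sum_add_distrib] at h1 ⊢
  rw [h2, levelForm]
  linear_combination h1 - h4 - h3

/-- The covariant derivative of the unit normal is tangential. -/
theorem sum_covDerivVec_mul_unitNormal (hx : x ∈ D) (i : Fin m) :
    ∑ j, (∑ l, covDerivVec D G (fun z => unitNormal (G z) (ν z)) x i l * G x l j) *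
      unitNormal (G x) (ν x) j = 0 := by
  have hn := hG.unitNormal_smooth hν hν0
  set n : Vec m → Vec m := fun z => unitNormal (G z) (ν z) with hndef
  -- differentiate `g(n, n) = 1`
  have h1 : ∀ z ∈ D, ∑ l, n z l * ∑ j, G z l j * n z j = 1 := fun z hz =>
    (unitNormal_spec (hG.symm z hz) (hG.pos z hz) (hν0 z hz)).1
  have hs : ∀ l, ContDiffOn ℝ ∞ (fun z => ∑ j, G z l j * n z j) D := fun l =>
    ContDiffOn.sum fun j _ => (hG.smooth l j).mul (hn j)
  have h2 := pd_congr (h := fun _ => (1 : ℝ)) h1 hx i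
  have h2' : ∑ l, pd D i (fun z => n z l * ∑ j, G z l j * n z j) x = 0 := by
    rw [← pd_sum hG.uniq _ (fun l _ => (hn l).mul (hs l)) hx, h2, pd_const]
  have h3 : ∀ l, pd D i (fun z => n z l * ∑ j, G z l j * n z j) x =
      pd D i (fun z => n z l) x * ∑ j, G x l j * n x j +
      n x l * ∑ j, (pd D i (fun z => G z l j) x * n x j + G x l j * pd D i (fun z => n z j) x) := by
    intro l
    rw [pd_mul hG.uniq (hn l) (hs l) hx,
      pd_sum hG.uniq _ (fun j _ => (hG.smooth l j).mul (hn j)) hx,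
      Finset.sum_congr rfl fun j _ => pd_mul hG.uniq (hG.smooth l j) (hn j) hx i]
  rw [Finset.sum_congr rfl fun l _ => h3 l] at h2'
  simp only [pd_eq_lowChristoffel hG.symm hx, mul_add, add_mul, Finset.sum_add_distrib,
    Finset.mul_sum] at h2'
  have e1 : ∑ l, ∑ j, n x l * (G x l j * pd D i (fun z => n z j) x) =
      ∑ l, ∑ j, pd D i (fun z => n z l) x * (G x l j * n x j) := by
    rw [Finset.sum_comm]
    refine Finset.sum_congr rfl fun l _ => Finset.sum_congr rfl fun j _ => ?_
    rw [(hG.symm x hx).apply]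
    ring
  have e2 : ∑ l, ∑ j, n x l * (lowChristoffel D G x l i j * n x j) =
      ∑ l, ∑ j, n x l * (lowChristoffel D G x j i l * n x j) := by
    rw [Finset.sum_comm]
    exact Finset.sum_congr rfl fun l _ => Finset.sum_congr rfl fun j _ => by ring
  have e3 : ∑ j, (∑ l, covDerivVec D G n x i l * G x l j) * n x j =
      ∑ l, ∑ j, pd D i (fun z => n z l) x * (G x l j * n x j) +
      ∑ l, ∑ j, n x l * (lowChristoffel D G x j i l * n x j) := by
    simp only [covDerivVec, add_mul, Finset.sum_add_distrib]
    congr 1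
    · simp only [Finset.sum_mul]
      rw [Finset.sum_comm]
      exact Finset.sum_congr rfl fun l _ => Finset.sum_congr rfl fun j _ => by ring
    · rw [Finset.sum_comm]
      refine Finset.sum_congr rfl fun j _ => ?_
      rw [Finset.sum_mul]
      simp only [← hG.sum_mul_christoffel hx j, Finset.sum_mul, Finset.mul_sum]
      rw [Finset.sum_comm]
      refine Finset.sum_congr rfl fun q _ => Finset.sum_congr rfl fun l _ => ?_
      rw [(hG.symm x hx).apply]
      ring
  rw [e3]
  linarith

/-- Contractions of the second fundamental form with a tangential tensor. -/
theorem trace_sff_mul (hx : x ∈ D) {C : Mat m} (hC : ν x ᵥ* C = 0) :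
    (sff D G (fun z => unitNormal (G z) (ν z)) x * C).trace =
      ∑ i, ∑ j, levelForm D G ν x i j * C j i := by
  simp only [Matrix.trace, Matrix.diag_apply, Matrix.mul_apply, sff, Matrix.of_apply,
    hG.sum_covDerivVec_mul hν hν0 hx]
  refine Finset.sum_congr rfl fun i _ => ?_
  have h : ∑ j, ν x j * C j i = 0 := congrFun hC i
  have e : ∑ j, -(-levelForm D G ν x i j + pd D i (fun z => invNorm (G z) (ν z)) x * ν x j) * C j i =
      ∑ j, levelForm D G ν x i j * C j i -
        pd D i (fun z => invNorm (G z) (ν z)) x * ∑ j, ν x j * C j i := by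
    rw [Finset.mul_sum, ← Finset.sum_sub_distrib]
    exact Finset.sum_congr rfl fun j _ => by ring
  rw [e, h, mul_zero, sub_zero]

/-- The second fundamental form, as an endomorphism, is the covariant derivative of the normal. -/
theorem sff_mul_tangential (hx : x ∈ D) :
    sff D G (fun z => unitNormal (G z) (ν z)) x *
        ((G x)⁻¹ - Matrix.vecMulVec (unitNormal (G x) (ν x)) (unitNormal (G x) (ν x))) =
      -Matrix.of fun i l => covDerivVec D G (fun z => unitNormal (G z) (ν z)) x i l := by
  have h1 : sff D G (fun z => unitNormal (G z) (ν z)) x =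
      -(Matrix.of (fun i l => covDerivVec D G (fun z => unitNormal (G z) (ν z)) x i l) * G x) := by
    ext i j
    simp [sff, Matrix.mul_apply]
  have h2 : sff D G (fun z => unitNormal (G z) (ν z)) x *ᵥ unitNormal (G x) (ν x) = 0 := by
    funext i
    have := hG.sum_covDerivVec_mul_unitNormal hν hν0 hx i
    simp only [Matrix.mulVec, dotProduct, sff, Matrix.of_apply, neg_mul, Finset.sum_neg_distrib,
      this, neg_zero, Pi.zero_apply]
  rw [Matrix.mul_sub, Matrix.mul_vecMulVec, h2, Matrix.zero_vecMulVec, sub_zero, h1, Matrix.neg_mul,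
    Matrix.mul_nonsing_inv_cancel_right _ _ (isUnit_det_of_pos (hG.pos x hx))]

theorem nablaContr_eq {σ : Vec m → Mat m} (hσ : ∀ i j, ContDiffOn ℝ ∞ (fun z => σ z i j) D)
    (hx : x ∈ D) :
    nablaContr D G (fun z => unitNormal (G z) (ν z)) σ x =
      Matrix.of (fun i l => covDerivVec D G (fun z => unitNormal (G z) (ν z)) x i l) * σ x +
      nablaFnF D G (fun z => unitNormal (G z) (ν z)) σ x := by
  have hn := hG.unitNormal_smooth hν hν0
  set n : Vec m → Vec m := fun z => unitNormal (G z) (ν z) with hndef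
  ext i j
  have h1 : nablaContr D G n σ x i j = pd D i (fun z => ∑ k, n z k * σ z k j) x -
      ∑ q, christoffel D G x q i j * ∑ k, n x k * σ x k q := by
    simp [nablaContr, covDeriv, Fin.tail]
  rw [h1, pd_sum hG.uniq _ (fun k _ => (hn k).mul (hσ k j)) hx,
    Finset.sum_congr rfl fun k _ => pd_mul hG.uniq (hn k) (hσ k j) hx i]
  simp only [Matrix.add_apply, Matrix.mul_apply, Matrix.of_apply, covDerivVec, nablaFnF,
    covDeriv_ofMat, add_mul, sub_mul, Finset.sum_add_distrib, Finset.sum_sub_distrib]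
  have e1 : ∑ k, (∑ q, christoffel D G x k i q * n x q) * σ x k j =
      ∑ k, (∑ q, christoffel D G x q i k * σ x q j) * n x k := by
    simp only [Finset.sum_mul]
    rw [Finset.sum_comm]
    exact Finset.sum_congr rfl fun _ _ => Finset.sum_congr rfl fun _ _ => by ring
  have e2 : ∑ q, christoffel D G x q i j * ∑ k, n x k * σ x k q =
      ∑ k, (∑ q, christoffel D G x q i j * σ x k q) * n x k := by
    simp only [Finset.sum_mul, Finset.mul_sum]
    rw [Finset.sum_comm]
    exact Finset.sum_congr rfl fun _ _ => Finset.sum_congr rfl fun _ _ => by ring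
  rw [e1, e2, Finset.sum_congr rfl fun k _ => mul_comm (n x k) _]
  ring

/-- The variation of the second fundamental form, contracted with a symmetric tangential tensor. -/
theorem facet_variation {σ : Vec m → Mat m} (hσ : ∀ i j, ContDiffOn ℝ ∞ (fun z => σ z i j) D)
    (hσs : ∀ z ∈ D, (σ z).IsSymm) (hx : x ∈ D) {C : Mat m} (hC : ν x ᵥ* C = 0) (hCs : C.IsSymm) :
    4 * ∑ i, ∑ j, ((1 / 2) * bil (σ x) (unitNormal (G x) (ν x)) (unitNormal (G x) (ν x)) *
        levelForm D G ν x i j + ∑ p, unitNormal (G x) (ν x) p * (lowChristoffel D σ x p i j -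
          ∑ q, σ x p q * christoffel D G x q i j)) * C j i =
      2 * ((bil (σ x) (unitNormal (G x) (ν x)) (unitNormal (G x) (ν x)) •
          sff D G (fun z => unitNormal (G z) (ν z)) x
        + nablaFnF D G (fun z => unitNormal (G z) (ν z)) σ x
        + nablaContr D G (fun z => unitNormal (G z) (ν z)) σ x
        - nablanFF D G (fun z => unitNormal (G z) (ν z)) σ x) * C).trace +
      2 * (sff D G (fun z => unitNormal (G z) (ν z)) x *
        ((G x)⁻¹ - Matrix.vecMulVec (unitNormal (G x) (ν x)) (unitNormal (G x) (ν x))) *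
          σ x * C).trace := by
  rw [hG.sff_mul_tangential hν hν0 hx, hG.nablaContr_eq hν hν0 hσ hx]
  have hs : ∀ i j, σ x i j = σ x j i := fun i j => (hσs x hx).apply j i
  have hs' : ∀ (Γ : Fin m → ℝ) i, ∑ q, Γ q * σ x q i = ∑ q, Γ q * σ x i q := fun Γ i =>
    Finset.sum_congr rfl fun q _ => by rw [hs]
  have hds : ∀ k i j, pd D k (fun z => σ z i j) x = pd D k (fun z => σ z j i) x := fun k i j =>
    pd_congr (fun z hz => (hσs z hz).apply j i) hx k
  have hτ : ∀ p i j, 2 * (lowChristoffel D σ x p i j - ∑ q, σ x p q * christoffel D G x q i j) =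
      covDeriv D G (fun z => ofMat (σ z)) x ![i, p, j] +
      covDeriv D G (fun z => ofMat (σ z)) x ![j, p, i] -
      covDeriv D G (fun z => ofMat (σ z)) x ![p, i, j] := by
    intro p i j
    simp only [covDeriv_ofMat, lowChristoffel, hds i p j, hds j p i, hG.christoffel_symm hx _ p i,
      hG.christoffel_symm hx _ p j, hG.christoffel_symm hx _ j i, hs',
      mul_comm (σ x p _)]
    ring
  have h1 : (nablaFnF D G (fun z => unitNormal (G z) (ν z)) σ x * C).trace =
      ∑ i, ∑ j, ∑ p, covDeriv D G (fun z => ofMat (σ z)) x ![j, p, i] *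
        unitNormal (G x) (ν x) p * C j i := by
    simp only [Matrix.trace, Matrix.diag_apply, Matrix.mul_apply, nablaFnF, Matrix.of_apply,
      Finset.sum_mul]
    rw [Finset.sum_comm]
    refine Finset.sum_congr rfl fun i _ => Finset.sum_congr rfl fun j _ =>
      Finset.sum_congr rfl fun p _ => ?_
    rw [hCs.apply]
  have h1' : (nablaFnF D G (fun z => unitNormal (G z) (ν z)) σ x * C).trace =
      ∑ i, ∑ j, ∑ p, covDeriv D G (fun z => ofMat (σ z)) x ![i, p, j] *
        unitNormal (G x) (ν x) p * C j i := by
    simp only [Matrix.trace, Matrix.diag_apply, Matrix.mul_apply, nablaFnF, Matrix.of_apply,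
      Finset.sum_mul]
  have h2 : (nablanFF D G (fun z => unitNormal (G z) (ν z)) σ x * C).trace =
      ∑ i, ∑ j, ∑ p, covDeriv D G (fun z => ofMat (σ z)) x ![p, i, j] *
        unitNormal (G x) (ν x) p * C j i := by
    simp only [Matrix.trace, Matrix.diag_apply, Matrix.mul_apply, nablanFF, Matrix.of_apply,
      Finset.sum_mul]
  have h3 := hG.trace_sff_mul hν hν0 hx hC
  simp only [Matrix.add_mul, Matrix.sub_mul, Matrix.trace_add, Matrix.trace_sub, Matrix.smul_mul,
    Matrix.trace_smul, smul_eq_mul, h3, Matrix.neg_mul, Matrix.trace_neg]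
  have h4 : 4 * ∑ i, ∑ j, ((1 / 2) * bil (σ x) (unitNormal (G x) (ν x)) (unitNormal (G x) (ν x)) *
        levelForm D G ν x i j + ∑ p, unitNormal (G x) (ν x) p * (lowChristoffel D σ x p i j -
          ∑ q, σ x p q * christoffel D G x q i j)) * C j i =
      2 * (bil (σ x) (unitNormal (G x) (ν x)) (unitNormal (G x) (ν x)) *
        ∑ i, ∑ j, levelForm D G ν x i j * C j i) +
      2 * ∑ i, ∑ j, ∑ p, 2 * (lowChristoffel D σ x p i j - ∑ q, σ x p q * christoffel D G x q i j) *
        unitNormal (G x) (ν x) p * C j i := by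
    simp only [add_mul, Finset.sum_add_distrib, Finset.sum_mul, mul_add, Finset.mul_sum]
    congr 1
    · exact Finset.sum_congr rfl fun i _ => Finset.sum_congr rfl fun j _ => by ring
    · exact Finset.sum_congr rfl fun i _ => Finset.sum_congr rfl fun j _ =>
        Finset.sum_congr rfl fun p _ => by ring
  rw [h4]
  simp only [hτ, add_mul, sub_mul, Finset.sum_add_distrib, Finset.sum_sub_distrib]
  rw [← h1, ← h1', ← h2]
  ring

end SmoothMetric

/-- The time derivative of `levelForm`. -/
theorem MetricFamily.timeC1_levelForm {m : ℕ} {D : Set (Vec m)} {g σ : ℝ → Vec m → Mat m}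
    (hg : MetricFamily D g σ) {ν : Vec m → Vec m} (hν : ∀ i, ContDiffOn ℝ ∞ (fun z => ν z i) D)
    (hν0 : ∀ z ∈ D, ν z ≠ 0) (i j : Fin m) :
    TimeC1 D (fun s x => levelForm D (g s) ν x i j) fun s x =>
      (1 / 2) * bil (σ s x) (unitNormal (g s x) (ν x)) (unitNormal (g s x) (ν x)) *
        levelForm D (g s) ν x i j +
      ∑ p, unitNormal (g s x) (ν x) p * (lowChristoffel D (σ s) x p i j -
          ∑ q, σ s x p q * christoffel D (g s) x q i j) := by
  have hD := (hg.metric 0).uniq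
  have hc : ∀ i, ContinuousOn (fun z => ν z i) D := fun i => (hν i).continuousOn
  have hP := fun s x hx => inv_form_pos (hg.isSymm s x hx) (hg.pos s x hx) (hν0 x hx)
  have hN := ((TimeC1.inv_form hg.timeC1_entry hg.isSymm
    (fun s x hx => (hg.metric s).det_ne_zero hx) hc hc).sqrt hP).inv
    fun s x hx => (Real.sqrt_pos.mpr (hP s x hx)).ne'
  have hL := (TimeC1.const (pd_smooth hD (hν j) i).continuousOn).sub
    (TimeC1.sum Finset.univ fun k _ => (hg.timeC1_christoffel k i j).mul (TimeC1.const (hc k)))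
  refine (hN.mul hL).neg.congr (fun s x hx => rfl) fun s x hx => ?_
  have hP0 := hP s x hx
  rw [bil_unitNormal_unitNormal (hg.isSymm s x hx) (hg.pos s x hx) _ _ (hν0 x hx)]
  have e : ∑ p, unitNormal (g s x) (ν x) p * (lowChristoffel D (σ s) x p i j -
          ∑ q, σ s x p q * christoffel D (g s) x q i j) =
      (√ (ν x ⬝ᵥ ((g s x)⁻¹ *ᵥ ν x)))⁻¹ * ∑ k, (∑ p, (g s x)⁻¹ k p *
        (lowChristoffel D (σ s) x p i j - ∑ q, σ s x p q * christoffel D (g s) x q i j)) * ν x k := by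
    simp only [unitNormal, Pi.smul_apply, smul_eq_mul, Matrix.mulVec, dotProduct, mul_assoc,
      ← Finset.mul_sum]
    congr 1
    simp only [Finset.sum_mul]
    rw [Finset.sum_comm]
    refine Finset.sum_congr rfl fun k _ => Finset.sum_congr rfl fun p _ => ?_
    rw [(inv_isSymm (hg.isSymm s x hx)).apply]
    ring
  rw [e, levelForm, invNorm]
  simp only [mul_zero, add_zero, zero_sub]
  have hsq := Real.sq_sqrt hP0.le
  have hs0 := Real.sqrt_pos.mpr hP0
  set r := √ (ν x ⬝ᵥ ((g s x)⁻¹ *ᵥ ν x))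
  rw [← hsq]
  field_simp
  ring

/-! ### The reference simplex -/

section Simplex

variable {m : ℕ}

theorem sum_bary (y : Vec m) : ∑ a, bary y a = 1 := by
  simp [bary, Fin.sum_univ_succ]

theorem tail_bary (y : Vec m) : Fin.tail (bary y) = y := Fin.tail_cons _ _

theorem bary_tail {p : Fin (m + 1) → ℝ} (hp : ∑ a, p a = 1) : bary (Fin.tail p) = p := by
  rw [Fin.sum_univ_succ] at hp
  have h : 1 - ∑ i, Fin.tail p i = p 0 := by
    simp only [Fin.tail]
    linarith
  rw [bary, h, Fin.cons_self_tail]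

theorem mem_simplex_iff (y : Vec m) : y ∈ simplex m ↔ ∀ a, 0 ≤ bary y a := by
  simp [simplex, bary, Fin.forall_fin_succ, and_comm]

theorem bary_faceMap (a : Fin (m + 2)) (y : Vec m) :
    bary (faceMap a y) = a.insertNth (α := fun _ => ℝ) 0 (bary y) :=
  bary_tail (by rw [Fin.sum_univ_succAbove _ a]; simp [sum_bary])

theorem bary_faceMap_self (a : Fin (m + 2)) (y : Vec m) : bary (faceMap a y) a = 0 := by
  simp [bary_faceMap]

theorem bary_faceMap_succAbove (a : Fin (m + 2)) (y : Vec m) (c : Fin (m + 1)) :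
    bary (faceMap a y) (a.succAbove c) = bary y c := by
  simp [bary_faceMap]

theorem faceMap_mem_simplex (a : Fin (m + 2)) {y : Vec m} (hy : y ∈ simplex m) :
    faceMap a y ∈ simplex (m + 1) := by
  rw [mem_simplex_iff] at hy ⊢
  intro b
  rcases Fin.eq_self_or_eq_succAbove a b with rfl | ⟨c, rfl⟩
  · rw [bary_faceMap_self]
  · rw [bary_faceMap_succAbove]
    exact hy c

/-- A left inverse of `faceMap`, obtained by omitting a barycentric coordinate. -/
def dropCoord (a : Fin (m + 2)) (z : Vec (m + 1)) : Vec m :=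
  Fin.tail fun c => bary z (a.succAbove c)

theorem dropCoord_faceMap (a : Fin (m + 2)) (y : Vec m) : dropCoord a (faceMap a y) = y := by
  simp only [dropCoord, bary_faceMap_succAbove]
  exact tail_bary y

theorem contDiff_bary (a : Fin (m + 1)) : ContDiff ℝ ∞ fun y : Vec m => bary y a := by
  refine Fin.cases ?_ (fun i => ?_) a
  · simp only [bary, Fin.cons_zero]
    fun_prop
  · simp only [bary, Fin.cons_succ]
    fun_prop

theorem contDiff_faceMap (a : Fin (m + 2)) : ContDiff ℝ ∞ (faceMap a : Vec m → Vec (m + 1)) := by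
  refine contDiff_pi.mpr fun i => ?_
  simp only [faceMap, Fin.tail]
  rcases Fin.eq_self_or_eq_succAbove a i.succ with h | ⟨c, h⟩
  · simp only [h, Fin.insertNth_apply_same]
    exact contDiff_const
  · simp only [h, Fin.insertNth_apply_succAbove]
    exact contDiff_bary c

theorem contDiff_dropCoord (a : Fin (m + 2)) :
    ContDiff ℝ ∞ (dropCoord a : Vec (m + 1) → Vec m) :=
  contDiff_pi.mpr fun _ => contDiff_bary _

theorem convex_simplex : Convex ℝ (simplex m) := by
  intro x hx y hy r s hr hs hrs
  refine ⟨fun i => ?_, ?_⟩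
  · have := hx.1 i
    have := hy.1 i
    simp only [Pi.add_apply, Pi.smul_apply, smul_eq_mul]
    positivity
  · simp only [Pi.add_apply, Pi.smul_apply, smul_eq_mul, Finset.sum_add_distrib, ← Finset.mul_sum]
    nlinarith [hx.2, hy.2]

theorem isCompact_simplex : IsCompact (simplex m) := by
  refine (isCompact_Icc (a := (0 : Vec m)) (b := 1)).of_isClosed_subset ?_ fun y hy =>
    ⟨fun i => hy.1 i, fun i => ?_⟩
  · have h1 : simplex m = (⋂ i, {y | 0 ≤ y i}) ∩ {y | ∑ i, y i ≤ 1} := by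
      ext y
      simp [simplex]
    rw [h1]
    exact (isClosed_iInter fun i => isClosed_le continuous_const (continuous_apply i)).inter
      (isClosed_le (by fun_prop) continuous_const)
  · exact (Finset.single_le_sum (fun j _ => hy.1 j) (Finset.mem_univ i)).trans hy.2

theorem interior_simplex_nonempty : (interior (simplex m)).Nonempty := by
  have ho : IsOpen ((⋂ i, {y : Vec m | 0 < y i}) ∩ {y | ∑ i, y i < 1}) :=
    (isOpen_iInter_of_finite fun i => isOpen_lt continuous_const (continuous_apply i)).inter
      (isOpen_lt (by fun_prop) continuous_const)
  refine ⟨fun _ => 1 / (m + 1), interior_maximal (fun y hy => ?_) ho ?_⟩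
  · exact ⟨fun i => (Set.mem_iInter.mp hy.1 i).le, le_of_lt hy.2⟩
  · refine ⟨Set.mem_iInter.mpr fun i => ?_, ?_⟩
    · simp only [Set.mem_ofPred_eq]
      positivity
    · simp only [Set.mem_ofPred_eq, Finset.sum_const, Finset.card_univ, Fintype.card_fin,
        nsmul_eq_mul]
      rw [mul_one_div, div_lt_one (by positivity)]
      linarith

theorem uniqueDiffOn_simplex : UniqueDiffOn ℝ (simplex m) :=
  uniqueDiffOn_convex convex_simplex interior_simplex_nonempty

theorem simplex_subset_closure_interior : simplex m ⊆ closure (interior (simplex m)) := by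
  rw [convex_simplex.closure_interior_eq_closure_of_nonempty_interior interior_simplex_nonempty]
  exact subset_closure

/-- The differentials of the barycentric coordinates of two vertices are linearly independent if
there is a third vertex `c`: a vector along the edge from `c` to `b` separates them. -/
theorem exists_fderiv_bary {a b c : Fin (m + 1)} (hab : a ≠ b) (hca : c ≠ a) (hcb : c ≠ b)
    (y : Vec m) : ∃ w, fderiv ℝ (fun y : Vec m => bary y a) y w = 0 ∧
      fderiv ℝ (fun y : Vec m => bary y b) y w = 1 := by
  set w : Vec m := Fin.tail (Pi.single b 1 : Fin (m + 1) → ℝ) -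
    Fin.tail (Pi.single c 1 : Fin (m + 1) → ℝ) with hw
  have h : ∀ d : Fin (m + 1), fderiv ℝ (fun y : Vec m => bary y d) y w =
      (Pi.single b 1 : Fin (m + 1) → ℝ) d - (Pi.single c 1 : Fin (m + 1) → ℝ) d := by
    intro d
    -- the derivative of an affine function is read off from its values
    have h1 : ∀ r : ℝ, bary (y + r • w) d = bary y d + r * ((Pi.single b 1 : Fin (m + 1) → ℝ) d -
        (Pi.single c 1 : Fin (m + 1) → ℝ) d) := by
      intro r
      have h2 : y + r • w = Fin.tail (fun d => bary y d + r * ((Pi.single b 1 : Fin (m + 1) → ℝ) d -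
          (Pi.single c 1 : Fin (m + 1) → ℝ) d)) := by
        funext i
        simp [hw, Fin.tail, bary]
      rw [h2, bary_tail]
      simp [Finset.sum_add_distrib, sum_bary, ← Finset.mul_sum]
    have h3 : HasDerivAt (fun r : ℝ => bary (y + r • w) d)
        (fderiv ℝ (fun y : Vec m => bary y d) y w) 0 := by
      have h4 : HasFDerivAt (fun y : Vec m => bary y d) (fderiv ℝ (fun y : Vec m => bary y d) y) y :=
        ((contDiff_bary d).differentiable (by simp) y).hasFDerivAt
      have h5 : HasDerivAt (fun r : ℝ => y + r • w) w 0 := by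
        simpa using ((hasDerivAt_id (0 : ℝ)).smul_const w).const_add y
      have h6 : HasFDerivAt (fun y : Vec m => bary y d)
          (fderiv ℝ (fun y : Vec m => bary y d) y) (y + (0 : ℝ) • w) := by simpa using h4
      exact h6.comp_hasDerivAt (0 : ℝ) h5
    simp only [h1] at h3
    have h7 : HasDerivAt (fun r : ℝ => bary y d + r * ((Pi.single b 1 : Fin (m + 1) → ℝ) d -
        (Pi.single c 1 : Fin (m + 1) → ℝ) d)) (1 * ((Pi.single b 1 : Fin (m + 1) → ℝ) d -
        (Pi.single c 1 : Fin (m + 1) → ℝ) d)) 0 :=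
      ((hasDerivAt_id (0 : ℝ)).mul_const _).const_add _
    rw [h3.unique h7, one_mul]
  refine ⟨w, ?_, ?_⟩
  · rw [h, Pi.single_eq_of_ne hab, Pi.single_eq_of_ne hca.symm, sub_zero]
  · rw [h, Pi.single_eq_same, Pi.single_eq_of_ne hcb.symm, sub_zero]

end Simplex

/-! ### Tangent spaces of parametrized subsimplices -/

section Jacobian

variable {m k : ℕ} {Ψ : Vec m → Vec k} (hΨ : ContDiffOn ℝ ∞ Ψ (simplex m))

theorem hasFDerivWithinAt_of_smooth {E F : Type*} [NormedAddCommGroup E] [NormedSpace ℝ E]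
    [NormedAddCommGroup F] [NormedSpace ℝ F] {f : E → F} {D : Set E} (hf : ContDiffOn ℝ ∞ f D)
    {x : E} (hx : x ∈ D) : HasFDerivWithinAt f (fderivWithin ℝ f D x) D x :=
  (hf.differentiableOn (by simp) x hx).hasFDerivWithinAt

/-- A linear functional in terms of its values on the frame. -/
theorem sum_apply_frame (L : Vec m →L[ℝ] ℝ) (w : Vec m) : ∑ p, w p * L (frame p) = L w := by
  conv_rhs => rw [pi_eq_sum_univ' w]
  simp only [map_sum, map_smul, smul_eq_mul, frame]

theorem jac_mulVec (y w : Vec m) :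
    jac Ψ y *ᵥ w = fderivWithin ℝ Ψ (simplex m) y w := by
  funext i
  have h := sum_apply_frame
    ((ContinuousLinearMap.proj i : Vec k →L[ℝ] ℝ).comp (fderivWithin ℝ Ψ (simplex m) y)) w
  simpa [Matrix.mulVec, dotProduct, jac, mul_comm] using h

include hΨ

theorem continuousOn_jac (i : Fin k) (p : Fin m) :
    ContinuousOn (fun y => jac Ψ y i p) (simplex m) := by
  have h := (hΨ.fderivWithin (m := ∞) uniqueDiffOn_simplex (by simp)).continuousOn
  exact (continuous_apply i).comp_continuousOn (h.clm_apply continuousOn_const)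

/-- A parametrization with a differentiable left inverse is an immersion. -/
theorem jac_injective {D : Set (Vec k)} {χ : Vec k → Vec m} (hm : Set.MapsTo Ψ (simplex m) D)
    (hχ : ContDiffOn ℝ ∞ χ D) (h : ∀ y ∈ simplex m, χ (Ψ y) = y) {y : Vec m} (hy : y ∈ simplex m)
    (w : Vec m) (hw : jac Ψ y *ᵥ w = 0) : w = 0 := by
  have h1 := (hasFDerivWithinAt_of_smooth hχ (hm hy)).comp y (hasFDerivWithinAt_of_smooth hΨ hy) hm
  have h2 := (uniqueDiffOn_simplex y hy).eq h1
    ((hasFDerivWithinAt_id y _).congr (fun z hz => h z hz) (h y hy))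
  have h3 := congrArg (fun L : Vec m →L[ℝ] Vec m => L w) h2
  rw [jac_mulVec] at hw
  simpa [hw] using h3.symm

/-- The differential of a function vanishes on the tangent vectors of a submanifold on which the
function vanishes. -/
theorem pd_vecMul_jac {D : Set (Vec k)} {f : Vec k → ℝ} (hm : Set.MapsTo Ψ (simplex m) D)
    (hf : ContDiffOn ℝ ∞ f D) (h : ∀ y ∈ simplex m, f (Ψ y) = 0) {y : Vec m} (hy : y ∈ simplex m) :
    (fun i => pd D i f (Ψ y)) ᵥ* jac Ψ y = 0 := by
  have h1 := (hasFDerivWithinAt_of_smooth hf (hm hy)).comp y (hasFDerivWithinAt_of_smooth hΨ hy) hm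
  have h2 := (uniqueDiffOn_simplex y hy).eq h1
    ((hasFDerivWithinAt_const (0 : ℝ) y _).congr (fun z hz => h z hz) (h y hy))
  funext p
  have h3 := congrArg (fun L : Vec m →L[ℝ] ℝ => L (frame p)) h2
  simp only [ContinuousLinearMap.comp_apply, _root_.zero_apply] at h3
  rw [← sum_apply_frame] at h3
  simp only [Matrix.vecMul, dotProduct, Pi.zero_apply, ← h3, jac, Matrix.of_apply, pd, mul_comm]

end Jacobian

/-! ### Curved simplices -/

namespace Element

variable {n : ℕ} (T : Element n)

theorem mapsTo_map : Set.MapsTo T.map (simplex (n + 2)) T.carrier := Set.mapsTo_image _ _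

theorem isCompact_carrier : IsCompact T.carrier :=
  isCompact_simplex.image_of_continuousOn T.map_smooth.continuousOn

/-- The differentials of the parametrization and of its inverse are inverse to each other. -/
theorem exists_hasFDerivWithinAt {y : Vec (n + 2)} (hy : y ∈ simplex (n + 2)) :
    ∃ e : Vec (n + 2) ≃L[ℝ] Vec (n + 2),
      HasFDerivWithinAt T.map (e : Vec (n + 2) →L[ℝ] Vec (n + 2)) (simplex (n + 2)) y ∧
      HasFDerivWithinAt T.inv (e.symm : Vec (n + 2) →L[ℝ] Vec (n + 2)) T.carrier (T.map y) := by
  have h1 := hasFDerivWithinAt_of_smooth T.map_smooth hy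
  have h2 := hasFDerivWithinAt_of_smooth T.inv_smooth (T.mapsTo_map hy)
  have h3 := (uniqueDiffOn_simplex y hy).eq (h2.comp y h1 T.mapsTo_map)
    ((hasFDerivWithinAt_id y _).congr (fun z hz => T.left_inv z hz) (T.left_inv y hy))
  have h4 : (fderivWithin ℝ T.inv (T.map '' simplex (n + 2)) (T.map y)).toLinearMap ∘ₗ
      (fderivWithin ℝ T.map (simplex (n + 2)) y).toLinearMap = LinearMap.id := by
    refine LinearMap.ext fun v => ?_
    exact congrArg (fun L : Vec (n + 2) →L[ℝ] Vec (n + 2) => L v) h3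
  have h5 := (LinearMap.comp_eq_id_comm ℝ _).mp h4
  exact ⟨ContinuousLinearEquiv.equivOfInverse _ _ (fun v => LinearMap.congr_fun h4 v)
    fun v => LinearMap.congr_fun h5 v, h1, h2⟩

theorem uniqueDiffOn_carrier : UniqueDiffOn ℝ T.carrier := by
  rintro _ ⟨y, hy, rfl⟩
  obtain ⟨e, he, -⟩ := T.exists_hasFDerivWithinAt hy
  exact he.uniqueDiffWithinAt_of_continuousLinearEquiv e (uniqueDiffOn_simplex y hy)

theorem carrier_subset_closure_interior : T.carrier ⊆ closure (interior T.carrier) := by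
  have h1 : T.map '' interior (simplex (n + 2)) ⊆ interior T.carrier := by
    rintro _ ⟨y, hy, rfl⟩
    have hn := mem_interior_iff_mem_nhds.mp hy
    obtain ⟨e, he, -⟩ := T.exists_hasFDerivWithinAt (interior_subset hy)
    -- the inverse function theorem
    have hs := ((T.map_smooth.contDiffAt hn).hasStrictFDerivAt' (he.hasFDerivAt hn) (by simp))
    rw [mem_interior_iff_mem_nhds, ← hs.map_nhds_eq_of_equiv]
    exact Filter.image_mem_map hn
  rintro _ ⟨y, hy, rfl⟩
  exact closure_mono h1 (((T.map_smooth.continuousOn y hy).mono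
    interior_subset).mem_closure_image (simplex_subset_closure_interior hy))

theorem face_subset_carrier (I : Finset (Fin (n + 3))) : T.face I ⊆ T.carrier :=
  Set.image_mono fun _ hy => hy.1

theorem bary_inv_of_mem_face {I : Finset (Fin (n + 3))} {x : Vec (n + 2)} (hx : x ∈ T.face I)
    {a : Fin (n + 3)} (ha : a ∈ I) : bary (T.inv x) a = 0 := by
  obtain ⟨y, hy, rfl⟩ := hx
  rw [T.left_inv y hy.1]
  exact hy.2 a ha

theorem mapsTo_facetMap (a : Fin (n + 3)) :
    Set.MapsTo (T.facetMap a) (simplex (n + 1)) (T.face {a}) := fun y hy =>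
  Set.mem_image_of_mem _ ⟨faceMap_mem_simplex a hy, by simp [bary_faceMap_self]⟩

theorem mapsTo_ridgeMap (a : Fin (n + 3)) (c : Fin (n + 2)) :
    Set.MapsTo (T.ridgeMap a c) (simplex n) (T.face {a, a.succAbove c}) := fun y hy =>
  Set.mem_image_of_mem _ ⟨faceMap_mem_simplex a (faceMap_mem_simplex c hy), by
    simp [bary_faceMap_self, bary_faceMap_succAbove]⟩

theorem facetMap_smooth (a : Fin (n + 3)) : ContDiffOn ℝ ∞ (T.facetMap a) (simplex (n + 1)) :=
  T.map_smooth.comp (contDiff_faceMap a).contDiffOn fun _ hy => faceMap_mem_simplex a hy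

theorem ridgeMap_smooth (a : Fin (n + 3)) (c : Fin (n + 2)) :
    ContDiffOn ℝ ∞ (T.ridgeMap a c) (simplex n) :=
  T.map_smooth.comp ((contDiff_faceMap a).comp (contDiff_faceMap c)).contDiffOn fun _ hy =>
    faceMap_mem_simplex a (faceMap_mem_simplex c hy)

theorem jac_map_injective {y : Vec (n + 2)} (hy : y ∈ simplex (n + 2)) (w : Vec (n + 2))
    (hw : jac T.map y *ᵥ w = 0) : w = 0 :=
  jac_injective T.map_smooth T.mapsTo_map T.inv_smooth T.left_inv hy w hw

theorem jac_facetMap_injective (a : Fin (n + 3)) {y : Vec (n + 1)} (hy : y ∈ simplex (n + 1))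
    (w : Vec (n + 1)) (hw : jac (T.facetMap a) y *ᵥ w = 0) : w = 0 :=
  jac_injective (T.facetMap_smooth a)
    ((T.mapsTo_facetMap a).mono_right (T.face_subset_carrier _))
    ((contDiff_dropCoord a).comp_contDiffOn T.inv_smooth) (fun z hz => by
      simp only [Function.comp_apply, facetMap, T.left_inv _ (faceMap_mem_simplex a hz),
        dropCoord_faceMap]) hy w hw

theorem jac_ridgeMap_injective (a : Fin (n + 3)) (c : Fin (n + 2)) {y : Vec n}
    (hy : y ∈ simplex n) (w : Vec n) (hw : jac (T.ridgeMap a c) y *ᵥ w = 0) : w = 0 :=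
  jac_injective (T.ridgeMap_smooth a c)
    ((T.mapsTo_ridgeMap a c).mono_right (T.face_subset_carrier _))
    (((contDiff_dropCoord c).comp (contDiff_dropCoord a)).comp_contDiffOn T.inv_smooth)
    (fun z hz => by
      simp only [Function.comp_apply, ridgeMap,
        T.left_inv _ (faceMap_mem_simplex a (faceMap_mem_simplex c hz)), dropCoord_faceMap]) hy w hw

theorem bary_inv_smooth (a : Fin (n + 3)) :
    ContDiffOn ℝ ∞ (fun z => bary (T.inv z) a) T.carrier :=
  (contDiff_bary a).comp_contDiffOn T.inv_smooth

theorem dbary_smooth (a : Fin (n + 3)) (k : Fin (n + 2)) :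
    ContDiffOn ℝ ∞ (fun z => T.dbary a z k) T.carrier :=
  pd_smooth T.uniqueDiffOn_carrier (T.bary_inv_smooth a) k

/-- The differential of a barycentric coordinate of a point of `T`, in the reference simplex. -/
theorem exists_dbary_dotProduct {x : Vec (n + 2)} (hx : x ∈ T.carrier) :
    ∃ e : Vec (n + 2) ≃L[ℝ] Vec (n + 2), ∃ y, ∀ a w,
      T.dbary a x ⬝ᵥ e w = fderiv ℝ (fun y : Vec (n + 2) => bary y a) y w := by
  obtain ⟨y, hy, rfl⟩ := hx
  obtain ⟨e, -, he⟩ := T.exists_hasFDerivWithinAt hy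
  refine ⟨e, y, fun a w => ?_⟩
  have h1 : HasFDerivAt (fun y : Vec (n + 2) => bary y a)
      (fderiv ℝ (fun y : Vec (n + 2) => bary y a) y) (T.inv (T.map y)) := by
    rw [T.left_inv y hy]
    exact ((contDiff_bary a).differentiable (by simp) y).hasFDerivAt
  have h2 := (h1.comp_hasFDerivWithinAt _ he).fderivWithin
    (T.uniqueDiffOn_carrier _ (T.mapsTo_map hy))
  have h3 : ∀ v, T.dbary a (T.map y) ⬝ᵥ v =
      fderivWithin ℝ (fun z => bary (T.inv z) a) T.carrier (T.map y) v := by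
    intro v
    rw [← sum_apply_frame]
    simp only [dotProduct, dbary, pd, mul_comm]
  rw [h3]
  change fderivWithin ℝ ((fun y : Vec (n + 2) => bary y a) ∘ T.inv) T.carrier (T.map y) (e w) = _
  rw [h2]
  simp

theorem dbary_ne_smul {a b : Fin (n + 3)} (hab : a ≠ b) {x : Vec (n + 2)} (hx : x ∈ T.carrier)
    (r : ℝ) : T.dbary b x ≠ r • T.dbary a x := by
  intro h
  obtain ⟨e, y, he⟩ := T.exists_dbary_dotProduct hx
  obtain ⟨c, hc⟩ : ∃ c : Fin (n + 3), c ∉ ({a, b} : Finset (Fin (n + 3))) := by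
    by_contra! hc
    have h1 : (Finset.univ : Finset (Fin (n + 3))) ⊆ {a, b} := fun c _ => hc c
    have h2 := Finset.card_le_card h1
    have h3 := Finset.card_le_two (a := a) (b := b)
    simp only [Finset.card_univ, Fintype.card_fin] at h2
    omega
  simp only [Finset.mem_insert, Finset.mem_singleton, not_or] at hc
  obtain ⟨w, hwa, hwb⟩ := exists_fderiv_bary hab hc.1 hc.2 y
  rw [← he] at hwa hwb
  rw [h, smul_dotProduct, hwa, smul_zero] at hwb
  exact zero_ne_one hwb

theorem dbary_ne_zero (a : Fin (n + 3)) {x : Vec (n + 2)} (hx : x ∈ T.carrier) :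
    T.dbary a x ≠ 0 := by
  obtain ⟨b, hb⟩ := exists_ne a
  simpa using T.dbary_ne_smul hb hx 0

/-- The differential of a barycentric coordinate vanishes on tangent vectors of the facet on which
the coordinate vanishes. -/
theorem dbary_vecMul_jac {m : ℕ} {Ψ : Vec m → Vec (n + 2)} (hΨ : ContDiffOn ℝ ∞ Ψ (simplex m))
    {I : Finset (Fin (n + 3))} (hm : Set.MapsTo Ψ (simplex m) (T.face I)) {a : Fin (n + 3)}
    (ha : a ∈ I) {y : Vec m} (hy : y ∈ simplex m) : T.dbary a (Ψ y) ᵥ* jac Ψ y = 0 :=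
  pd_vecMul_jac hΨ (hm.mono_right (T.face_subset_carrier I)) (T.bary_inv_smooth a)
    (fun _ hz => T.bary_inv_of_mem_face (hm hz) ha) hy

end Element

/-! ### Families of Regge metrics -/

theorem iterPd_smooth {m : ℕ} {D : Set (Vec m)} (hD : UniqueDiffOn ℝ D) {f : Vec m → ℝ}
    (hf : ContDiffOn ℝ ∞ f D) (l : List (Fin m)) : ContDiffOn ℝ ∞ (iterPd D l f) D := by
  induction l with
  | nil => exact hf
  | cons k l ih => exact pd_smooth hD ih k

theorem bil_eq_sum {m : ℕ} (G : Mat m) (X Y : Vec m) :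
    bil G X Y = ∑ i, ∑ j, X i * (G i j * Y j) := by
  simp only [bil, dotProduct, Matrix.mulVec, Finset.mul_sum]

/-- The entries of `JᵀGJ` are the values of `G` on the columns of `J`. -/
theorem transpose_mul_mul_apply {m k : ℕ} (G : Mat k) (J : Matrix (Fin k) (Fin m) ℝ)
    (p q : Fin m) : (Jᵀ * G * J) p q = bil G (fun i => J i p) (fun i => J i q) := by
  rw [Matrix.mul_assoc, Matrix.mul_apply, bil, dotProduct]
  refine Finset.sum_congr rfl fun i _ => ?_
  rw [Matrix.mul_apply, Matrix.transpose_apply, Matrix.mulVec, dotProduct]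

theorem continuousOn_cofactorMat {X : Type*} [TopologicalSpace X] {K : Set X} {n : ℕ}
    {U : X → Tens (n + 2) (Fin n ⊕ Fin n)} (hU : ∀ I, ContinuousOn (fun y => U y I) K)
    {ν : X → Vec (n + 2)} (hν : ∀ i, ContinuousOn (fun y => ν y i) K) (i j : Fin (n + 2)) :
    ContinuousOn (fun y => cofactorMat (U y) (ν y) i j) K := by
  simp only [cofactorMat, Matrix.of_apply]
  exact continuousOn_finsetSum _ fun b _ => continuousOn_finsetSum _ fun c _ =>
    (((continuousOn_cofactorTens hU _).mul (hν b)).mul (hν c))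

namespace TimeC1

variable {X : Type*} [TopologicalSpace X] [MeasurableSpace X] [OpensMeasurableSpace X] [T2Space X]
    {μ : Measure X} [IsFiniteMeasureOnCompacts μ] [TopologicalSpace.PseudoMetrizableSpace X]
    {D : Set X} {f a b : ℝ → X → ℝ}

/-- Differentiation under the integral sign, with the integral of the derivative split into two
parts; the continuity of the first part implies that of the second. -/
theorem hasDerivAt_integral_add (hD : IsCompact D) (hf : TimeC1 D f fun s x => a s x + b s x)
    {t : ℝ} (ha : ContinuousOn (a t) D) :
    HasDerivAt (fun s => ∫ x in D, f s x ∂μ) (∫ x in D, a t x ∂μ + ∫ x in D, b t x ∂μ) t := by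
  refine (hf.hasDerivAt_integral hD t).congr_deriv ?_
  have hb : ContinuousOn (b t) D := by
    refine ((hf.continuousOn_deriv_at t).sub ha).congr fun x _ => ?_
    simp
  exact integral_add (ha.integrableOn_compact hD) (hb.integrableOn_compact hD)

end TimeC1

namespace Mesh

variable {n : ℕ} {M : Mesh n} {g : ℝ → M.Field2} {U : M.FieldU}

section Family

variable (hg : ∀ t, M.IsReggeMetric (g t)) (hC1 : M.IsC1Family g)
include hg hC1

theorem metricFamily (i : M.ι) :
    MetricFamily (M.elem i).carrier (fun s => g s i) fun s => M.timeDeriv g s i where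
  metric s := ⟨(M.elem i).uniqueDiffOn_carrier, (hg s).smooth i, (hg s).symm i, (hg s).pos i⟩
  smooth s j k := hC1.smooth_deriv s i j k
  symm s z hz := by
    ext j k
    simp only [Matrix.transpose_apply, timeDeriv, Matrix.of_apply]
    congr 1
    funext r
    exact ((hg r).symm i z hz).apply j k
  timeC1 l j k := TimeC1.of_deriv (M.elem i).isCompact_carrier
    (fun s x hx => hC1.hasDeriv i j k l x hx s)
    (fun s => (iterPd_smooth (M.elem i).uniqueDiffOn_carrier ((hg s).smooth i j k) l).continuousOn)
    (hC1.cont i j k l)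

/-- The tangential-tangential continuity of a Regge metric is inherited by its time derivative. -/
theorem timeDeriv_tt {F : M.Facet} (hF : F ∈ M.intFacets) {s s' : M.Side} (hs : s ∈ M.sides F)
    (hs' : s' ∈ M.sides F) {x : Vec (n + 2)} (hx : x ∈ F.1) (hxs : x ∈ (M.elem s.1).carrier)
    (hxs' : x ∈ (M.elem s'.1).carrier) {X Y : Vec (n + 2)} (hX : M.Tangent s x X)
    (hY : M.Tangent s x Y) (t : ℝ) :
    bil (M.timeDeriv g t s.1 x) X Y = bil (M.timeDeriv g t s'.1 x) X Y := by
  have h : ∀ i, x ∈ (M.elem i).carrier → HasDerivAt (fun r => bil (g r i x) X Y)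
      (bil (M.timeDeriv g t i x) X Y) t := by
    intro i hi
    simp only [bil_eq_sum]
    exact HasDerivAt.fun_sum fun j _ => HasDerivAt.fun_sum fun k _ =>
      ((((metricFamily hg hC1 i).timeC1_entry j k).deriv t x hi).mul_const _).const_mul _
  refine (h s.1 hxs).unique ?_
  rw [funext fun r => (hg r).tt F hF s hs s' hs' x hx X Y hX hY]
  exact h s'.1 hxs'

end Family

section FacetGeometry

variable (F : M.Facet)

theorem plus_mem_sides : M.plus F ∈ M.sides F := by
  simp only [sides, Finset.mem_filter_univ]
  exact F.2.choose_spec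

theorem facetPar_smooth : ContDiffOn ℝ ∞ (M.facetPar F) (simplex (n + 1)) :=
  (M.elem _).facetMap_smooth _

theorem jac_facetPar_injective {y : Vec (n + 1)} (hy : y ∈ simplex (n + 1)) (w : Vec (n + 1))
    (hw : jac (M.facetPar F) y *ᵥ w = 0) : w = 0 :=
  (M.elem _).jac_facetMap_injective _ hy w hw

variable {F}

theorem mapsTo_facetPar_sideSet {s : M.Side} (hs : s ∈ M.sides F) :
    Set.MapsTo (M.facetPar F) (simplex (n + 1)) (M.sideSet s) := by
  have h1 : M.sideSet s = F.1 := by simpa [sides] using hs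
  have h2 : M.sideSet (M.plus F) = F.1 := F.2.choose_spec
  rw [h1, ← h2]
  exact (M.elem _).mapsTo_facetMap _

theorem facetPar_mem {y : Vec (n + 1)} (hy : y ∈ simplex (n + 1)) : M.facetPar F y ∈ F.1 := by
  have h : M.sideSet (M.plus F) = F.1 := F.2.choose_spec
  rw [← h]
  exact mapsTo_facetPar_sideSet (plus_mem_sides F) hy

theorem mapsTo_facetPar {s : M.Side} (hs : s ∈ M.sides F) :
    Set.MapsTo (M.facetPar F) (simplex (n + 1)) (M.elem s.1).carrier :=
  (mapsTo_facetPar_sideSet hs).mono_right ((M.elem s.1).face_subset_carrier _)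

theorem dbary_vecMul_jac_facetPar {s : M.Side} (hs : s ∈ M.sides F) {y : Vec (n + 1)}
    (hy : y ∈ simplex (n + 1)) :
    (M.elem s.1).dbary s.2 (M.facetPar F y) ᵥ* jac (M.facetPar F) y = 0 :=
  (M.elem s.1).dbary_vecMul_jac (facetPar_smooth F) (mapsTo_facetPar_sideSet hs)
    (Finset.mem_singleton_self _) hy

theorem tangent_jac {s : M.Side} (hs : s ∈ M.sides F) {y : Vec (n + 1)}
    (hy : y ∈ simplex (n + 1)) (p : Fin (n + 1)) :
    M.Tangent s (M.facetPar F y) fun i => jac (M.facetPar F) y i p :=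
  congrFun (dbary_vecMul_jac_facetPar hs hy) p

theorem jump_eq (B : M.Side → Vec (n + 2) → Mat (n + 2)) (y : Vec (n + 1)) :
    M.jump F B y = (jac (M.facetPar F) y)ᵀ * (∑ s ∈ M.sides F, B s (M.facetPar F y)) *
      jac (M.facetPar F) y := by
  simp only [jump, restrict, Matrix.mul_sum, Matrix.sum_mul]

end FacetGeometry

end Mesh

/-! ### The variation on facets -/

/-- The tensor `C_ν` is tangential: covectors that vanish on the tangent space are in its kernel. -/
theorem vecMul_cofactorMat_of_vecMul_jac {n : ℕ} {G : Mat (n + 2)} (hs : G.IsSymm)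
    (hp : ∀ X : Vec (n + 2), X ≠ 0 → 0 < bil G X X) {U : Tens (n + 2) (Fin n ⊕ Fin n)}
    (hU : IsSymDyadForm U) {ν : Vec (n + 2)} (hν : ν ≠ 0)
    {J : Matrix (Fin (n + 2)) (Fin (n + 1)) ℝ} (hJ : ∀ w, J *ᵥ w = 0 → w = 0) (hνJ : ν ᵥ* J = 0)
    {μ : Vec (n + 2)} (hμJ : μ ᵥ* J = 0) : μ ᵥ* cofactorMat U ν = 0 := by
  have h := congrArg (fun A => μ ᵥ* A) (raise_contractNN hs hp hU hν hJ hνJ)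
  simp only [Matrix.mul_assoc J, ← Matrix.vecMul_vecMul μ J, hμJ, Matrix.zero_vecMul,
    Matrix.vecMul_smul] at h
  refine (smul_eq_zero.mp h.symm).resolve_left (inv_ne_zero (mul_ne_zero ?_ ?_))
  · exact (det_pos_of_pos hs hp).ne'
  · exact (inv_form_pos hs hp hν).ne'

/-- Only the tangential part of a 2-tensor enters its product with `C_ν`. -/
theorem tangentialInv_mul_congr {n : ℕ} {G : Mat (n + 2)} (hs : G.IsSymm)
    (hp : ∀ X : Vec (n + 2), X ≠ 0 → 0 < bil G X X) {U : Tens (n + 2) (Fin n ⊕ Fin n)}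
    (hU : IsSymDyadForm U) {ν : Vec (n + 2)} (hν : ν ≠ 0)
    {J : Matrix (Fin (n + 2)) (Fin (n + 1)) ℝ} (hJ : ∀ w, J *ᵥ w = 0 → w = 0) (hνJ : ν ᵥ* J = 0)
    {σ σ' : Mat (n + 2)} (hσ : Jᵀ * σ * J = Jᵀ * σ' * J) :
    tangentialInv G J * σ * cofactorMat U ν = tangentialInv G J * σ' * cofactorMat U ν := by
  have h1 := raise_contractNN hs hp hU hν hJ hνJ
  set A := (Jᵀ * G * J)⁻¹ * (Jᵀ * contractNN (mapA G U) (unitNormal G ν) * J) * (Jᵀ * G * J)⁻¹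
  have h0 : (G.det * (ν ⬝ᵥ (G⁻¹ *ᵥ ν)))⁻¹ ≠ 0 :=
    inv_ne_zero (mul_ne_zero (det_pos_of_pos hs hp).ne' (inv_form_pos hs hp hν).ne')
  have h2 : ∀ τ : Mat (n + 2), (G.det * (ν ⬝ᵥ (G⁻¹ *ᵥ ν)))⁻¹ •
      (tangentialInv G J * τ * cofactorMat U ν) =
        J * (Jᵀ * G * J)⁻¹ * (Jᵀ * τ * J) * A * Jᵀ := by
    intro τ
    rw [← Matrix.mul_smul, ← h1, tangentialInv]
    simp only [Matrix.mul_assoc]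
  have h3 := (h2 σ).trans ((by rw [hσ]) : _ = _) |>.trans (h2 σ').symm
  exact smul_right_injective _ h0 h3

namespace Mesh

variable {n : ℕ} {M : Mesh n} {g : ℝ → M.Field2} {U : M.FieldU}

section Facet

/-- The metric-independent tangential tensor on a facet that is proportional to `A_{F𝔫𝔫F}` with
raised indices. -/
def facetCof (U : M.FieldU) (F : M.Facet) (y : Vec (n + 1)) : Mat (n + 2) :=
  cofactorMat (U (M.plus F).1 (M.facetPar F y))
    ((M.elem (M.plus F).1).dbary (M.plus F).2 (M.facetPar F y))

/-- The factor of proportionality between `A_{F𝔫𝔫F}` with raised indices and `facetCof`. -/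
def facetScale (g : M.Field2) (F : M.Facet) (y : Vec (n + 1)) : ℝ :=
  ((g (M.plus F).1 (M.facetPar F y)).det *
    ((M.elem (M.plus F).1).dbary (M.plus F).2 (M.facetPar F y) ⬝ᵥ
      ((g (M.plus F).1 (M.facetPar F y))⁻¹ *ᵥ
        (M.elem (M.plus F).1).dbary (M.plus F).2 (M.facetPar F y))))⁻¹

/-- The inverse of the metric on a facet, as a tensor of the ambient space. -/
def facetInv (g : M.Field2) (F : M.Facet) (y : Vec (n + 1)) : Mat (n + 2) :=
  tangentialInv (g (M.plus F).1 (M.facetPar F y)) (jac (M.facetPar F) y)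

theorem dbary_ne_zero_facet {F : M.Facet} {s : M.Side} (hs : s ∈ M.sides F) {y : Vec (n + 1)}
    (hy : y ∈ simplex (n + 1)) : (M.elem s.1).dbary s.2 (M.facetPar F y) ≠ 0 :=
  (M.elem _).dbary_ne_zero _ (mapsTo_facetPar hs hy)

section Pointwise

variable {g : M.Field2} (hg : M.IsReggeMetric g) {F : M.Facet} {y : Vec (n + 1)}
  (hy : y ∈ simplex (n + 1))
include hg hy

/-- Contractions with tangential tensors of the second fundamental forms from all sides of a
facet. -/
theorem trace_secondFF_mul {s : M.Side} (hs : s ∈ M.sides F) {C : Mat (n + 2)}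
    (hC : (M.elem s.1).dbary s.2 (M.facetPar F y) ᵥ* C = 0) :
    (M.secondFF g s (M.facetPar F y) * C).trace = ∑ i, ∑ j,
      levelForm (M.elem s.1).carrier (g s.1) ((M.elem s.1).dbary s.2) (M.facetPar F y) i j *
        C j i :=
  (SmoothMetric.mk (M.elem s.1).uniqueDiffOn_carrier (hg.smooth s.1) (hg.symm s.1)
    (hg.pos s.1)).trace_sff_mul (fun k => (M.elem s.1).dbary_smooth s.2 k)
    (fun _ hz => (M.elem s.1).dbary_ne_zero s.2 hz) (mapsTo_facetPar hs hy) hC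

theorem facet_symm {s : M.Side} (hs : s ∈ M.sides F) : (g s.1 (M.facetPar F y)).IsSymm :=
  hg.symm s.1 _ (mapsTo_facetPar hs hy)

theorem facet_pos {s : M.Side} (hs : s ∈ M.sides F) :
    ∀ X : Vec (n + 2), X ≠ 0 → 0 < bil (g s.1 (M.facetPar F y)) X X :=
  hg.pos s.1 _ (mapsTo_facetPar hs hy)

/-- On an interior facet, the inverse metric of any side is the sum of `facetInv` and a normal
part. -/
theorem facetInv_eq (hF : F ∈ M.intFacets) {s : M.Side} (hs : s ∈ M.sides F) :
    (g s.1 (M.facetPar F y))⁻¹ - Matrix.vecMulVec (M.nrm g s (M.facetPar F y))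
      (M.nrm g s (M.facetPar F y)) = M.facetInv g F y := by
  have h : (jac (M.facetPar F) y)ᵀ * g s.1 (M.facetPar F y) * jac (M.facetPar F) y =
      (jac (M.facetPar F) y)ᵀ * g (M.plus F).1 (M.facetPar F y) * jac (M.facetPar F) y := by
    ext p q
    rw [transpose_mul_mul_apply, transpose_mul_mul_apply]
    exact hg.tt F hF s hs _ (plus_mem_sides F) _ (facetPar_mem hy) _ _ (tangent_jac hs hy p)
      (tangent_jac hs hy q)
  rw [facetInv, tangentialInv, ← h]
  exact sub_eq_of_eq_add (inv_eq_tangentialInv_add (facet_symm hg hy hs) (facet_pos hg hy hs)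
    (jac_facetPar_injective F hy) (dbary_ne_zero_facet hs hy) (dbary_vecMul_jac_facetPar hs hy))

omit hg in
theorem vecMul_facetInv {s : M.Side} (hs : s ∈ M.sides F) (C : Mat (n + 2)) :
    (M.elem s.1).dbary s.2 (M.facetPar F y) ᵥ* (M.facetInv g F y * C) = 0 := by
  simp only [facetInv, tangentialInv, Matrix.mul_assoc]
  rw [← Matrix.vecMul_vecMul, dbary_vecMul_jac_facetPar hs hy, Matrix.zero_vecMul]

variable (hU : M.IsTest U)
include hU

theorem vecMul_facetCof {s : M.Side} (hs : s ∈ M.sides F) :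
    (M.elem s.1).dbary s.2 (M.facetPar F y) ᵥ* M.facetCof U F y = 0 :=
  vecMul_cofactorMat_of_vecMul_jac (facet_symm hg hy (plus_mem_sides F))
    (facet_pos hg hy (plus_mem_sides F))
    (hU.form (M.plus F).1 _ (mapsTo_facetPar (plus_mem_sides F) hy))
    (dbary_ne_zero_facet (plus_mem_sides F) hy)
    (jac_facetPar_injective F hy) (dbary_vecMul_jac_facetPar (plus_mem_sides F) hy)
    (dbary_vecMul_jac_facetPar hs hy)

theorem ip_AFnnF (B : M.Side → Vec (n + 2) → Mat (n + 2)) :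
    ip (M.onFacet F g y) (ofMat (M.jump F B y)) (ofMat (M.AFnnF g (M.testA g U) F y)) =
      M.facetScale g F y * ∑ s ∈ M.sides F, (B s (M.facetPar F y) * M.facetCof U F y).trace := by
  rw [jump_eq, ← Matrix.trace_sum, ← Matrix.sum_mul]
  exact ip_contractNN (facet_symm hg hy (plus_mem_sides F))
    (facet_pos hg hy (plus_mem_sides F))
    (hU.form (M.plus F).1 _ (mapsTo_facetPar (plus_mem_sides F) hy))
    (dbary_ne_zero_facet (plus_mem_sides F) hy)
    (jac_facetPar_injective F hy) (dbary_vecMul_jac_facetPar (plus_mem_sides F) hy) _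

theorem triple_AFnnF (B : M.Side → Vec (n + 2) → Mat (n + 2)) (σ : M.Field2) :
    triple (M.onFacet F g y) (M.jump F B y) (traceRev (M.onFacet F g y) (M.onFacet F σ y))
        (M.AFnnF g (M.testA g U) F y) =
      M.facetScale g F y * (∑ s ∈ M.sides F, (B s (M.facetPar F y) * (M.facetInv g F y *
          σ (M.plus F).1 (M.facetPar F y) * M.facetCof U F y)).trace -
        tr (M.onFacet F g y) (M.onFacet F σ y) *
          ∑ s ∈ M.sides F, (B s (M.facetPar F y) * M.facetCof U F y).trace) := by
  rw [jump_eq, ← Matrix.trace_sum, ← Matrix.sum_mul, ← Matrix.trace_sum, ← Matrix.sum_mul,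
    ← Matrix.mul_assoc, ← Matrix.mul_assoc]
  exact triple_traceRev_contractNN (facet_symm hg hy (plus_mem_sides F))
    (facet_pos hg hy (plus_mem_sides F))
    (hU.form (M.plus F).1 _ (mapsTo_facetPar (plus_mem_sides F) hy))
    (dbary_ne_zero_facet (plus_mem_sides F) hy)
    (jac_facetPar_injective F hy) (dbary_vecMul_jac_facetPar (plus_mem_sides F) hy) _ _

end Pointwise

variable (hg : ∀ t, M.IsReggeMetric (g t)) (hC1 : M.IsC1Family g) (hU : M.IsTest U)
  {F : M.Facet}

include hg hC1 hU in
/-- Only the tangential part of `ġ`, which is the same from all sides, enters its product with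
`facetCof`. -/
theorem facetInv_mul_timeDeriv (hF : F ∈ M.intFacets) {s : M.Side} (hs : s ∈ M.sides F)
    {y : Vec (n + 1)} (hy : y ∈ simplex (n + 1)) (t : ℝ) :
    M.facetInv (g t) F y * M.timeDeriv g t s.1 (M.facetPar F y) * M.facetCof U F y =
      M.facetInv (g t) F y * M.timeDeriv g t (M.plus F).1 (M.facetPar F y) *
        M.facetCof U F y := by
  have hp := plus_mem_sides F
  refine tangentialInv_mul_congr (facet_symm (hg t) hy hp) (facet_pos (hg t) hy hp)
    (hU.form (M.plus F).1 _ (mapsTo_facetPar hp hy)) (dbary_ne_zero_facet hp hy)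
    (jac_facetPar_injective F hy) (dbary_vecMul_jac_facetPar hp hy) ?_
  ext p q
  rw [transpose_mul_mul_apply, transpose_mul_mul_apply]
  exact timeDeriv_tt hg hC1 hF hs hp (facetPar_mem hy) (mapsTo_facetPar hs hy)
    (mapsTo_facetPar hp hy) (tangent_jac hs hy p) (tangent_jac hs hy q) t

theorem continuousOn_dbary_facet (i : Fin (n + 2)) : ContinuousOn
    (fun y => (M.elem (M.plus F).1).dbary (M.plus F).2 (M.facetPar F y) i) (simplex (n + 1)) :=
  ((M.elem _).dbary_smooth _ i).continuousOn.comp (facetPar_smooth F).continuousOn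
    (mapsTo_facetPar (plus_mem_sides F))

include hU in
theorem continuousOn_facetCof (i j : Fin (n + 2)) :
    ContinuousOn (fun y => M.facetCof U F y i j) (simplex (n + 1)) :=
  continuousOn_cofactorMat (fun I => (hU.smooth _ I).continuousOn.comp
    (facetPar_smooth F).continuousOn (mapsTo_facetPar (plus_mem_sides F)))
    continuousOn_dbary_facet i j

include hg hC1

/-- The volume form of a facet, times the factor in `A_{F𝔫𝔫F}`, and its time derivative. -/
theorem timeC1_facetScale :
    TimeC1 (simplex (n + 1)) (fun t y =>
        √ (restrict (M.facetPar F) y (g t (M.plus F).1 (M.facetPar F y))).det *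
          M.facetScale (g t) F y)
      fun t y => -((1 / 2) * tr (M.onFacet F (g t) y) (M.onFacet F (M.timeDeriv g t) y)) *
        (√ (restrict (M.facetPar F) y (g t (M.plus F).1 (M.facetPar F y))).det *
          M.facetScale (g t) F y) :=
  TimeC1.facetFactor (G := fun t y => g t (M.plus F).1 (M.facetPar F y))
    (σ := fun t y => M.timeDeriv g t (M.plus F).1 (M.facetPar F y))
    (fun i j => ((metricFamily hg hC1 _).timeC1_entry i j).comp (facetPar_smooth F).continuousOn
      (mapsTo_facetPar (plus_mem_sides F)))
    (fun t _ hy => facet_symm (hg t) hy (plus_mem_sides F))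
    (fun t _ hy => facet_pos (hg t) hy (plus_mem_sides F)) (continuousOn_jac (facetPar_smooth F))
    (fun _ hy => jac_facetPar_injective F hy) continuousOn_dbary_facet
    (fun _ hy => dbary_ne_zero_facet (plus_mem_sides F) hy)
    (fun _ hy => dbary_vecMul_jac_facetPar (plus_mem_sides F) hy)

theorem timeC1_levelForm_facet {s : M.Side} (hs : s ∈ M.sides F) (i j : Fin (n + 2)) :
    TimeC1 (simplex (n + 1)) (fun t y => levelForm (M.elem s.1).carrier (g t s.1)
        ((M.elem s.1).dbary s.2) (M.facetPar F y) i j)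
      fun t y => (1 / 2) * bil (M.timeDeriv g t s.1 (M.facetPar F y)) (M.nrm (g t) s (M.facetPar F y))
          (M.nrm (g t) s (M.facetPar F y)) * levelForm (M.elem s.1).carrier (g t s.1)
            ((M.elem s.1).dbary s.2) (M.facetPar F y) i j +
        ∑ p, M.nrm (g t) s (M.facetPar F y) p *
          (lowChristoffel (M.elem s.1).carrier (M.timeDeriv g t s.1) (M.facetPar F y) p i j -
            ∑ q, M.timeDeriv g t s.1 (M.facetPar F y) p q *
              christoffel (M.elem s.1).carrier (g t s.1) (M.facetPar F y) q i j) :=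
  ((metricFamily hg hC1 s.1).timeC1_levelForm (fun k => (M.elem s.1).dbary_smooth s.2 k)
    (fun _ hz => (M.elem s.1).dbary_ne_zero s.2 hz) i j).comp (facetPar_smooth F).continuousOn
    (mapsTo_facetPar hs)

include hU

/-- The variation of the second fundamental form from one side of a facet. -/
theorem facet_variation_side (hF : F ∈ M.intFacets) {s : M.Side} (hs : s ∈ M.sides F)
    {y : Vec (n + 1)} (hy : y ∈ simplex (n + 1)) (t : ℝ) :
    4 * ∑ i, ∑ j, ((1 / 2) * bil (M.timeDeriv g t s.1 (M.facetPar F y))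
          (M.nrm (g t) s (M.facetPar F y)) (M.nrm (g t) s (M.facetPar F y)) *
            levelForm (M.elem s.1).carrier (g t s.1) ((M.elem s.1).dbary s.2)
              (M.facetPar F y) i j +
        ∑ p, M.nrm (g t) s (M.facetPar F y) p *
          (lowChristoffel (M.elem s.1).carrier (M.timeDeriv g t s.1) (M.facetPar F y) p i j -
            ∑ q, M.timeDeriv g t s.1 (M.facetPar F y) p q *
              christoffel (M.elem s.1).carrier (g t s.1) (M.facetPar F y) q i j)) *
          M.facetCof U F y j i =
      2 * (M.facetForm (g t) (M.timeDeriv g t) s (M.facetPar F y) * M.facetCof U F y).trace +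
      2 * (M.secondFF (g t) s (M.facetPar F y) * (M.facetInv (g t) F y *
          M.timeDeriv g t (M.plus F).1 (M.facetPar F y) * M.facetCof U F y)).trace := by
  rw [← facetInv_mul_timeDeriv hg hC1 hU hF hs hy t, ← facetInv_eq (hg t) hy hF hs,
    ← Matrix.mul_assoc, ← Matrix.mul_assoc]
  exact ((metricFamily hg hC1 s.1).metric t).facet_variation
    (fun k => (M.elem s.1).dbary_smooth s.2 k)
    (fun _ hz => (M.elem s.1).dbary_ne_zero s.2 hz) ((metricFamily hg hC1 s.1).smooth t)
    ((metricFamily hg hC1 s.1).symm t) (mapsTo_facetPar hs hy)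
    (vecMul_facetCof (hg t) hy hU hs) (cofactorMat_isSymm (hU.form (M.plus F).1 _
      (mapsTo_facetPar (plus_mem_sides F) hy)) _)

/-- The integrand of the curvature functional on a facet, and its time derivative. -/
theorem timeC1_facet (hF : F ∈ M.intFacets) :
    TimeC1 (simplex (n + 1)) (fun t y => ip (M.onFacet F (g t) y)
          (ofMat (M.jump F (M.secondFF (g t)) y))
          (ofMat (M.AFnnF (g t) (M.testA (g t) U) F y)) *
        √ (restrict (M.facetPar F) y (g t (M.plus F).1 (M.facetPar F y))).det)
      fun t y => (1 / 2) * (triple (M.onFacet F (g t) y) (M.jump F (M.secondFF (g t)) y)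
          (traceRev (M.onFacet F (g t) y) (M.onFacet F (M.timeDeriv g t) y))
          (M.AFnnF (g t) (M.testA (g t) U) F y) *
            √ (restrict (M.facetPar F) y (g t (M.plus F).1 (M.facetPar F y))).det) +
        (1 / 2) * (ip (M.onFacet F (g t) y)
          (ofMat (M.jump F (M.facetForm (g t) (M.timeDeriv g t)) y))
          (ofMat (M.AFnnF (g t) (M.testA (g t) U) F y)) *
            √ (restrict (M.facetPar F) y (g t (M.plus F).1 (M.facetPar F y))).det) := by
  have hlev := TimeC1.sum (M.sides F) fun s hs => TimeC1.sum Finset.univ fun i _ =>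
    TimeC1.sum Finset.univ fun j _ => (timeC1_levelForm_facet hg hC1 hs i j).mul
      (TimeC1.const (continuousOn_facetCof (F := F) hU j i))
  refine ((timeC1_facetScale (F := F) hg hC1).mul hlev).congr (fun t y hy => ?_) fun t y hy => ?_
  · rw [ip_AFnnF (hg t) hy hU, Finset.sum_congr rfl fun s hs =>
      trace_secondFF_mul (hg t) hy hs (vecMul_facetCof (hg t) hy hU hs)]
    ring
  · rw [ip_AFnnF (hg t) hy hU, triple_AFnnF (hg t) hy hU]
    simp only [mul_zero, add_zero]
    have h4 : ∀ {a b c : ℝ}, 4 * a = 2 * b + 2 * c → a = (1 / 2) * (b + c) := by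
      intro a b c h
      linarith
    rw [Finset.sum_congr rfl fun s hs => h4 (facet_variation_side hg hC1 hU hF hs hy t),
      ← Finset.mul_sum, Finset.sum_add_distrib, Finset.sum_congr rfl fun s hs =>
      (trace_secondFF_mul (hg t) hy hs (vecMul_facetCof (hg t) hy hU hs)).symm]
    ring

/-- The part of the derivative in `timeC1_facet` that belongs to `aForm` is integrable by
itself. -/
theorem continuousOn_triple_facet (t : ℝ) :
    ContinuousOn (fun y => triple (M.onFacet F (g t) y) (M.jump F (M.secondFF (g t)) y)
          (traceRev (M.onFacet F (g t) y) (M.onFacet F (M.timeDeriv g t) y))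
          (M.AFnnF (g t) (M.testA (g t) U) F y) *
            √ (restrict (M.facetPar F) y (g t (M.plus F).1 (M.facetPar F y))).det)
      (simplex (n + 1)) := by
  have hp := plus_mem_sides F
  have hJ := continuousOn_jac (facetPar_smooth F)
  have hH := TimeC1.transpose_mul_mul (G := fun t y => g t (M.plus F).1 (M.facetPar F y))
    (σ := fun t y => M.timeDeriv g t (M.plus F).1 (M.facetPar F y))
    (fun i j => ((metricFamily hg hC1 _).timeC1_entry i j).comp (facetPar_smooth F).continuousOn
      (mapsTo_facetPar hp)) hJ
  have hHinv := continuousOn_matrix_inv (fun p q => (hH p q).continuousOn_at t) fun y hy =>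
    (det_pos_of_pos (restrict_isSymm (facet_symm (hg t) hy hp) _)
      (restrict_pos (facet_pos (hg t) hy hp) (jac_facetPar_injective F hy))).ne'
  have hI : ∀ i j, ContinuousOn (fun y => M.facetInv (g t) F y i j) (simplex (n + 1)) :=
    continuousOn_matrix_mul (continuousOn_matrix_mul hJ hHinv) fun p i => hJ i p
  have hC := continuousOn_facetCof (F := F) hU
  have hσ : ∀ i j, ContinuousOn (fun y => M.timeDeriv g t (M.plus F).1 (M.facetPar F y) i j)
      (simplex (n + 1)) := fun i j =>
    (((metricFamily hg hC1 _).timeC1_entry i j).comp (facetPar_smooth F).continuousOn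
      (mapsTo_facetPar hp)).continuousOn_deriv_at t
  have hsum : ∀ {C : Vec (n + 1) → Mat (n + 2)},
      (∀ i j, ContinuousOn (fun y => C y i j) (simplex (n + 1))) →
      (∀ s ∈ M.sides F, ∀ y ∈ simplex (n + 1),
        (M.elem s.1).dbary s.2 (M.facetPar F y) ᵥ* C y = 0) →
      ContinuousOn (fun y => ∑ s ∈ M.sides F, (M.secondFF (g t) s (M.facetPar F y) * C y).trace)
        (simplex (n + 1)) := by
    intro C hC h0
    have h := continuousOn_finsetSum (M.sides F) fun s hs =>
      continuousOn_finsetSum Finset.univ fun i _ => continuousOn_finsetSum Finset.univ fun j _ =>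
        ((timeC1_levelForm_facet hg hC1 hs i j).continuousOn_at t).mul (hC j i)
    exact h.congr fun y hy => Finset.sum_congr rfl fun s hs =>
      trace_secondFF_mul (hg t) hy hs (h0 s hs y hy)
  have htr : ContinuousOn (fun y => tr (M.onFacet F (g t) y) (M.onFacet F (M.timeDeriv g t) y))
      (simplex (n + 1)) :=
    continuousOn_finsetSum Finset.univ fun p _ =>
      continuousOn_matrix_mul hHinv (fun p q => (hH p q).continuousOn_deriv_at t) p p
  refine (((timeC1_facetScale (F := F) hg hC1).continuousOn_at t).mul
    ((hsum (continuousOn_matrix_mul (continuousOn_matrix_mul hI hσ) hC) fun s hs y hy => ?_).sub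
      (htr.mul (hsum hC fun s hs y hy => vecMul_facetCof (hg t) hy hU hs)))).congr fun y hy => ?_
  · rw [Matrix.mul_assoc, vecMul_facetInv hy hs]
  · rw [triple_AFnnF (hg t) hy hU]
    simp only [Pi.mul_apply, Pi.sub_apply]
    ring

/-- The variation of the contribution of a facet. -/
theorem hasDerivAt_intFacet (hF : F ∈ M.intFacets) (t : ℝ) :
    HasDerivAt (fun t => M.intFacet (g t) F fun y => ip (M.onFacet F (g t) y)
        (ofMat (M.jump F (M.secondFF (g t)) y)) (ofMat (M.AFnnF (g t) (M.testA (g t) U) F y)))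
      ((1 / 2) * M.intFacet (g t) F (fun y => triple (M.onFacet F (g t) y)
          (M.jump F (M.secondFF (g t)) y)
          (traceRev (M.onFacet F (g t) y) (M.onFacet F (M.timeDeriv g t) y))
          (M.AFnnF (g t) (M.testA (g t) U) F y)) +
        (1 / 2) * M.intFacet (g t) F (fun y => ip (M.onFacet F (g t) y)
          (ofMat (M.jump F (M.facetForm (g t) (M.timeDeriv g t)) y))
          (ofMat (M.AFnnF (g t) (M.testA (g t) U) F y)))) t := by
  simp only [intFacet, volInt, ← integral_const_mul]
  exact (timeC1_facet hg hC1 hU hF).hasDerivAt_integral_add isCompact_simplex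
    (continuousOn_const.mul (continuousOn_triple_facet hg hC1 hU t))

end Facet

end Mesh

/-! ### The variation on subsimplices of codimension 2 -/

namespace Mesh

variable {n : ℕ} {M : Mesh n}

section Flags

/-- The flag with the same element and the same subsimplex of codimension 2, but the other one of
the two facets between them. -/
def swapFlag (f : M.Flag) : M.Flag :=
  (f.1, f.2.1.succAbove f.2.2, (Fin.exists_succAbove_eq (Fin.succAbove_ne f.2.1 f.2.2).symm).choose)

theorem swapFlag_succAbove (f : M.Flag) :
    (swapFlag f).2.1.succAbove (swapFlag f).2.2 = f.2.1 :=
  (Fin.exists_succAbove_eq (Fin.succAbove_ne f.2.1 f.2.2).symm).choose_spec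

theorem swapFlag_swapFlag (f : M.Flag) : swapFlag (swapFlag f) = f := by
  have h1 : (swapFlag (swapFlag f)).2.1 = f.2.1 := swapFlag_succAbove f
  have h2 := swapFlag_succAbove (swapFlag f)
  rw [h1] at h2
  have h3 : (swapFlag (swapFlag f)).2.2 = f.2.2 := Fin.succAbove_right_injective h2
  exact Prod.ext rfl (Prod.ext h1 h3)

theorem flagSet_swapFlag (f : M.Flag) : M.flagSet (swapFlag f) = M.flagSet f := by
  rw [flagSet, flagSet, swapFlag_succAbove, Finset.pair_comm]
  rfl

open Classical in
/-- All flags with a given subsimplex of codimension 2. -/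
def flagsOf (E : M.Ridge) : Finset M.Flag := {f | M.flagSet f = E.1}

theorem mem_flagsOf {E : M.Ridge} {f : M.Flag} : f ∈ M.flagsOf E ↔ M.flagSet f = E.1 := by
  simp only [flagsOf, Finset.mem_filter_univ]

theorem flag_mem_flagsOf (E : M.Ridge) : M.flag E ∈ M.flagsOf E := mem_flagsOf.mpr E.2.choose_spec

theorem sum_facetsAt_flagsAt (E : M.Ridge) (h : M.Flag → ℝ) :
    ∑ F ∈ M.facetsAt E, ∑ f ∈ M.flagsAt E F, h f = ∑ f ∈ M.flagsOf E, h f := by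
  classical
  rw [← Finset.sum_fiberwise_of_maps_to (s := M.flagsOf E) (t := M.facetsAt E)
    (g := fun f => (⟨M.sideSet (M.flagSide f), _, rfl⟩ : M.Facet)) fun f hf => ?_]
  · refine Finset.sum_congr rfl fun F _ => Finset.sum_congr ?_ fun _ _ => rfl
    ext f
    simp only [flagsAt, Finset.mem_filter, Finset.mem_univ, true_and, mem_flagsOf,
      Subtype.ext_iff]
  · simp only [facetsAt, Finset.mem_filter_univ]
    exact ⟨f, mem_flagsOf.mp hf, rfl⟩

theorem sum_elementsAt_add_swapFlag (E : M.Ridge) (h : M.Flag → ℝ) :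
    ∑ f ∈ M.elementsAt E, (h f + h (swapFlag f)) = ∑ f ∈ M.flagsOf E, h f := by
  classical
  have h1 : ∀ f, f ∈ M.elementsAt E ↔
      M.flagSet f = E.1 ∧ f.2.1 < f.2.1.succAbove f.2.2 := fun f => by
    simp only [elementsAt, Finset.mem_filter_univ]
  rw [← Finset.sum_filter_add_sum_filter_not (M.flagsOf E) fun f =>
    f.2.1 < f.2.1.succAbove f.2.2, Finset.sum_add_distrib]
  congr 1
  · refine Finset.sum_congr ?_ fun _ _ => rfl
    ext f
    rw [h1, Finset.mem_filter, mem_flagsOf]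
  · refine Finset.sum_nbij' swapFlag swapFlag (fun f hf => ?_) (fun f hf => ?_)
      (fun f _ => swapFlag_swapFlag f) (fun f _ => swapFlag_swapFlag f) fun _ _ => rfl
    · rw [h1] at hf
      rw [Finset.mem_filter, mem_flagsOf, flagSet_swapFlag, swapFlag_succAbove]
      exact ⟨hf.1, not_lt.mpr hf.2.le⟩
    · rw [Finset.mem_filter, mem_flagsOf] at hf
      rw [h1, flagSet_swapFlag, swapFlag_succAbove]
      exact ⟨hf.1, lt_of_le_of_ne (not_lt.mp hf.2) (Fin.succAbove_ne _ _)⟩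

end Flags

section RidgeGeometry

variable (E : M.Ridge)

theorem ridgePar_smooth : ContDiffOn ℝ ∞ (M.ridgePar E) (simplex n) :=
  (M.elem _).ridgeMap_smooth _ _

theorem jac_ridgePar_injective {y : Vec n} (hy : y ∈ simplex n) (w : Vec n)
    (hw : jac (M.ridgePar E) y *ᵥ w = 0) : w = 0 :=
  (M.elem _).jac_ridgeMap_injective _ _ hy w hw

variable {E}

theorem mapsTo_ridgePar_flagSet {f : M.Flag} (hf : f ∈ M.flagsOf E) :
    Set.MapsTo (M.ridgePar E) (simplex n) (M.flagSet f) := by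
  rw [mem_flagsOf.mp hf, ← mem_flagsOf.mp (flag_mem_flagsOf E)]
  exact (M.elem _).mapsTo_ridgeMap _ _

theorem mapsTo_ridgePar {f : M.Flag} (hf : f ∈ M.flagsOf E) :
    Set.MapsTo (M.ridgePar E) (simplex n) (M.elem f.1).carrier :=
  (mapsTo_ridgePar_flagSet hf).mono_right ((M.elem f.1).face_subset_carrier _)

theorem continuousOn_dbary_ridge {f : M.Flag} (hf : f ∈ M.flagsOf E) (a : Fin (n + 3))
    (i : Fin (n + 2)) :
    ContinuousOn (fun y => (M.elem f.1).dbary a (M.ridgePar E y) i) (simplex n) :=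
  ((M.elem _).dbary_smooth _ i).continuousOn.comp (ridgePar_smooth E).continuousOn
    (mapsTo_ridgePar hf)

end RidgeGeometry

section Ridge

/-- The metric-independent part of `A(𝔪, 𝔫, 𝔫, 𝔪)`. -/
def ridgeCof (U : M.FieldU) (E : M.Ridge) (y : Vec n) : ℝ :=
  (M.elem (M.flag E).1).dbary ((M.flag E).2.1.succAbove (M.flag E).2.2) (M.ridgePar E y) ⬝ᵥ
    (cofactorMat (U (M.flag E).1 (M.ridgePar E y))
      ((M.elem (M.flag E).1).dbary (M.flag E).2.1 (M.ridgePar E y)) *ᵥ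
      (M.elem (M.flag E).1).dbary ((M.flag E).2.1.succAbove (M.flag E).2.2) (M.ridgePar E y))

/-- The factor `(det g)⁻¹` times the inverse Gram determinant of the conormals of `E`, which is the
metric-dependent part of `A(𝔪, 𝔫, 𝔫, 𝔪)`. -/
def ridgeScale (g : M.Field2) (E : M.Ridge) (y : Vec n) : ℝ :=
  let G := g (M.flag E).1 (M.ridgePar E y)
  let ν := (M.elem (M.flag E).1).dbary (M.flag E).2.1 (M.ridgePar E y)
  let μ := (M.elem (M.flag E).1).dbary ((M.flag E).2.1.succAbove (M.flag E).2.2) (M.ridgePar E y)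
  (G.det * ((ν ⬝ᵥ (G⁻¹ *ᵥ ν)) * (μ ⬝ᵥ (G⁻¹ *ᵥ μ)) - (ν ⬝ᵥ (G⁻¹ *ᵥ μ)) ^ 2))⁻¹

variable {g : ℝ → M.Field2} {U : M.FieldU} (hg : ∀ t, M.IsReggeMetric (g t))
  (hC1 : M.IsC1Family g) (hU : M.IsTest U) {E : M.Ridge}
include hg hC1

/-- The variation of the angle deficit is half the sum of the jumps at the facets around `E`. -/
theorem timeC1_deficit :
    TimeC1 (simplex n) (fun t y => M.deficit (g t) E (M.ridgePar E y)) fun t y =>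
      (1 / 2) * ∑ F ∈ M.facetsAt E, M.jumpNM (g t) (M.timeDeriv g t) E F (M.ridgePar E y) := by
  have hmem : ∀ f ∈ M.elementsAt E, f ∈ M.flagsOf E := fun f hf => by
    simp only [elementsAt, Finset.mem_filter_univ] at hf
    exact mem_flagsOf.mpr hf.1
  have hangle := TimeC1.sum (M.elementsAt E) fun f hf => TimeC1.dihedralAngle
    (G := fun t y => g t f.1 (M.ridgePar E y))
    (σ := fun t y => M.timeDeriv g t f.1 (M.ridgePar E y))
    (ν := fun y => (M.elem f.1).dbary f.2.1 (M.ridgePar E y))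
    (μ := fun y => (M.elem f.1).dbary (f.2.1.succAbove f.2.2) (M.ridgePar E y))
    (fun i j => ((metricFamily hg hC1 f.1).timeC1_entry i j).comp (ridgePar_smooth E).continuousOn
      (mapsTo_ridgePar (hmem f hf)))
    (fun t y hy => (hg t).symm _ _ (mapsTo_ridgePar (hmem f hf) hy))
    (fun t y hy => (hg t).pos _ _ (mapsTo_ridgePar (hmem f hf) hy))
    (fun t y hy => (metricFamily hg hC1 f.1).symm t _ (mapsTo_ridgePar (hmem f hf) hy))
    (continuousOn_dbary_ridge (hmem f hf) _) (continuousOn_dbary_ridge (hmem f hf) _)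
    (fun y hy => (M.elem f.1).dbary_ne_zero _ (mapsTo_ridgePar (hmem f hf) hy))
    fun y hy => (M.elem f.1).dbary_ne_smul (Fin.succAbove_ne _ _).symm
      (mapsTo_ridgePar (hmem f hf) hy)
  refine ((TimeC1.const (continuousOn_const (c := 2 * Real.pi))).sub hangle).congr
    (fun t y hy => rfl) fun t y hy => ?_
  simp only [jumpNM]
  rw [sum_facetsAt_flagsAt, ← sum_elementsAt_add_swapFlag, Finset.mul_sum, zero_sub,
    ← Finset.sum_neg_distrib]
  refine Finset.sum_congr rfl fun f _ => ?_
  rw [neg_neg]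
  have h : M.conrm (g t) (swapFlag f) (M.ridgePar E y) = unitConormal (g t f.1 (M.ridgePar E y))
      ((M.elem f.1).dbary (f.2.1.succAbove f.2.2) (M.ridgePar E y))
      ((M.elem f.1).dbary f.2.1 (M.ridgePar E y)) := by
    rw [conrm, swapFlag_succAbove]
    rfl
  rw [h]
  rfl

theorem timeC1_ridgeScale :
    TimeC1 (simplex n) (fun t y =>
        √ (restrict (M.ridgePar E) y (g t (M.flag E).1 (M.ridgePar E y))).det *
          ridgeScale (g t) E y)
      fun t y => -((1 / 2) * tr (M.onRidge E (g t) y) (M.onRidge E (M.timeDeriv g t) y)) *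
        (√ (restrict (M.ridgePar E) y (g t (M.flag E).1 (M.ridgePar E y))).det *
          ridgeScale (g t) E y) :=
  have hf := flag_mem_flagsOf E
  TimeC1.ridgeFactor (G := fun t y => g t (M.flag E).1 (M.ridgePar E y))
    (σ := fun t y => M.timeDeriv g t (M.flag E).1 (M.ridgePar E y))
    (fun i j => ((metricFamily hg hC1 _).timeC1_entry i j).comp (ridgePar_smooth E).continuousOn
      (mapsTo_ridgePar hf))
    (fun t _ hy => (hg t).symm _ _ (mapsTo_ridgePar hf hy))
    (fun t _ hy => (hg t).pos _ _ (mapsTo_ridgePar hf hy))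
    (fun t _ hy => (metricFamily hg hC1 _).symm t _ (mapsTo_ridgePar hf hy))
    (continuousOn_dbary_ridge hf _) (continuousOn_dbary_ridge hf _)
    (fun _ hy => (M.elem _).dbary_ne_zero _ (mapsTo_ridgePar hf hy))
    (fun _ hy => (M.elem _).dbary_ne_smul (Fin.succAbove_ne _ _).symm (mapsTo_ridgePar hf hy))
    (continuousOn_jac (ridgePar_smooth E)) (fun _ hy => jac_ridgePar_injective E hy)
    (fun _ hy => (M.elem _).dbary_vecMul_jac (ridgePar_smooth E) (mapsTo_ridgePar_flagSet hf)
      (Finset.mem_insert_self _ _) hy)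
    (fun _ hy => (M.elem _).dbary_vecMul_jac (ridgePar_smooth E) (mapsTo_ridgePar_flagSet hf)
      (Finset.mem_insert_of_mem (Finset.mem_singleton_self _)) hy)

omit hC1 in
include hU in
theorem AmnnM_eq {y : Vec n} (hy : y ∈ simplex n) (t : ℝ) :
    M.AmnnM (g t) (M.testA (g t) U) E (M.ridgePar E y) =
      ridgeScale (g t) E y * ridgeCof U E y :=
  have hx := mapsTo_ridgePar (flag_mem_flagsOf E) hy
  eval_mapA_conormal ((hg t).symm _ _ hx) ((hg t).pos _ _ hx) ((M.elem _).dbary_ne_zero _ hx)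
    ((M.elem _).dbary_ne_smul (Fin.succAbove_ne _ _).symm hx) (hU.form _ _ hx)

omit hg hC1 in
include hU in
theorem continuousOn_ridgeCof : ContinuousOn (ridgeCof U E) (simplex n) := by
  have hf := flag_mem_flagsOf E
  unfold ridgeCof
  simp only [dotProduct, Matrix.mulVec]
  exact continuousOn_finsetSum _ fun i _ => ContinuousOn.mul (continuousOn_dbary_ridge hf _ i)
    (continuousOn_finsetSum _ fun j _ => ContinuousOn.mul (continuousOn_cofactorMat (fun I =>
      (hU.smooth _ I).continuousOn.comp (ridgePar_smooth E).continuousOn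
        (mapsTo_ridgePar hf)) (continuousOn_dbary_ridge hf _) i j) (continuousOn_dbary_ridge hf _ j))

include hU

/-- The integrand of the curvature functional on a subsimplex of codimension 2, and its time
derivative. -/
theorem timeC1_ridge :
    TimeC1 (simplex n) (fun t y => M.deficit (g t) E (M.ridgePar E y) *
        M.AmnnM (g t) (M.testA (g t) U) E (M.ridgePar E y) *
          √ (restrict (M.ridgePar E) y (g t (M.flag E).1 (M.ridgePar E y))).det)
      fun t y => -(1 / 2) * (tr (M.onRidge E (g t) y) (M.onRidge E (M.timeDeriv g t) y) *
            M.deficit (g t) E (M.ridgePar E y) *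
              M.AmnnM (g t) (M.testA (g t) U) E (M.ridgePar E y) *
          √ (restrict (M.ridgePar E) y (g t (M.flag E).1 (M.ridgePar E y))).det) +
        (1 / 2) * ((∑ F ∈ M.facetsAt E, M.jumpNM (g t) (M.timeDeriv g t) E F (M.ridgePar E y)) *
            M.AmnnM (g t) (M.testA (g t) U) E (M.ridgePar E y) *
          √ (restrict (M.ridgePar E) y (g t (M.flag E).1 (M.ridgePar E y))).det) := by
  refine (((timeC1_ridgeScale hg hC1 (E := E)).mul (TimeC1.const (continuousOn_ridgeCof (E := E) hU))).mul
    (timeC1_deficit hg hC1 (E := E))).congr (fun t y hy => ?_) fun t y hy => ?_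
  · rw [AmnnM_eq hg hU hy]
    ring
  · rw [AmnnM_eq hg hU hy]
    ring

/-- The variation of the contribution of a subsimplex of codimension 2. -/
theorem hasDerivAt_intRidge (t : ℝ) :
    HasDerivAt (fun t => M.intRidge (g t) E fun y => M.deficit (g t) E (M.ridgePar E y) *
        M.AmnnM (g t) (M.testA (g t) U) E (M.ridgePar E y))
      (-(1 / 2) * M.intRidge (g t) E (fun y =>
          tr (M.onRidge E (g t) y) (M.onRidge E (M.timeDeriv g t) y) *
            M.deficit (g t) E (M.ridgePar E y) *
              M.AmnnM (g t) (M.testA (g t) U) E (M.ridgePar E y)) +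
        (1 / 2) * M.intRidge (g t) E (fun y =>
          (∑ F ∈ M.facetsAt E, M.jumpNM (g t) (M.timeDeriv g t) E F (M.ridgePar E y)) *
            M.AmnnM (g t) (M.testA (g t) U) E (M.ridgePar E y))) t := by
  simp only [intRidge, volInt, ← integral_const_mul]
  refine (timeC1_ridge hg hC1 hU).hasDerivAt_integral_add isCompact_simplex
    (((((timeC1_ridgeScale (E := E) hg hC1).continuousOn_deriv_at t).mul (continuousOn_ridgeCof (E := E) hU)).mul
      ((timeC1_deficit (E := E) hg hC1).continuousOn_at t)).congr fun y hy => ?_)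
  rw [AmnnM_eq hg hU hy]
  simp only [Pi.mul_apply]
  ring

end Ridge

end Mesh

/-! ### The variation on elements -/

theorem SmoothMetric.riemann_smooth {m : ℕ} {D : Set (Vec m)} {G : Vec m → Mat m}
    (hG : SmoothMetric D G) (I : Fin 4 → Fin m) :
    ContDiffOn ℝ ∞ (fun x => riemann D G x I) D :=
  ContDiffOn.sum fun l _ => (hG.smooth _ l).mul
    (((pd_smooth hG.uniq (hG.christoffel_smooth _ _ _) _).sub
      (pd_smooth hG.uniq (hG.christoffel_smooth _ _ _) _)).add
      (ContDiffOn.sum fun _ _ => ((hG.christoffel_smooth _ _ _).mul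
        (hG.christoffel_smooth _ _ _)).sub ((hG.christoffel_smooth _ _ _).mul
        (hG.christoffel_smooth _ _ _))))

namespace Mesh

variable {n : ℕ} {M : Mesh n} {g : ℝ → M.Field2} {U : M.FieldU}
  (hg : ∀ t, M.IsReggeMetric (g t)) (hC1 : M.IsC1Family g) (hU : M.IsTest U)
include hg hC1 hU

/-- The part of the variation on an element that belongs to `aForm` is integrable by itself. -/
theorem continuousOn_aForm_element (i : M.ι) (t : ℝ) :
    ContinuousOn (fun x => ip (g t i x) (L1 (g t i x) (M.timeDeriv g t i x) (M.curv (g t) i x))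
          (M.testA (g t) U i x) -
        (1 / 2) * tr (g t i x) (M.timeDeriv g t i x) *
          ip (g t i x) (M.curv (g t) i x) (M.testA (g t) U i x)) (M.elem i).carrier := by
  have hfam := metricFamily hg hC1 i
  have hG : ∀ j k, ContinuousOn (fun x => g t i x j k) (M.elem i).carrier := fun j k =>
    ((hg t).smooth i j k).continuousOn
  have hdet : ∀ x ∈ (M.elem i).carrier, 0 < (g t i x).det := fun x hx =>
    det_pos_of_pos ((hg t).symm i x hx) ((hg t).pos i x hx)
  have hL : ∀ j k, ContinuousOn (fun x => Lend (g t i x) (M.timeDeriv g t i x) j k)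
      (M.elem i).carrier :=
    continuousOn_matrix_mul (continuousOn_matrix_inv hG fun x hx => (hdet x hx).ne')
      fun j k => (hC1.smooth_deriv t i j k).continuousOn
  have hR : ∀ I, ContinuousOn (fun x => M.curv (g t) i x I) (M.elem i).carrier := fun I =>
    ((hfam.metric t).riemann_smooth I).continuousOn
  have hip : ∀ {B : Vec (n + 2) → Tens (n + 2) (Fin 4)},
      (∀ I, ContinuousOn (fun x => B x I) (M.elem i).carrier) →
      ContinuousOn (fun x => ip (g t i x) (B x) (M.testA (g t) U i x)) (M.elem i).carrier := by
    intro B hB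
    have h := ((continuousOn_matrix_det hG).inv₀ fun x hx => (hdet x hx).ne').mul
      (continuousOn_finsetSum Finset.univ fun I _ =>
        (hB I).mul (continuousOn_cofactorTens (fun I => (hU.smooth i I).continuousOn) I))
    exact h.congr fun x hx => ip_mapA ((hg t).symm i x hx) (hdet x hx) (hU.form i x hx) _
  have htr : ContinuousOn (fun x => tr (g t i x) (M.timeDeriv g t i x)) (M.elem i).carrier :=
    continuousOn_finsetSum Finset.univ fun j _ => hL j j
  refine (hip fun I => ?_).sub ((continuousOn_const.mul htr).mul (hip hR))
  exact continuousOn_finsetSum _ fun q _ => (hL q (I 0)).mul (hR _)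

/-- The variation of the contribution of an element. -/
theorem hasDerivAt_intElem (i : M.ι) (t : ℝ) :
    HasDerivAt (fun t => M.intElem (g t) i fun x =>
        ip (g t i x) (M.curv (g t) i x) (M.testA (g t) U i x))
      (M.intElem (g t) i (fun x => ip (g t i x) (L1 (g t i x) (M.timeDeriv g t i x)
          (M.curv (g t) i x)) (M.testA (g t) U i x) -
        (1 / 2) * tr (g t i x) (M.timeDeriv g t i x) *
          ip (g t i x) (M.curv (g t) i x) (M.testA (g t) U i x)) +
        2 * M.intElem (g t) i (fun x => ip (g t i x)
          (hess (M.elem i).carrier (g t i) (M.timeDeriv g t i) x)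
            (swap23 (M.testA (g t) U i x)))) t := by
  simp only [intElem, volInt, ← integral_const_mul]
  have hΨ := (M.elem i).map_smooth.continuousOn
  have hm := (M.elem i).mapsTo_map
  have hJ := continuousOn_jac (M.elem i).map_smooth
  refine ((metricFamily hg hC1 i).timeC1_element (M.elem i).carrier_subset_closure_interior hΨ hm
    hJ (fun _ hy => (M.elem i).jac_map_injective hy)
    (fun I => (hU.smooth i I).continuousOn.comp hΨ hm)
    fun y hy => hU.form i _ (hm hy)).hasDerivAt_integral_add isCompact_simplex
    (((continuousOn_aForm_element hg hC1 hU i t).comp hΨ hm).mul ?_)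
  exact (continuousOn_matrix_det (continuousOn_matrix_mul (continuousOn_matrix_mul
    (fun p j => hJ j p) fun j k => ((hg t).smooth i j k).continuousOn.comp hΨ hm) hJ)).sqrt

end Mesh

end Regge

end

theorem mainTheorem3 {n : ℕ} (M : Regge.Mesh n) (g : ℝ → M.Field2)
    (hg : ∀ t, M.IsReggeMetric (g t)) (hC1 : M.IsC1Family g)
    (U : M.FieldU) (hU : M.IsTest U) (t : ℝ) :
    HasDerivAt (fun s => M.Qω (g s) U)
      (M.aForm (g t) (M.timeDeriv g t) (M.testA (g t) U)
        + M.bForm (g t) (M.timeDeriv g t) (M.testA (g t) U)) t := by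
  have h1 := HasDerivAt.fun_sum (u := Finset.univ) fun i _ =>
    Regge.Mesh.hasDerivAt_intElem hg hC1 hU i t
  have h2 := (HasDerivAt.fun_sum (u := M.intFacets) fun _ hF =>
    Regge.Mesh.hasDerivAt_intFacet hg hC1 hU hF t).const_mul 4
  have h3 := (HasDerivAt.fun_sum (u := M.intRidges) fun E _ =>
    Regge.Mesh.hasDerivAt_intRidge hg hC1 hU (E := E) t).const_mul 4
  refine ((h1.add h2).add h3).congr_deriv ?_
  simp only [Finset.sum_add_distrib, ← Finset.mul_sum, Regge.Mesh.aForm, Regge.Mesh.bForm]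
  ring
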